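/- Notation. $\mathbb{L}^3$ is $\mathbb{R}^3$ with the metric $\langle x,y\rangle = x_1y_1+x_2y_2-x_3y_3$; $v$ is a nonzero spacelike vector, $T(x)=x+v$, and $p_2:\mathbb{L}^3\to\mathbb{L}^3/\langle T\rangle$ is the projection. Let $M$ be a connected smooth surface and let $X:M\to\mathbb{L}^3/\langle T\rangle$ be a continuous map, surjective on fundamental groups. $X$ is a maximal immersion with isolated singularities at $F$ if $F\subset M$ is closed and discrete, $X|_{M\setminus F}$ is a smooth spacelike immersion with zero mean curvature, and the induced metric is singular at each $q\in F$: on a punctured disc around $q$ containing no other point of $F$ it can be written $H|dz|^2$ in a bounded isothermal parameter $z$, with $H>0$ and $H\to 0$ at $q$. Let $\tilde X:\tilde M\to\mathbb{L}^3$ be the lifting of $X$, where $\tilde M\to M$ is the covering with group $\ker X_*$, i.e. $\tilde M=\{(p,x)\in M\times\mathbb{L}^3 : X(p)=p_2(x)\}$ and $\tilde X(p,x)=x$. $X$ is entire if for some spacelike plane $\Pi$ the orthogonal projection $\pi\circ\tilde X:\tilde M\to\Pi$ is a branched covering, i.e. it is locally equivalent to $z\mapsto z^n$ ($n\ge1$)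 on the unit disc and it has the (not necessarily unique) path lifting property. An entire $X$ is of finite type if $M$ has finite topology ($M$ is homeomorphic to a compact surface $\overline M$ without boundary minus a finite set of points, the ends), $F$ is finite, and some timelike geodesic $\gamma$ of $\mathbb{L}^3/\langle T\rangle$ meets the surface finitely often, i.e. $\{(p,t)\in M\times\mathbb{R} : X(p)=\gamma(t)\}$ is finite (equivalently, $\tilde X$ is a finitely sheeted multigraph). In a conformal parameter $z$ of $M\setminus F$ put $\phi_j=2\,\partial X_j/\partial z\,dz$. The Weierstrass data $(g,\phi_3)$, with $|g|<1$ (this fixes the orientation), are given by $\phi_1=\frac i2\left(\frac1g-g\right)\phi_3$ and $\phi_2=-\frac12\left(\frac1g+g\right)\phi_3$. Put $\omega=\phi_3/g$; it is well defined also at zeros of $g$, by $\phi_1=\frac i2(1-g^2)\omega$, $\phi_2=-\frac12(1+g^2)\omega$, $\phi_3=g\omega$. Lemma. Let $X:M\to\mathbb{L}^3/\langle T\rangle$ be an entire maximal immersion of finite type, with singular set $F$, and let $P\in\overline M\setminus M$ be an end. Then: (1) Some punctured neighbourhood of $P$ in $M\setminus F$ is conformally equivalent to a punctured disc $\{0<|z|<r\}$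 with $P$ corresponding to $z=0$, by a parameter in which the Weierstrass data with $|g|<1$ are defined; and in every such conformal parametrization the form $\omega=\phi_3/g$ has a simple pole at $z=0$ (it extends meromorphically to $z=0$, with order exactly $-1$). (2) $X$ is asymptotic at $P$ to a totally geodesic spacelike half cylinder of $\mathbb{L}^3/\langle T\rangle$, with some multiplicity $w\ge1$. Precisely: there are a point $p_0$, a unit spacelike vector $e\perp v$, a unit timelike vector $n\perp v,e$, an integer $w\ge1$, a function $u$ on $\mathbb{R}\times[0,\infty)$, and a continuous map $\chi:\mathbb{R}\times[0,\infty)\to M$ satisfying $\chi(s,t)=\chi(s',t')$ if and only if $t=t'$ and $s-s'\in w\mathbb{Z}$, such that the image of $\chi$ together with $P$ is a neighbourhood of $P$, $\chi(s,t)\to P$ and $u(s,t)\to0$ as $t\to\infty$ uniformly in $s$, and $X(\chi(s,t))=p_2\big(p_0+s\,v+t\,e+u(s,t)\,n\big)$. The half cylinder is $C=p_2\big(\{p_0+sv+te : s\in\mathbb{R},\ t\ge0\}\big)$. -/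

import Mathlib

open scoped Manifold ContDiff Topology

namespace MaxSurf

noncomputable section

/-! ### The Lorentz-Minkowski space and its quotient by a translation -/

/-- The vector space underlying `𝕃³`. -/
abbrev L3 := Fin 3 → ℝ

/-- The Lorentzian inner product `dx₁² + dx₂² - dx₃²`. -/
def lor (x y : L3) : ℝ := x 0 * y 0 + x 1 * y 1 - x 2 * y 2

/-- `𝕃³ / ⟨T⟩`, where `T` is the translation of vector `v`. -/
abbrev Quo (v : L3) := L3 ⧸ AddSubgroup.zmultiples v

/-- The covering projection `𝕃³ → 𝕃³ / ⟨T⟩`. -/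
def toQuo (v : L3) (x : L3) : Quo v := (x : L3 ⧸ AddSubgroup.zmultiples v)

/-- `f` is a continuous lift to `𝕃³` of the map `Y : S → 𝕃³ / ⟨T⟩` on the open set `U`. Any two such
lifts differ by a locally constant translation, so derivatives of `f` only depend on `Y`. -/
structure IsLocalLift {S : Type*} [TopologicalSpace S] (v : L3) (Y : S → Quo v) (U : Set S)
    (f : S → L3) : Prop where
  isOpen : IsOpen U
  continuousOn : ContinuousOn f U
  lifts : ∀ p ∈ U, toQuo v (f p) = Y p

/-! ### Spacelike and maximal immersions -/

/-- The parameter plane `ℝ²`. -/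
abbrev E2 := EuclideanSpace ℝ (Fin 2)

/-- The `i`-th coordinate vector of `ℝ²`. -/
def coordVec (i : Fin 2) : E2 := EuclideanSpace.single i 1

/-- `f : ℝ² → 𝕃³` is a spacelike immersion at `x`: the induced metric is positive definite. -/
def SpacelikeAt (f : E2 → L3) (x : E2) : Prop :=
  ∀ w : E2, w ≠ 0 → 0 < lor (fderiv ℝ f x w) (fderiv ℝ f x w)

/-- Coefficients `g i j` of the first fundamental form. -/
def firstForm (f : E2 → L3) (x : E2) (i j : Fin 2) : ℝ :=
  lor (fderiv ℝ f x (coordVec i)) (fderiv ℝ f x (coordVec j))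

/-- Coefficients of the second fundamental form in the direction of a normal vector `ν`. -/
def secondForm (f : E2 → L3) (x : E2) (ν : L3) (i j : Fin 2) : ℝ :=
  lor (fderiv ℝ (fderiv ℝ f) x (coordVec i) (coordVec j)) ν

/-- Zero mean curvature at `x`: the trace of the second fundamental form with respect to the first
one, `(G e - 2 F f + E g) / (E G - F²)`, vanishes (where `E G - F² > 0` for spacelike immersions).
-/
def ZeroMeanCurvatureAt (f : E2 → L3) (x : E2) : Prop :=
  ∀ ν : L3, (∀ w : E2, lor (fderiv ℝ f x w) ν = 0) →
    firstForm f x 1 1 * secondForm f x ν 0 0 - 2 * firstForm f x 0 1 * secondForm f x ν 0 1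
      + firstForm f x 0 0 * secondForm f x ν 1 1 = 0

section Surface

variable {M : Type*} [TopologicalSpace M]

/-- `X : M → 𝕃³ / ⟨T⟩` is, at the point `p`, a smooth spacelike immersion with zero mean curvature
(read in the chart at `p`). -/
def MaximalAt [ChartedSpace E2 M] (v : L3) (X : M → Quo v) (p : M) : Prop :=
  ∃ (U : Set M) (f : M → L3), p ∈ U ∧ IsLocalLift v X U f ∧
    ContDiffAt ℝ ∞ (f ∘ (extChartAt (𝓡 2) p).symm) (extChartAt (𝓡 2) p p) ∧
    SpacelikeAt (f ∘ (extChartAt (𝓡 2) p).symm) (extChartAt (𝓡 2) p p) ∧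
    ZeroMeanCurvatureAt (f ∘ (extChartAt (𝓡 2) p).symm) (extChartAt (𝓡 2) p p)

/-- `ψ : Ω → M` is (the inverse of) an isothermal parameter for the metric induced by `X` on its
image, which avoids the set `F`, and the metric is `H |dz|²` in this parameter. -/
structure IsIsothermal (v : L3) (X : M → Quo v) (F : Set M) (Ω : Set ℂ) (ψ : ℂ → M) (H : ℂ → ℝ) :
    Prop where
  isOpen : IsOpen Ω
  continuousOn : ContinuousOn ψ Ω
  injOn : Set.InjOn ψ Ω
  isOpen_image : IsOpen (ψ '' Ω)
  avoids : ∀ z ∈ Ω, ψ z ∉ F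
  conformal : ∀ z ∈ Ω, ∃ (U : Set ℂ) (f : ℂ → L3), z ∈ U ∧ IsLocalLift v (X ∘ ψ) U f ∧
    ContDiffAt ℝ ∞ f z ∧ 0 < H z ∧
    lor (fderiv ℝ f z 1) (fderiv ℝ f z 1) = H z ∧
    lor (fderiv ℝ f z Complex.I) (fderiv ℝ f z Complex.I) = H z ∧
    lor (fderiv ℝ f z 1) (fderiv ℝ f z Complex.I) = 0

/-- The induced metric is singular at `q ∈ F`: on a punctured disc around `q` containing no other
point of `F` there is a (bounded) isothermal parameter whose conformal factor tends to `0` at `q`.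
-/
def MetricSingularAt (v : L3) (X : M → Quo v) (F : Set M) (q : M) : Prop :=
  ∃ d : OpenPartialHomeomorph M ℂ, q ∈ d.source ∧ d.target = Metric.ball 0 1 ∧
    d.source ∩ F = {q} ∧
    ∃ (Ω : Set ℂ) (ψ : ℂ → M) (H : ℂ → ℝ), Bornology.IsBounded Ω ∧ IsIsothermal v X F Ω ψ H ∧
      ψ '' Ω = d.source \ {q} ∧
      Filter.Tendsto H (Filter.comap ψ (𝓝 q) ⊓ Filter.principal Ω) (𝓝 0)

/-- `X` is a maximal immersion with isolated singularities, and `F` is its singular set. -/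
structure IsMaximalWithSingularities [ChartedSpace E2 M] (v : L3) (X : M → Quo v) (F : Set M) :
    Prop where
  continuous : Continuous X
  isClosed : IsClosed F
  isDiscrete : IsDiscrete F
  maximalAt : ∀ p, p ∉ F → MaximalAt v X p
  singularAt : ∀ q ∈ F, MetricSingularAt v X F q

/-! ### Multigraphs, entire surfaces, finite type -/

/-- A branched local homeomorphism: around each point, `h` looks like `z ↦ zⁿ`, `n ≥ 1`, on the unit
disc. -/
def IsBranchedLocalHomeo {S P : Type*} [TopologicalSpace S] [TopologicalSpace P] (h : S → P) :
    Prop :=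
  ∀ p : S, ∃ (n : ℕ) (e₁ : OpenPartialHomeomorph S ℂ) (e₂ : OpenPartialHomeomorph P ℂ), 1 ≤ n ∧
    p ∈ e₁.source ∧ e₁ p = 0 ∧ e₁.target = Metric.ball 0 1 ∧ e₂.target = Metric.ball 0 1 ∧
    h '' e₁.source = e₂.source ∧ ∀ q ∈ e₁.source, e₂ (h q) = e₁ q ^ n

/-- A branched covering: a branched local homeomorphism with the (not necessarily unique) path
lifting property. -/
structure IsBranchedCovering {S P : Type*} [TopologicalSpace S] [TopologicalSpace P] (h : S → P) :
    Prop where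
  continuous : Continuous h
  branched : IsBranchedLocalHomeo h
  path_lifting : ∀ (β : C(unitInterval, P)) (p : S), h p = β 0 →
    ∃ α : C(unitInterval, S), α 0 = p ∧ ∀ t, h (α t) = β t

/-- The spacelike plane through the origin orthogonal to the timelike vector `n`. -/
abbrev OrthPlane (n : L3) := {x : L3 // lor x n = 0}

/-- Lorentzian orthogonal projection onto the spacelike plane orthogonal to `n`, `⟨n, n⟩ = -1`. -/
def orthProj (n : L3) (hn : lor n n = -1) (x : L3) : OrthPlane n :=
  ⟨x + lor x n • n, by
    have h : lor (x + lor x n • n) n = lor x n + lor x n * lor n n := by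
      simp only [lor, Pi.add_apply, Pi.smul_apply, smul_eq_mul]; ring
    rw [h, hn]; ring⟩

/-- The lifting `M̃` of `M`: the pullback by `X` of the universal covering `𝕃³ → 𝕃³ / ⟨T⟩`. The first
projection `M̃ → M` is a covering; when `X` is surjective on fundamental groups, `M̃` is connected
and is the covering of `M` with fundamental group `ker X_*`. -/
abbrev Lifting (v : L3) (X : M → Quo v) := {q : M × L3 // X q.1 = toQuo v q.2}

/-- The lifting `X̃ : M̃ → 𝕃³` of `X`. -/
def liftMap (v : L3) (X : M → Quo v) (q : Lifting v X) : L3 := q.1.2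

/-- `X` is entire: its lifting is an entire multigraph over some spacelike plane, that is, the
orthogonal projection of the lifting to the plane is a branched covering. -/
def IsEntire (v : L3) (X : M → Quo v) : Prop :=
  ∃ (n : L3) (hn : lor n n = -1), IsBranchedCovering (orthProj n hn ∘ liftMap v X)

/-- Some timelike geodesic `t ↦ [a + t b]` of `𝕃³ / ⟨T⟩` meets the surface only finitely often
(counting the points `p` of `M`), i.e. the lifting has finitely many sheets over the plane
orthogonal to `b`. -/
def FinitelySheeted (v : L3) (X : M → Quo v) : Prop :=
  ∃ a b : L3, lor b b < 0 ∧ {q : M × ℝ | X q.1 = toQuo v (a + q.2 • b)}.Finite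

/-- `ι` exhibits `M` as the complement of finitely many points (the ends of `M`) in the surface `N`.
A surface has finite topology when there is such an `ι` with `N` a closed surface. -/
structure IsEndCompactification {N : Type*} [TopologicalSpace N] (ι : M → N) : Prop where
  isOpenEmbedding : Topology.IsOpenEmbedding ι
  finite_ends : (Set.range ι)ᶜ.Finite

/-! ### Weierstrass data at the ends -/

/-- The component `φ_j = 2 (∂f_j / ∂z)` (coefficient of `dz`) of the form `Φ` with `f = Re ∫ Φ`. -/
def phi (f : ℂ → L3) (z : ℂ) (j : Fin 3) : ℂ :=
  (fderiv ℝ f z 1 j : ℂ) - Complex.I * (fderiv ℝ f z Complex.I j : ℂ)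

/-- `(g, φ₃)` are the Weierstrass data of `X` in the conformal parametrization `ψ : Ω → M`,
normalized by `|g| < 1`, and `η = φ₃ / g`. The equations are `φ₃ = g η` and
`φ₁ = (i/2) (1/g - g) φ₃`, `φ₂ = -(1/2) (1/g + g) φ₃` with `φ₃ / g` written as `η`, so that they make
sense at the zeros of `g` as well; they determine `g` and `η`. -/
structure IsWeierstrassData (v : L3) (X : M → Quo v) (Ω : Set ℂ) (ψ : ℂ → M) (g φ₃ η : ℂ → ℂ) :
    Prop where
  norm_lt_one : ∀ z ∈ Ω, ‖g z‖ < 1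
  form_eq : ∀ z ∈ Ω, φ₃ z = g z * η z
  phi_eq : ∀ z ∈ Ω, ∃ (U : Set ℂ) (f : ℂ → L3), z ∈ U ∧ IsLocalLift v (X ∘ ψ) U f ∧
    DifferentiableAt ℝ f z ∧
    phi f z 0 = Complex.I / 2 * (η z - g z * φ₃ z) ∧
    phi f z 1 = -(1 / 2) * (η z + g z * φ₃ z) ∧
    phi f z 2 = φ₃ z

/-- The punctured disc of radius `r`. -/
def puncturedDisc (r : ℝ) : Set ℂ := {z | 0 < ‖z‖ ∧ ‖z‖ < r}

/-- `ψ` is a conformal parametrization, by the punctured disc of radius `r` and with Weierstrass data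
`(g, φ₃)`, `φ₃ / g = η`, of a punctured neighbourhood of the end `P`; the puncture `0` corresponds
to `P`. -/
structure IsConformalEnd {N : Type*} [TopologicalSpace N] (v : L3) (X : M → Quo v) (F : Set M)
    (ι : M → N) (P : N) (r : ℝ) (ψ : ℂ → M) (g φ₃ η : ℂ → ℂ) : Prop where
  pos : 0 < r
  isothermal : ∃ H : ℂ → ℝ, IsIsothermal v X F (puncturedDisc r) ψ H
  tendsto : Filter.Tendsto (ι ∘ ψ) (𝓝[≠] 0) (𝓝 P)
  data : IsWeierstrassData v X (puncturedDisc r) ψ g φ₃ η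

/-- The 1-form `η(z) dz` has a simple pole at `0`. -/
def HasSimplePole (η : ℂ → ℂ) : Prop := MeromorphicAt η 0 ∧ meromorphicOrderAt η 0 = ((-1 : ℤ) : WithTop ℤ)

/-! ### Asymptotics of the ends -/

/-- The totally geodesic half cylinder `{p₀ + s v + t e : s ∈ ℝ, t ≥ 0} / ⟨T⟩`. -/
def halfCylinder (v p₀ e : L3) : Set (Quo v) :=
  {y | ∃ s t : ℝ, 0 ≤ t ∧ y = toQuo v (p₀ + s • v + t • e)}

/-- A set is a totally geodesic spacelike half cylinder, with axis direction `v`, initial point `p₀`,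
unit conormal `e` and unit timelike normal `n`. -/
structure IsSpacelikeHalfCylinder (v : L3) (C : Set (Quo v)) (p₀ e n : L3) : Prop where
  eq : C = halfCylinder v p₀ e
  axis_spacelike : 0 < lor v v
  conormal_unit : lor e e = 1
  conormal_orth : lor e v = 0
  normal_unit : lor n n = -1
  normal_orth_axis : lor n v = 0
  normal_orth_conormal : lor n e = 0

/-- Near the end `P` the surface is asymptotic, with multiplicity `w`, to the half cylinder `C`: a
punctured neighbourhood of `P`, parametrized by `χ` over the `w`-fold cover
`(ℝ / w ℤ) × [0, ∞)` of `C`, is the normal graph over this cover of a function `u` which tends to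
`0` at infinity (uniformly in the circle direction). -/
def AsymptoticWithMultiplicity {N : Type*} [TopologicalSpace N] (v : L3) (X : M → Quo v)
    (ι : M → N) (P : N) (C : Set (Quo v)) (w : ℕ) : Prop :=
  ∃ (p₀ e n : L3) (χ : ℝ × ℝ → M) (u : ℝ × ℝ → ℝ),
    IsSpacelikeHalfCylinder v C p₀ e n ∧
    ContinuousOn χ {q | 0 ≤ q.2} ∧
    (∀ q q' : ℝ × ℝ, 0 ≤ q.2 → 0 ≤ q'.2 →
      (χ q = χ q' ↔ q.2 = q'.2 ∧ ∃ k : ℤ, q'.1 = q.1 + k * w)) ∧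
    insert P ((ι ∘ χ) '' {q | 0 ≤ q.2}) ∈ 𝓝 P ∧
    Filter.Tendsto (ι ∘ χ) (Filter.comap Prod.snd Filter.atTop) (𝓝 P) ∧
    (∀ q : ℝ × ℝ, 0 ≤ q.2 → X (χ q) = toQuo v (p₀ + q.1 • v + q.2 • e + u q • n)) ∧
    Filter.Tendsto u (Filter.comap Prod.snd Filter.atTop) (𝓝 0)

end Surface

end

end MaxSurf

/-!
The lifting `X̃` of an entire surface projects to a spacelike plane `Π`. Choose an orthonormal frame
`(a, b, n)` with `n ⊥ Π` and `b` orthogonal to the period `v`, so that the coordinate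
`⟨·, b⟩` is defined on the quotient.

*Sheets.* Maximal graphs are spacelike, so lifts of straight segments cannot branch off the singular
set and the height varies less than the horizontal distance. With finitely many intersections with
one timelike line this bounds every fibre, and a branched covering with finite fibres is proper
(`IsBranchedCovering.finite_fiber`, `IsBranchedCovering.isProperMap`). Hence `⟨X, b⟩` is proper on
`M` and tends to `+∞` or to `-∞` at each end (`EntireData.tendsto_atTop_or`). Replacing `b` by `-b`,
assume it tends to `+∞`. Over a half plane `{Im c > y₀}` free of singular values the lifting consists
of global graphs of functions `φ`, and some translation by `w v`, `w ≥ 1`, preserves each of them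
(`EntireData.exists_sheet`); one such graph modulo its period is a punctured neighbourhood of the end
(`EntireData.exists_sheet_at_end`).

*Conformal type.* The equation of maximal graphs says that certain 1-forms are closed. Their
primitives give Lewy's map, an isothermal parameter for the graph which does not decrease distances;
hence its image contains a half plane up to normalization, and the exponential map of the quotient by
the period is an isothermal parameter by a punctured disc (`exists_isGraphParam`,
`EntireData.exists_isothermal_end`). In any isothermal parameter the coordinates of a maximal surface
are harmonic, so `Φ = 2 ∂X` is holomorphic and null (`IsIsothermal.exists_form`). The Gauss map
avoids the unit circle, so on a connected domain `|g| < 1` holds up to conjugating the parameter.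

*Simple pole.* In a punctured disc the form `Θ = ⟨Φ, b⟩` has `Re ∫ Θ = ⟨X, b⟩`, which is single valued
and tends to `+∞`. The period of `∫ Θ` is imaginary, so `z ^ κ exp (-∫ Θ)` is single valued for some
real `κ`; it is meromorphic at the puncture, as `exp (-⟨X, b⟩)` is bounded, and its logarithmic
derivative `κ / z - Θ` has at most a simple pole. Were the residue of `Θ` zero, `⟨X, b⟩` would be
bounded (`exists_simple_pole`). Since `|g| < 1`, the Gauss map extends to the puncture and
`η = Θ / ⟨W(g), b⟩`, where `W(g)` is the null vector with `Φ = W(g) η`; its product with `b` does not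
vanish because the real and imaginary parts of `W(g)` span a spacelike plane and `b` is spacelike
(`IsWeierstrassData.exists_residue`).

*Asymptotics.* The null residue `c` of `Φ` has real and imaginary parts which are orthogonal of equal
positive length, and its period `2π Im c` is a nonzero multiple `k v` of `v`. So up to a smooth
remainder vanishing at the puncture, `X` is the parametrization
`ζ ↦ Re (c ζ)`, `ζ = log z`, of the `|k|`-fold half cylinder, and the inverse function theorem turns
this into a graph over the half cylinder (`asymptotic_of_expansion`).
-/

open scoped Manifold ContDiff Topology

namespace MaxSurf

noncomputable section

/-! ### Orthonormal frames of the Lorentz-Minkowski space -/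

theorem lor_comm (x y : L3) : lor x y = lor y x := by simp only [lor]; ring

@[simp] theorem lor_add_left (x y z : L3) : lor (x + y) z = lor x z + lor y z := by
  simp only [lor, Pi.add_apply]; ring

@[simp] theorem lor_add_right (x y z : L3) : lor x (y + z) = lor x y + lor x z := by
  simp only [lor, Pi.add_apply]; ring

@[simp] theorem lor_sub_right (x y z : L3) : lor x (y - z) = lor x y - lor x z := by
  simp only [lor, Pi.sub_apply]; ring

@[simp] theorem lor_smul_left (c : ℝ) (x y : L3) : lor (c • x) y = c * lor x y := by
  simp only [lor, Pi.smul_apply, smul_eq_mul]; ring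

@[simp] theorem lor_smul_right (c : ℝ) (x y : L3) : lor x (c • y) = c * lor x y := by
  simp only [lor, Pi.smul_apply, smul_eq_mul]; ring

@[simp] theorem lor_neg_left (x y : L3) : lor (-x) y = -lor x y := by
  simp only [lor, Pi.neg_apply]; ring

@[simp] theorem lor_neg_right (x y : L3) : lor x (-y) = -lor x y := by
  simp only [lor, Pi.neg_apply]; ring

@[simp] theorem lor_zero_left (y : L3) : lor 0 y = 0 := by simp [lor]

@[simp] theorem lor_zero_right (y : L3) : lor y 0 = 0 := by simp [lor]

/-- The linear functional `x ↦ ⟨x, y⟩`. -/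
def lorL (y : L3) : L3 →L[ℝ] ℝ :=
  y 0 • ContinuousLinearMap.proj 0 + y 1 • ContinuousLinearMap.proj 1
    - y 2 • ContinuousLinearMap.proj 2

@[simp] theorem lorL_apply (y x : L3) : lorL y x = lor x y := by
  simp [lorL, lor]; ring

/-- An orthonormal frame of `𝕃³`: `a` and `b` are spacelike and `n` is timelike. -/
structure LorFrame (a b n : L3) : Prop where
  aa : lor a a = 1
  bb : lor b b = 1
  nn : lor n n = -1
  ab : lor a b = 0
  an : lor a n = 0
  bn : lor b n = 0

/-- The Lorentzian cross product. -/
def cross (x y : L3) : L3 :=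
  ![x 1 * y 2 - x 2 * y 1, x 2 * y 0 - x 0 * y 2, -(x 0 * y 1 - x 1 * y 0)]

theorem lor_cross_left (x y : L3) : lor x (cross x y) = 0 := by
  simp [lor, cross]; ring

theorem lor_cross_right (x y : L3) : lor y (cross x y) = 0 := by
  simp [lor, cross]; ring

/-- The cross product of orthonormal spacelike vectors is unit timelike, and that of a unit spacelike
and an orthogonal unit timelike vector is unit spacelike. -/
theorem lor_cross_self (x y : L3) :
    lor (cross x y) (cross x y) = lor x y ^ 2 - lor x x * lor y y := by
  simp [lor, cross]; ring

theorem LorFrame.of_timelike {a n : L3} (ha : lor a a = 1) (hn : lor n n = -1)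
    (han : lor a n = 0) : LorFrame a (cross a n) n :=
  ⟨ha, by rw [lor_cross_self, ha, hn, han]; norm_num, hn, lor_cross_left _ _, han,
    by rw [lor_comm]; exact lor_cross_right _ _⟩

theorem LorFrame.of_spacelike {a b : L3} (ha : lor a a = 1) (hb : lor b b = 1)
    (hab : lor a b = 0) : LorFrame a b (cross a b) :=
  ⟨ha, hb, by rw [lor_cross_self, ha, hb, hab]; norm_num, hab, lor_cross_left _ _,
    lor_cross_right _ _⟩

theorem LorFrame.neg {a b n : L3} (h : LorFrame a b n) : LorFrame a (-b) n :=
  ⟨h.aa, by simp [h.bb], h.nn, by simp [h.ab], h.an, by simp [h.bn]⟩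

/-- Expansion of a vector in an orthonormal frame. The proof inverts the Gram relation
`AᵀηA = η` of the matrix `A` of the frame. -/
theorem LorFrame.expand {a b n : L3} (h : LorFrame a b n) (x : L3) :
    x = lor x a • a + lor x b • b - lor x n • n := by
  let A : Matrix (Fin 3) (Fin 3) ℝ := Matrix.of ![a, b, n]
  let B : Matrix (Fin 3) (Fin 3) ℝ :=
    Matrix.of ![![a 0, b 0, -n 0], ![a 1, b 1, -n 1], ![-a 2, -b 2, n 2]]
  obtain ⟨haa, hbb, hnn, hab, han, hbn⟩ := h
  simp only [lor] at haa hbb hnn hab han hbn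
  have hAB : A * B = 1 := by
    ext i j
    fin_cases i <;> fin_cases j <;> simp [A, B, Matrix.mul_apply, Fin.sum_univ_three] <;> linarith
  have hBA := mul_eq_one_comm.mp hAB
  have e (i j : Fin 3) := congrFun (congrFun hBA i) j
  have e00 := e 0 0
  have e01 := e 0 1
  have e02 := e 0 2
  have e10 := e 1 0
  have e11 := e 1 1
  have e12 := e 1 2
  have e20 := e 2 0
  have e21 := e 2 1
  have e22 := e 2 2
  simp [A, B, Matrix.mul_apply, Fin.sum_univ_three] at e00 e01 e02 e10 e11 e12 e20 e21 e22
  ext i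
  fin_cases i
  · simp [lor]
    linear_combination (-x 0) * e00 - x 1 * e10 - x 2 * e20
  · simp [lor]
    linear_combination (-x 0) * e01 - x 1 * e11 - x 2 * e21
  · simp [lor]
    linear_combination (-x 0) * e02 - x 1 * e12 - x 2 * e22

theorem LorFrame.lor_eq {a b n : L3} (h : LorFrame a b n) (x y : L3) :
    lor x y = lor x a * lor y a + lor x b * lor y b - lor x n * lor y n := by
  conv_lhs => rw [h.expand y]
  simp only [lor_sub_right, lor_add_right, lor_smul_right]; ring

/-- A vector which is null and orthogonal to two orthonormal spacelike vectors is zero. -/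
theorem eq_zero_of_null_of_orth {u w x : L3} {H : ℝ} (hH : 0 < H) (hu : lor u u = H)
    (hw : lor w w = H) (huw : lor u w = 0) (hxu : lor x u = 0) (hxw : lor x w = 0)
    (hx : lor x x = 0) : x = 0 := by
  have hs : (√H)⁻¹ * ((√H)⁻¹ * H) = 1 := by
    have : √H ≠ 0 := (Real.sqrt_pos.mpr hH).ne'
    field_simp
    exact (Real.sq_sqrt hH.le).symm
  have hf : LorFrame ((√H)⁻¹ • u) ((√H)⁻¹ • w) _ :=
    LorFrame.of_spacelike (by simp [hu, hs]) (by simp [hw, hs]) (by simp [huw])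
  have h1 := hf.lor_eq x x
  have h2 := hf.expand x
  simp only [lor_smul_right, hxu, hxw, hx, mul_zero, zero_smul, add_zero, zero_sub] at h1 h2
  have h3 : lor x (cross ((√H)⁻¹ • u) ((√H)⁻¹ • w)) = 0 := by nlinarith
  rw [h3] at h2
  simpa using h2

theorem ne_zero_of_lor_pos {v : L3} (hv : 0 < lor v v) : v ≠ 0 := by
  rintro rfl; simp at hv

/-- A spacelike vector `v` and a unit timelike vector `n` determine a frame `(a, b, n)` in which
the projection of `v` orthogonal to `n` is a positive multiple of `a`. -/
theorem exists_frame {v n : L3} (hv : 0 < lor v v) (hn : lor n n = -1) :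
    ∃ a b : L3, LorFrame a b n ∧ lor v b = 0 ∧ 0 < lor v a := by
  set w := v + lor v n • n with hw
  have hwn : lor w n = 0 := by simp [hw, hn]
  have hvw : lor v w = lor v v + lor v n ^ 2 := by simp [hw]; ring
  have hww : lor w w = lor v v + lor v n ^ 2 := by
    rw [← hvw]; conv_lhs => rw [hw]
    rw [lor_add_left, lor_smul_left, lor_comm n w, hwn]; ring
  have hpos : 0 < lor w w := by rw [hww]; positivity
  have hs : √(lor w w) ≠ 0 := (Real.sqrt_pos.mpr hpos).ne'
  have hf : LorFrame ((√(lor w w))⁻¹ • w) (cross ((√(lor w w))⁻¹ • w) n) n := by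
    refine LorFrame.of_timelike ?_ hn (by simp [hwn])
    simp only [lor_smul_left, lor_smul_right]
    field_simp
    exact (Real.sq_sqrt hpos.le).symm
  refine ⟨_, _, hf, ?_, ?_⟩
  · have hab := hf.ab
    have hbn := hf.bn
    generalize cross ((√(lor w w))⁻¹ • w) n = b at hab hbn ⊢
    rw [lor_smul_left, mul_eq_zero, or_iff_right (inv_ne_zero hs)] at hab
    simpa [hw, lor_comm n, hbn] using hab
  · rw [lor_smul_right, hvw, ← hww]
    have := Real.sqrt_pos.mpr hpos
    positivity

/-! ### Lifts to the Lorentz-Minkowski space -/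

theorem toQuo_eq_iff {v x y : L3} : toQuo v x = toQuo v y ↔ ∃ k : ℤ, y = x + (k : ℝ) • v := by
  rw [toQuo, toQuo, QuotientAddGroup.eq, AddSubgroup.mem_zmultiples_iff]
  refine exists_congr fun k => ?_
  rw [← Int.cast_smul_eq_zsmul ℝ, eq_comm, neg_add_eq_iff_eq_add]

theorem toQuo_add_int (v x : L3) (k : ℤ) : toQuo v (x + (k : ℝ) • v) = toQuo v x :=
  (toQuo_eq_iff.mpr ⟨k, rfl⟩).symm

theorem toQuo_add (v x y : L3) : toQuo v (x + y) = toQuo v x + toQuo v y := rfl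

theorem isOpenMap_toQuo (v : L3) : IsOpenMap (toQuo v) := QuotientAddGroup.isOpenMap_coe

/-- Two continuous lifts of the same map into `𝕃³ / ⟨T⟩` differ locally by a constant. -/
theorem eventually_sub_eq_of_toQuo_eq {A : Type*} [TopologicalSpace A] {v : L3} (hv : v ≠ 0)
    {f g : A → L3} {z : A} (hf : ContinuousAt f z) (hg : ContinuousAt g z)
    (h : ∀ᶠ w in 𝓝 z, toQuo v (f w) = toQuo v (g w)) :
    ∀ᶠ w in 𝓝 z, g w - f w = g z - f z := by
  have hd : ContinuousAt (fun w => (g w - f w) - (g z - f z)) z := by fun_prop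
  have hnorm : ∀ᶠ w in 𝓝 z, ‖(g w - f w) - (g z - f z)‖ < ‖v‖ := by
    have := hd.norm.eventually_lt (continuousAt_const (y := ‖v‖)) (by simpa using hv)
    exact this
  obtain ⟨k0, hk0⟩ := toQuo_eq_iff.mp h.self_of_nhds
  filter_upwards [h, hnorm] with w hw hlt
  obtain ⟨k, hk⟩ := toQuo_eq_iff.mp hw
  have hv' : 0 < ‖v‖ := norm_pos_iff.mpr hv
  rw [hk, hk0, add_sub_cancel_left, add_sub_cancel_left, ← sub_smul, norm_smul] at hlt
  have h1 : ‖(k : ℝ) - k0‖ < 1 := by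
    by_contra hcon
    nlinarith [not_lt.mp hcon]
  have h2 : |k - k0| < 1 := by
    rw [Real.norm_eq_abs] at h1; exact_mod_cast h1
  have h3 : k = k0 := by have := Int.abs_lt_one_iff.mp h2; omega
  rw [hk, hk0, h3]; simp

/-- The coordinate along `b`, which is well defined on `𝕃³ / ⟨T⟩` as `b` is orthogonal to `v`. -/
def quoCoord (v b : L3) (hb : lor v b = 0) : Quo v → ℝ :=
  Quotient.lift (fun x : L3 => lor x b) (by
    intro x y hxy
    obtain ⟨k, hk⟩ := toQuo_eq_iff.mp (Quotient.sound hxy : toQuo v x = toQuo v y)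
    simp [hk, hb])

@[simp] theorem quoCoord_toQuo {v b : L3} (hb : lor v b = 0) (x : L3) :
    quoCoord v b hb (toQuo v x) = lor x b := rfl

theorem continuous_lor_left (b : L3) : Continuous fun x => lor x b := by
  unfold lor; fun_prop

theorem continuous_quoCoord {v b : L3} (hb : lor v b = 0) : Continuous (quoCoord v b hb) :=
  Continuous.quotient_lift (continuous_lor_left b) _

/-! ### Branched coverings of the plane: lifts of segments and properness -/

section Branched

open Set Metric Filter

variable {S : Type*} [TopologicalSpace S] {h : S → ℂ}

/-- A branched chart of `h` at `p`: in the coordinates `e₁` and `e₂`, both onto the unit disc, `h`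
reads `z ↦ zⁿ`. -/
structure BranchedChart (h : S → ℂ) (p : S) (n : ℕ) (e₁ : OpenPartialHomeomorph S ℂ)
    (e₂ : OpenPartialHomeomorph ℂ ℂ) : Prop where
  one_le : 1 ≤ n
  mem_source : p ∈ e₁.source
  map_zero : e₁ p = 0
  target₁ : e₁.target = ball 0 1
  target₂ : e₂.target = ball 0 1
  image_eq : h '' e₁.source = e₂.source
  eq_pow : ∀ q ∈ e₁.source, e₂ (h q) = e₁ q ^ n

theorem IsBranchedLocalHomeo.exists_chart (hb : IsBranchedLocalHomeo h) (p : S) :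
    ∃ n e₁ e₂, BranchedChart h p n e₁ e₂ := by
  obtain ⟨n, e₁, e₂, h1, h2, h3, h4, h5, h6, h7⟩ := hb p
  exact ⟨n, e₁, e₂, ⟨h1, h2, h3, h4, h5, h6, h7⟩⟩

namespace BranchedChart

variable {p : S} {n : ℕ} {e₁ : OpenPartialHomeomorph S ℂ} {e₂ : OpenPartialHomeomorph ℂ ℂ}

theorem map_mem (c : BranchedChart h p n e₁ e₂) {q : S} (hq : q ∈ e₁.source) :
    h q ∈ e₂.source := c.image_eq ▸ mem_image_of_mem h hq

/-- In the chart the set is `{z | zⁿ ∈ e₂ K}`, which is compact as `e₂ K` is compact in the open disc. -/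
theorem isCompact_inter_preimage (c : BranchedChart h p n e₁ e₂) {K : Set ℂ} (hK : IsCompact K)
    (hKs : K ⊆ e₂.source) : IsCompact (e₁.source ∩ h ⁻¹' K) := by
  have hn : n ≠ 0 := by have := c.one_le; omega
  have hK2 : IsCompact (e₂ '' K) := hK.image_of_continuousOn (e₂.continuousOn.mono hKs)
  have hball : ∀ z : ℂ, z ^ n ∈ e₂ '' K → z ∈ ball (0 : ℂ) 1 := by
    rintro z ⟨k, hk, hz⟩
    have h1 : e₂ k ∈ ball (0 : ℂ) 1 := c.target₂ ▸ e₂.map_source (hKs hk)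
    rw [hz, mem_ball_zero_iff, norm_pow] at h1
    rw [mem_ball_zero_iff]
    exact (pow_lt_one_iff_of_nonneg (norm_nonneg z) hn).mp h1
  have hZ : IsCompact {z : ℂ | z ^ n ∈ e₂ '' K} :=
    isCompact_of_isClosed_isBounded (hK2.isClosed.preimage (continuous_pow n))
      (isBounded_ball.subset hball)
  have hcont : ContinuousOn e₁.symm {z : ℂ | z ^ n ∈ e₂ '' K} :=
    e₁.continuousOn_symm.mono fun z hz => c.target₁ ▸ hball z hz
  convert! hZ.image_of_continuousOn hcont using 1
  ext q
  constructor
  · rintro ⟨hq, hqK⟩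
    exact ⟨e₁ q, by rw [mem_ofPred_eq, ← c.eq_pow q hq]; exact mem_image_of_mem _ hqK,
      e₁.left_inv hq⟩
  · rintro ⟨z, hz, rfl⟩
    have hzt : z ∈ e₁.target := c.target₁ ▸ hball z hz
    have hs := e₁.map_target hzt
    refine ⟨hs, ?_⟩
    obtain ⟨k, hk, hkz⟩ := hz
    have h1 := c.eq_pow _ hs
    rw [e₁.right_inv hzt, ← hkz] at h1
    rw [mem_preimage, e₂.injOn (c.map_mem hs) (hKs hk) h1]
    exact hk

/-- A path that starts in the domain of a branched chart stays there as long as its projection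
stays in a compact subset of the domain of the chart of the base. -/
theorem path_mem_source [T2Space S] (c : BranchedChart h p n e₁ e₂) {K : Set ℂ} (hK : IsCompact K)
    (hKs : K ⊆ e₂.source) {J : Set ℝ} (hJ : IsPreconnected J) {α : ℝ → S} (hα : ContinuousOn α J)
    (hαK : ∀ t ∈ J, h (α t) ∈ K) {t₁ : ℝ} (ht₁ : t₁ ∈ J) (h₁ : α t₁ ∈ e₁.source) :
    ∀ t ∈ J, α t ∈ e₁.source := by
  have hC := (c.isCompact_inter_preimage hK hKs).isClosed
  have hpre := isPreconnected_iff_subset_of_disjoint.mp (hJ.image α hα) e₁.source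
    (e₁.source ∩ h ⁻¹' K)ᶜ e₁.open_source hC.isOpen_compl
    (by
      rintro _ ⟨t, ht, rfl⟩
      by_cases hs : α t ∈ e₁.source
      · exact Or.inl hs
      · exact Or.inr fun h' => hs h'.1)
    (by
      ext x
      simp only [mem_inter_iff, mem_compl_iff, mem_empty_iff_false, iff_false, not_and]
      rintro ⟨t, ht, rfl⟩ hx hx'
      exact hx' hx (hαK t ht))
  rcases hpre with h' | h'
  · exact fun t ht => h' (mem_image_of_mem α ht)
  · exact absurd (show α t₁ ∈ e₁.source ∩ h ⁻¹' K from ⟨h₁, hαK _ ht₁⟩)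
      (h' (mem_image_of_mem α ht₁))

theorem finite_fiber (c : BranchedChart h p n e₁ e₂) (w : ℂ) :
    {q | q ∈ e₁.source ∧ h q = w}.Finite := by
  have hn : 0 < n := c.one_le
  have hroots : {z : ℂ | z ^ n = e₂ w}.Finite := by
    refine (Polynomial.nthRootsFinset n (e₂ w)).finite_toSet.subset fun z hz => ?_
    simpa [Polynomial.mem_nthRootsFinset hn] using hz
  refine Finite.of_finite_image (f := e₁) (hroots.subset ?_) (e₁.injOn.mono fun q hq => hq.1)
  rintro _ ⟨q, ⟨hq, rfl⟩, rfl⟩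
  exact (c.eq_pow q hq).symm

end BranchedChart

/-- `α` lifts to `S` the segment `t ↦ c + t d`, `0 ≤ t ≤ T`. -/
structure IsSegmentLift (h : S → ℂ) (c d : ℂ) (T : ℝ) (α : ℝ → S) : Prop where
  continuousOn : ContinuousOn α (Icc 0 T)
  lifts : ∀ t ∈ Icc 0 T, h (α t) = c + t * d

theorem IsBranchedCovering.exists_segmentLift (hb : IsBranchedCovering h) (s : S) (d : ℂ) {T : ℝ}
    (hT : 0 ≤ T) : ∃ α, IsSegmentLift h (h s) d T α ∧ α 0 = s := by
  obtain ⟨γ, h0, hγ⟩ := hb.path_lifting ⟨fun t => h s + (T * (t : ℝ) : ℝ) * d, by fun_prop⟩ s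
    (by simp)
  refine ⟨fun t => γ (projIcc 0 1 zero_le_one (t / T)), ⟨by fun_prop, fun t ht => ?_⟩, ?_⟩
  · rw [hγ]
    rcases hT.eq_or_lt with rfl | hT'
    · have : t = 0 := le_antisymm ht.2 ht.1
      simp [this]
    · have h1 : t / T ∈ Icc (0 : ℝ) 1 := ⟨by have := ht.1; positivity, by
        rw [div_le_one hT']; exact ht.2⟩
      rw [projIcc_of_mem _ h1]
      simp only [ContinuousMap.coe_mk]
      congr 3
      field_simp
  · simpa using h0

variable [T2Space S] {Fs : Set S}

/-- Two lifts of a segment agree as long as they do not meet the singular set. -/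
theorem IsSegmentLift.eqOn_of_eq (hinj : ∀ s ∉ Fs, ∃ V ∈ 𝓝 s, InjOn h V) {c d : ℂ} {T : ℝ}
    {α α' : ℝ → S} (hα : IsSegmentLift h c d T α) (hα' : IsSegmentLift h c d T α') {J : Set ℝ}
    (hJ : IsPreconnected J) (hJT : J ⊆ Icc 0 T) (hF : ∀ t ∈ J, c + t * d ∉ h '' Fs) {t₁ : ℝ}
    (ht₁ : t₁ ∈ J) (h₁ : α t₁ = α' t₁) : EqOn α α' J := by
  have : PreconnectedSpace J := isPreconnected_iff_preconnectedSpace.mp hJ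
  have c1 : Continuous (J.domRestrict α) := (hα.continuousOn.mono hJT).domRestrict
  have c2 : Continuous (J.domRestrict α') := (hα'.continuousOn.mono hJT).domRestrict
  have hclopen : IsClopen {t : J | J.domRestrict α t = J.domRestrict α' t} := by
    refine ⟨isClosed_eq c1 c2, isOpen_iff_mem_nhds.mpr fun t ht => ?_⟩
    have hns : J.domRestrict α t ∉ Fs := fun hs => hF t t.2
      ⟨_, hs, hα.lifts t (hJT t.2)⟩
    obtain ⟨V, hV, hVinj⟩ := hinj _ hns
    have hV' : V ∈ 𝓝 (J.domRestrict α' t) := by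
      rw [← (show J.domRestrict α t = J.domRestrict α' t from ht)]; exact hV
    filter_upwards [c1.continuousAt hV, c2.continuousAt hV'] with t' h1 h2
    refine hVinj h1 h2 ?_
    rw [domRestrict_apply, domRestrict_apply, hα.lifts _ (hJT t'.2), hα'.lifts _ (hJT t'.2)]
  have huniv := hclopen.eq_univ ⟨⟨t₁, ht₁⟩, h₁⟩
  intro t ht
  have : (⟨t, ht⟩ : J) ∈ {t : J | J.domRestrict α t = J.domRestrict α' t} := huniv ▸ mem_univ _
  exact this

/-- A segment meets a locally finite set at finitely many times. -/
theorem finite_times {c d : ℂ} (hd : d ≠ 0) (T : ℝ) {B : Set ℂ}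
    (hB : ∀ R, (B ∩ closedBall 0 R).Finite) : {t ∈ Icc 0 T | c + t * d ∈ B}.Finite := by
  refine Finite.of_finite_image (f := fun t : ℝ => c + t * d)
    ((hB (‖c‖ + |T| * ‖d‖)).subset ?_) ?_
  · rintro _ ⟨t, ⟨ht, htB⟩, rfl⟩
    refine ⟨htB, ?_⟩
    rw [mem_closedBall_zero_iff]
    refine (norm_add_le _ _).trans ?_
    rw [norm_mul, Complex.norm_real, Real.norm_eq_abs]
    gcongr
    · exact ht.1
    · exact ht.2
  · intro t _ t' _ htt
    have := add_left_cancel htt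
    exact_mod_cast mul_right_cancel₀ hd this

/-- Going backwards along a segment from a given endpoint, the lifts of the segment can only split
at finitely many branch points, so that they have finitely many starting points. -/
theorem IsBranchedLocalHomeo.finite_starts (hb : IsBranchedLocalHomeo h)
    (hinj : ∀ s ∉ Fs, ∃ V ∈ 𝓝 s, InjOn h V) (hB : ∀ R, (h '' Fs ∩ closedBall 0 R).Finite)
    {c d : ℂ} (hd : d ≠ 0) {T : ℝ} (hT : 0 ≤ T) (s₁ : S) :
    {s | ∃ α, IsSegmentLift h c d T α ∧ α T = s₁ ∧ α 0 = s}.Finite := by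
  -- `R τ` is the set of positions at the time `τ` of the lifts ending at `s₁`. The supremum `τs` of the
  -- times at which it is infinite leads to a contradiction.
  let R (τ : ℝ) : Set S := {s | ∃ α, IsSegmentLift h c d T α ∧ α T = s₁ ∧ α τ = s}
  suffices H : ∀ τ ∈ Icc 0 T, (R τ).Finite from H 0 ⟨le_rfl, hT⟩
  by_contra! hcon
  let bad : Set ℝ := {τ | τ ∈ Icc 0 T ∧ (R τ).Infinite}
  obtain ⟨τ₀, hτ₀, hinf⟩ := hcon
  have hne : bad.Nonempty := ⟨τ₀, hτ₀, hinf⟩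
  have hbdd : BddAbove bad := ⟨T, fun τ hτ => hτ.1.2⟩
  set τs := sSup bad with hτs
  have hτsT : τs ∈ Icc 0 T :=
    ⟨hτ₀.1.trans (le_csSup hbdd ⟨hτ₀, hinf⟩), csSup_le hne fun τ hτ => hτ.1.2⟩
  -- The set of positions at the time `τs` is finite: it injects into the one at a later time.
  have hfin : (R τs).Finite := by
    rcases hτsT.2.eq_or_lt with heq | hlt
    · refine (finite_singleton s₁).subset ?_
      rintro s ⟨α, -, h1, h2⟩
      rw [mem_singleton_iff, ← h1, ← h2, heq]
    · have hbt : ({t ∈ Icc 0 T | c + t * d ∈ h '' Fs} \ {τs}).Finite :=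
        (finite_times hd T hB).sdiff
      have hev : ∀ᶠ t in 𝓝[>] τs, t < T ∧
          Icc τs t ⊆ ({t ∈ Icc 0 T | c + t * d ∈ h '' Fs} \ {τs})ᶜ := by
        have hop : ({t ∈ Icc 0 T | c + t * d ∈ h '' Fs} \ {τs})ᶜ ∈ 𝓝 τs :=
          hbt.isClosed.isOpen_compl.mem_nhds (by simp)
        obtain ⟨ε, hε, hεs⟩ := Metric.mem_nhds_iff.mp hop
        filter_upwards [Ioo_mem_nhdsGT (lt_min hlt (lt_add_of_pos_right τs hε))] with t ht
        refine ⟨ht.2.trans_le (min_le_left _ _), fun u hu => hεs ?_⟩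
        rw [mem_ball, Real.dist_eq, abs_of_nonneg (sub_nonneg.mpr hu.1)]
        have := ht.2.trans_le (min_le_right _ _)
        have := hu.2
        linarith
      obtain ⟨t, ⟨htT, hfree⟩, htlt⟩ := (hev.and self_mem_nhdsWithin).exists
      have htlt' : τs < t := htlt
      have ht0 : t ∈ Icc 0 T := ⟨hτsT.1.trans htlt'.le, htT.le⟩
      have hRt : (R t).Finite := by
        by_contra hinf'
        exact (le_csSup hbdd ⟨ht0, hinf'⟩).not_gt htlt'
      have hch : ∀ s ∈ R τs, ∃ α, IsSegmentLift h c d T α ∧ α T = s₁ ∧ α τs = s := fun s hs => hs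
      choose! A hA1 hA2 hA3 using hch
      refine Finite.of_finite_image (f := fun s => A s t)
        (hRt.subset (by rintro _ ⟨s, hs, rfl⟩; exact ⟨A s, hA1 s hs, hA2 s hs, rfl⟩)) ?_
      intro s hs s' hs' hss
      have hsub : Ioc τs t ⊆ Icc 0 T := fun u hu => ⟨hτsT.1.trans hu.1.le, hu.2.trans htT.le⟩
      have heq : EqOn (A s) (A s') (Ioc τs t) :=
        (hA1 s hs).eqOn_of_eq hinj (hA1 s' hs') isPreconnected_Ioc hsub
          (fun u hu huB => hfree ⟨hu.1.le, hu.2⟩ ⟨⟨hsub hu, huB⟩, hu.1.ne'⟩)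
          (right_mem_Ioc.mpr htlt') hss
      have hsub' : Icc τs t ⊆ Icc 0 T := Icc_subset_Icc hτsT.1 htT.le
      have heq2 : EqOn (A s) (A s') (Icc τs t) := by
        refine heq.of_subset_closure ((hA1 s hs).continuousOn.mono hsub')
          ((hA1 s' hs').continuousOn.mono hsub') Ioc_subset_Icc_self ?_
        rw [closure_Ioc htlt'.ne]
      rw [← hA3 s hs, ← hA3 s' hs']
      exact heq2 ⟨le_rfl, htlt'.le⟩
  -- Slightly before `τs` the positions lie in finitely many branched charts.
  have hleft : ∀ y ∈ R τs, ∀ᶠ t in 𝓝 τs, t ∈ Icc 0 τs →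
      {s | ∃ α, IsSegmentLift h c d T α ∧ α τs = y ∧ α t = s}.Finite := by
    rintro y ⟨α₀, hα₀, -, hy⟩
    obtain ⟨n, e₁, e₂, ch⟩ := hb.exists_chart y
    have hyc : h y = c + τs * d := by rw [← hy]; exact hα₀.lifts _ hτsT
    obtain ⟨ε, hε, hεs⟩ := Metric.nhds_basis_closedBall.mem_iff.mp
      (e₂.open_source.mem_nhds (ch.map_mem ch.mem_source))
    have hcont : Tendsto (fun t : ℝ => c + t * d) (𝓝 τs) (𝓝 (h y)) := by
      rw [hyc]
      exact Continuous.tendsto (by fun_prop) _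
    have hnear : ∀ᶠ t in 𝓝 τs, ∀ u ∈ Icc t τs, c + u * d ∈ closedBall (h y) ε := by
      obtain ⟨δ, hδ, hδs⟩ := Metric.mem_nhds_iff.mp (hcont (closedBall_mem_nhds _ hε))
      filter_upwards [ball_mem_nhds τs hδ] with t ht u hu
      refine hδs ?_
      rw [mem_ball, Real.dist_eq, abs_sub_comm] at ht ⊢
      rw [abs_of_nonneg (sub_nonneg.mpr hu.2)]
      rw [abs_of_nonneg (sub_nonneg.mpr (hu.1.trans hu.2))] at ht
      linarith [hu.1]
    filter_upwards [hnear] with t ht hmem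
    refine (ch.finite_fiber (c + t * d)).subset ?_
    rintro s ⟨α, hα, h1, rfl⟩
    have hsub : Icc t τs ⊆ Icc 0 T := Icc_subset_Icc hmem.1 hτsT.2
    refine ⟨ch.path_mem_source (isCompact_closedBall _ _) hεs isPreconnected_Icc
      (hα.continuousOn.mono hsub) (fun u hu => ?_) (t₁ := τs) ⟨hmem.2, le_rfl⟩
      (h1 ▸ ch.mem_source) t ⟨le_rfl, hmem.2⟩, hα.lifts t (hsub ⟨le_rfl, hmem.2⟩)⟩
    rw [hα.lifts u (hsub hu)]; exact ht u hu
  have hall := (hfin.eventually_all (l := 𝓝 τs)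
    (p := fun y t => t ∈ Icc 0 τs →
      {s | ∃ α, IsSegmentLift h c d T α ∧ α τs = y ∧ α t = s}.Finite)).mpr hleft
  obtain ⟨ε, hε, hεs⟩ := Metric.mem_nhds_iff.mp hall
  obtain ⟨t, htbad, htlt⟩ := exists_lt_of_lt_csSup hne (sub_lt_self τs hε)
  have htle : t ≤ τs := le_csSup hbdd htbad
  have hp := hεs (show t ∈ ball τs ε by
    rw [mem_ball, Real.dist_eq, abs_sub_comm, abs_of_nonneg (sub_nonneg.mpr htle)]; linarith)
  refine htbad.2 ((hfin.biUnion fun y hy => hp y hy ⟨htbad.1.1, htle⟩).subset ?_)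
  rintro s ⟨α, hα, h1, h2⟩
  exact mem_biUnion (x := α τs) ⟨α, hα, h1, rfl⟩ ⟨α, hα, rfl, h2⟩

/-- A continuous function on an interval whose upper right slopes are bounded by `L` off a finite
set increases with slope at most `L`. -/
theorem sub_le_of_slope_le_off_finite {f : ℝ → ℝ} {T L : ℝ} (hf : ContinuousOn f (Icc 0 T))
    (E : Finset ℝ)
    (hE : ∀ t ∈ Ico 0 T, t ∉ E → ∀ᶠ u in 𝓝[>] t, f u - f t ≤ L * (u - t)) :
    ∀ x ∈ Icc 0 T, ∀ y ∈ Icc 0 T, x ≤ y → f y - f x ≤ L * (y - x) := by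
  -- No exceptional time in `[x, y)`.
  have hfree : ∀ x ∈ Icc 0 T, ∀ y ∈ Icc 0 T, x ≤ y → (∀ t ∈ Ico x y, t ∉ E) →
      f y - f x ≤ L * (y - x) := by
    intro x hx y hy hxy hno
    have hsub : Icc x y ⊆ Icc 0 T := Icc_subset_Icc hx.1 hy.2
    have := image_le_of_liminf_slope_right_le_deriv_boundary (f := f) (a := x) (b := y)
      (hf.mono hsub) (B := fun t => f x + L * (t - x)) (B' := fun _ => L) (by simp)
      (by fun_prop)
      (fun t _ => by
        have : HasDerivAt (fun t => f x + L * (t - x)) (L * 1) t :=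
          (((hasDerivAt_id t).sub_const x).const_mul L).const_add _
        simpa using this.hasDerivWithinAt)
      (fun t ht r hr => by
        have h1 := hE t ⟨hx.1.trans ht.1, ht.2.trans_le hy.2⟩ (hno t ht)
        refine Filter.Eventually.frequently ?_
        filter_upwards [h1, self_mem_nhdsWithin] with u hu hut
        have hut' : 0 < u - t := sub_pos.mpr hut
        rw [slope_def_field, div_lt_iff₀ hut']
        nlinarith)
      (right_mem_Icc.mpr hxy)
    linarith
  -- An exceptional time at `x` is allowed by continuity.
  have hfree' : ∀ x ∈ Icc 0 T, ∀ y ∈ Icc 0 T, x ≤ y → (∀ t ∈ Ioo x y, t ∉ E) →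
      f y - f x ≤ L * (y - x) := by
    intro x hx y hy hxy hno
    rcases hxy.eq_or_lt with rfl | hlt
    · simp
    have hsub : Icc x y ⊆ Icc 0 T := Icc_subset_Icc hx.1 hy.2
    have hcl : x ∈ closure (Ioo x y) := by
      rw [closure_Ioo hlt.ne]; exact ⟨le_rfl, hxy⟩
    have hcont := hf.mono hsub
    refine ContinuousWithinAt.closure_le hcl (f := fun u => f y - f u)
      (g := fun u => L * (y - u)) ?_ ?_ ?_
    · exact continuousWithinAt_const.sub ((hcont x ⟨le_rfl, hxy⟩).mono Ioo_subset_Icc_self)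
    · exact Continuous.continuousWithinAt (by fun_prop)
    · intro u hu
      exact hfree u (hsub ⟨hu.1.le, hu.2.le⟩) y hy hu.2.le
        fun t ht => hno t ⟨hu.1.trans_le ht.1, ht.2⟩
  -- Split the interval at the exceptional times.
  have key : ∀ m : ℕ, ∀ x ∈ Icc 0 T, ∀ y ∈ Icc 0 T, x ≤ y →
      (E.filter fun t => t ∈ Ioo x y).card = m → f y - f x ≤ L * (y - x) := by
    intro m
    induction m using Nat.strong_induction_on with
    | _ m ih =>
      intro x hx y hy hxy hm
      by_cases hno : ∀ t ∈ Ioo x y, t ∉ E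
      · exact hfree' x hx y hy hxy hno
      push Not at hno
      obtain ⟨t, ht, htE⟩ := hno
      have htT : t ∈ Icc 0 T := ⟨hx.1.trans ht.1.le, ht.2.le.trans hy.2⟩
      have h1 := ih _ (by
        rw [← hm]
        refine Finset.card_lt_card (Finset.ssubset_iff_of_subset (fun u hu => ?_) |>.mpr
          ⟨t, by simp [htE, ht.1, ht.2], by simp⟩)
        simp only [Finset.mem_filter, mem_Ioo] at hu ⊢
        exact ⟨hu.1, hu.2.1, hu.2.2.trans ht.2⟩) x hx t htT ht.1.le rfl
      have h2 := ih _ (by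
        rw [← hm]
        refine Finset.card_lt_card (Finset.ssubset_iff_of_subset (fun u hu => ?_) |>.mpr
          ⟨t, by simp [htE, ht.1, ht.2], by simp⟩)
        simp only [Finset.mem_filter, mem_Ioo] at hu ⊢
        exact ⟨hu.1, ht.1.trans hu.2.1, hu.2.2⟩) t htT y hy ht.2.le rfl
      linarith
  exact fun x hx y hy hxy => key _ x hx y hy hxy rfl

/-- `k` is locally `1`-Lipschitz with respect to the projection `h`, off the set `Fs`; this is what
remains of the spacelike condition for the height `k` of a surface with projection `h`. -/
def IsLocallyShort (h : S → ℂ) (k : S → ℝ) (Fs : Set S) : Prop :=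
  ∀ s ∉ Fs, ∃ V ∈ 𝓝 s, ∀ q ∈ V, ∀ q' ∈ V, |k q - k q'| ≤ ‖h q - h q'‖

omit [T2Space S] in
/-- Along a lift of a segment the height varies by at most the length of the segment: the singular
set is met at finitely many times. -/
theorem IsLocallyShort.lift_le {k : S → ℝ} (hk : IsLocallyShort h k Fs) (hkc : Continuous k)
    (hB : ∀ R, (h '' Fs ∩ closedBall 0 R).Finite) {c d : ℂ} (hd : d ≠ 0) {T : ℝ} {α : ℝ → S}
    (hα : IsSegmentLift h c d T α) : ∀ t ∈ Icc 0 T, |k (α t) - k (α 0)| ≤ ‖d‖ * t := by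
  have hfin := finite_times (c := c) hd T hB
  have hslope : ∀ t ∈ Ico 0 T, t ∉ hfin.toFinset →
      ∀ᶠ u in 𝓝[>] t, |k (α u) - k (α t)| ≤ ‖d‖ * (u - t) := by
    intro t ht htE
    have htT : t ∈ Icc 0 T := ⟨ht.1, ht.2.le⟩
    have hns : α t ∉ Fs := fun hs => htE (by
      rw [Finite.mem_toFinset]
      exact ⟨htT, _, hs, hα.lifts t htT⟩)
    obtain ⟨V, hV, hVk⟩ := hk _ hns
    have h1 : ∀ᶠ u in 𝓝[Icc 0 T] t, α u ∈ V := hα.continuousOn t htT hV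
    have h2 : 𝓝[>] t ≤ 𝓝[Icc 0 T] t := by
      rw [← nhdsWithin_Ioo_eq_nhdsGT ht.2]
      exact nhdsWithin_mono _ fun u hu => ⟨ht.1.trans hu.1.le, hu.2.le⟩
    filter_upwards [h2 h1, h2 self_mem_nhdsWithin, self_mem_nhdsWithin] with u hu huT hut
    refine (hVk _ hu _ (mem_of_mem_nhds hV)).trans ?_
    rw [hα.lifts u huT, hα.lifts t htT, add_sub_add_left_eq_sub, ← sub_mul, norm_mul,
      ← Complex.ofReal_sub, Complex.norm_real, Real.norm_eq_abs,
      abs_of_nonneg (sub_nonneg.mpr (le_of_lt hut)), mul_comm]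
  have hcont : ContinuousOn (fun t => k (α t)) (Icc 0 T) := hkc.comp_continuousOn hα.continuousOn
  intro t ht
  have h0 : (0 : ℝ) ∈ Icc 0 T := ⟨le_rfl, ht.1.trans ht.2⟩
  rw [abs_le]
  constructor
  · have := sub_le_of_slope_le_off_finite (f := fun t => -k (α t)) (L := ‖d‖) hcont.neg
      hfin.toFinset (fun t ht htE => (hslope t ht htE).mono fun u hu => by
        have := neg_abs_le (k (α u) - k (α t)); linarith) 0 h0 t ht ht.1
    linarith
  · have := sub_le_of_slope_le_off_finite (f := fun t => k (α t)) (L := ‖d‖) hcont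
      hfin.toFinset (fun t ht htE => (hslope t ht htE).mono fun u hu => by
        have := le_abs_self (k (α u) - k (α t)); linarith) 0 h0 t ht ht.1
    linarith

/-- A multigraph that meets one timelike line finitely often has finite fibres: from every point
over a given point of the plane, the lift of a segment to the projection of the line, and then of
the projected line itself, reaches the timelike line because the height is short. -/
theorem IsBranchedCovering.finite_fiber (hb : IsBranchedCovering h)
    (hinj : ∀ s ∉ Fs, ∃ V ∈ 𝓝 s, InjOn h V) (hB : ∀ R, (h '' Fs ∩ closedBall 0 R).Finite)
    {k : S → ℝ} (hkc : Continuous k) (hk : IsLocallyShort h k Fs) {a b : ℂ} {a₃ b₃ : ℝ}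
    (hab : ‖b‖ < |b₃|) (hfin : {x : S × ℝ | h x.1 = a + x.2 * b ∧ k x.1 = a₃ + x.2 * b₃}.Finite)
    (c : ℂ) : (h ⁻¹' {c}).Finite := by
  have hb3 : b₃ ≠ 0 := by rintro rfl; simp at hab; exact (norm_nonneg b).not_gt hab
  -- The fibre over the point `a` of the projected line `{a + t b}`.
  have ha : (h ⁻¹' {a}).Finite := by
    by_cases hb0 : b = 0
    · refine Finite.subset (hfin.image Prod.fst) fun s hs => ⟨(s, (k s - a₃) / b₃), ?_, rfl⟩
      refine ⟨by simpa [hb0] using hs, ?_⟩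
      field_simp; ring
    have key : ∀ s ∈ h ⁻¹' {a}, ∃ x ∈ {x : S × ℝ | h x.1 = a + x.2 * b ∧ k x.1 = a₃ + x.2 * b₃},
        ∃ ε : ℝ, (ε = 1 ∨ ε = -1) ∧ 0 ≤ ε * x.2 ∧
        ∃ α, IsSegmentLift h a (ε * b) (ε * x.2) α ∧ α (ε * x.2) = x.1 ∧ α 0 = s := by
      intro s hs
      have hs' : h s = a := hs
      -- The direction along the line in which the height of the line catches up.
      obtain ⟨ε, hε, hsgn⟩ : ∃ ε : ℝ, (ε = 1 ∨ ε = -1) ∧ 0 ≤ (k s - a₃) * (ε * b₃) := by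
        by_cases h0 : 0 ≤ (k s - a₃) * b₃
        · exact ⟨1, Or.inl rfl, by simpa using h0⟩
        · exact ⟨-1, Or.inr rfl, by push Not at h0; nlinarith⟩
      have hεε : ε * ε = 1 := by rcases hε with rfl | rfl <;> norm_num
      have hεn : ‖(ε : ℂ)‖ = 1 := by rcases hε with rfl | rfl <;> simp
      have hεb : |ε * b₃| = |b₃| := by rcases hε with rfl | rfl <;> simp
      have hd : (ε : ℂ) * b ≠ 0 :=
        mul_ne_zero (by rintro h0; simp [h0] at hεn) hb0
      -- The heights of the line and of the lift differ by `|k s - a₃|` at the start and approach each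
      -- other with speed at least `|b₃| - ‖b‖`.
      set T := |k s - a₃| / (|b₃| - ‖b‖) with hT
      have hpos : 0 < |b₃| - ‖b‖ := sub_pos.mpr hab
      have hT0 : 0 ≤ T := by positivity
      have hTe : T * (|b₃| - ‖b‖) = |k s - a₃| := by rw [hT]; field_simp
      obtain ⟨α, hα, hα0⟩ := hb.exists_segmentLift s (ε * b) hT0
      rw [hs'] at hα
      have hlip := hk.lift_le hkc hB hd hα
      have hcont : ContinuousOn (fun t => k (α t) - a₃ - t * (ε * b₃)) (Icc 0 T) := by
        exact ((hkc.comp_continuousOn hα.continuousOn).sub continuousOn_const).sub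
          (Continuous.continuousOn (by fun_prop))
      have hlT := hlip T ⟨hT0, le_rfl⟩
      rw [hα0, norm_mul, hεn, one_mul, abs_le] at hlT
      have hzero : ∃ t ∈ Icc 0 T, k (α t) - a₃ - t * (ε * b₃) = 0 := by
        rcases le_total 0 (k s - a₃) with h0 | h0
        · have hb' : ε * b₃ = |b₃| ∨ k s - a₃ = 0 := by
            rcases h0.eq_or_lt with h1 | h1
            · exact Or.inr h1.symm
            · left; rw [← hεb, abs_of_nonneg (nonneg_of_mul_nonneg_right hsgn h1)]
          rcases hb' with hb' | hb'
          · rw [abs_of_nonneg h0] at hTe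
            have := intermediate_value_Icc' hT0 hcont
            obtain ⟨t, ht, h2⟩ := this (show (0 : ℝ) ∈ _ from ⟨by rw [hb']; nlinarith,
              by simpa [hα0] using h0⟩)
            exact ⟨t, ht, h2⟩
          · exact ⟨0, ⟨le_rfl, hT0⟩, by simpa [hα0] using hb'⟩
        · have hb' : ε * b₃ = -|b₃| ∨ k s - a₃ = 0 := by
            rcases h0.eq_or_lt with h1 | h1
            · exact Or.inr h1
            · left
              have : ε * b₃ ≤ 0 := by by_contra hcon; push Not at hcon; nlinarith
              rw [← hεb, abs_of_nonpos this]; ring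
          rcases hb' with hb' | hb'
          · rw [abs_of_nonpos h0] at hTe
            have := intermediate_value_Icc hT0 hcont
            obtain ⟨t, ht, h2⟩ := this (show (0 : ℝ) ∈ _ from ⟨by simpa [hα0] using h0,
              by rw [hb']; nlinarith⟩)
            exact ⟨t, ht, h2⟩
          · exact ⟨0, ⟨le_rfl, hT0⟩, by simpa [hα0] using hb'⟩
      obtain ⟨t, ht, h2⟩ := hzero
      have hcancel : ε * (ε * t) = t := by rw [← mul_assoc, hεε, one_mul]
      refine ⟨(α t, ε * t), ⟨?_, ?_⟩, ε, hε, by rw [hcancel]; exact ht.1, α, ?_, ?_, hα0⟩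
      · rw [hα.lifts t ht]; push_cast; ring
      · simp only; linarith
      · rw [hcancel]
        exact ⟨hα.continuousOn.mono (Icc_subset_Icc_right ht.2),
          fun u hu => hα.lifts u ⟨hu.1, hu.2.trans ht.2⟩⟩
      · rw [hcancel]
    have hε0 : ∀ ε : ℝ, ε = 1 ∨ ε = -1 → (ε : ℂ) * b ≠ 0 := by
      rintro ε (rfl | rfl) <;> simpa using hb0
    have hfin2 : ∀ ε : ℝ, (ε = 1 ∨ ε = -1) → (⋃ x ∈ {x : S × ℝ | h x.1 = a + x.2 * b ∧
        k x.1 = a₃ + x.2 * b₃}, {s | 0 ≤ ε * x.2 ∧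
        ∃ α, IsSegmentLift h a (ε * b) (ε * x.2) α ∧ α (ε * x.2) = x.1 ∧ α 0 = s}).Finite := by
      intro ε hε
      refine hfin.biUnion fun x _ => ?_
      by_cases hx : 0 ≤ ε * x.2
      · exact (hb.branched.finite_starts hinj hB (hε0 ε hε) hx x.1).subset fun s hs => hs.2
      · exact finite_empty.subset fun s hs => hx hs.1
    refine ((hfin2 1 (Or.inl rfl)).union (hfin2 (-1) (Or.inr rfl))).subset fun s hs => ?_
    obtain ⟨x, hx, ε, hε, h0, hrest⟩ := key s hs
    rcases hε with rfl | rfl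
    · exact Or.inl (mem_biUnion hx ⟨h0, hrest⟩)
    · exact Or.inr (mem_biUnion hx ⟨h0, hrest⟩)
  -- A segment from `c` to `a` lifts from each point over `c`, and ends at one of the finitely many
  -- points over `a`.
  by_cases hca : c = a
  · rw [hca]; exact ha
  refine (ha.biUnion fun s₁ _ => hb.branched.finite_starts hinj hB
    (c := c) (sub_ne_zero.mpr (Ne.symm hca)) zero_le_one s₁).subset fun s hs => ?_
  obtain ⟨α, hα, hα0⟩ := hb.exists_segmentLift s (a - c) zero_le_one
  rw [show h s = c from hs] at hα
  refine mem_biUnion (x := α 1) ?_ ⟨α, hα, rfl, hα0⟩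
  rw [mem_preimage, hα.lifts 1 ⟨zero_le_one, le_rfl⟩]; simp

/-- A branched covering of the plane with finite fibres is proper. -/
theorem IsBranchedCovering.isProperMap (hb : IsBranchedCovering h)
    (hfin : ∀ c, (h ⁻¹' {c}).Finite) : IsProperMap h := by
  rw [isProperMap_iff_isCompact_preimage]
  refine ⟨hb.continuous, fun K hK => ?_⟩
  -- Around `c` take a disc in the domains of the branched charts at the points over `c`. Radial segments
  -- lift to paths ending over `c`, so that these charts contain everything over the disc.
  have hloc : ∀ c : ℂ, ∃ D ∈ 𝓝 c, IsCompact (h ⁻¹' D) := by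
    intro c
    choose n e₁ e₂ ch using fun p => hb.branched.exists_chart p
    have hnb : ∀ p ∈ h ⁻¹' {c}, (e₂ p).source ∈ 𝓝 c := fun p hp => by
      have hp' : h p = c := hp
      rw [← hp']
      exact (e₂ p).open_source.mem_nhds ((ch p).map_mem (ch p).mem_source)
    obtain ⟨ε, hε, hεs⟩ := Metric.nhds_basis_closedBall.mem_iff.mp
      ((biInter_mem (hfin c)).mpr hnb)
    have hsub : ∀ p ∈ h ⁻¹' {c}, closedBall c ε ⊆ (e₂ p).source := fun p hp =>
      hεs.trans (biInter_subset_of_mem hp)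
    refine ⟨closedBall c ε, closedBall_mem_nhds c hε, ?_⟩
    have hcomp : IsCompact (⋃ p ∈ h ⁻¹' {c}, ((e₁ p).source ∩ h ⁻¹' closedBall c ε)) :=
      (hfin c).isCompact_biUnion fun p hp =>
        (ch p).isCompact_inter_preimage (isCompact_closedBall _ _) (hsub p hp)
    refine hcomp.of_isClosed_subset (isClosed_closedBall.preimage hb.continuous) fun s hs => ?_
    obtain ⟨α, hα, hα0⟩ := hb.exists_segmentLift s (c - h s) zero_le_one
    have h1 : α 1 ∈ h ⁻¹' {c} := by
      rw [mem_preimage, hα.lifts 1 ⟨zero_le_one, le_rfl⟩]; simp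
    refine mem_biUnion h1 ⟨?_, hs⟩
    rw [← hα0]
    refine (ch (α 1)).path_mem_source (isCompact_closedBall c ε) (hsub _ h1)
      (isPreconnected_Icc (a := (0 : ℝ)) (b := 1)) hα.continuousOn (fun t ht => ?_)
      (t₁ := 1) ⟨zero_le_one, le_rfl⟩ (ch _).mem_source 0 ⟨le_rfl, zero_le_one⟩
    rw [hα.lifts t ht]
    have hs' : h s ∈ closedBall c ε := hs
    rw [mem_closedBall, dist_eq_norm] at hs' ⊢
    have : h s + t * (c - h s) - c = (1 - t : ℝ) * (h s - c) := by push_cast; ring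
    rw [this, norm_mul, Complex.norm_real, Real.norm_eq_abs, abs_of_nonneg (by linarith [ht.2])]
    nlinarith [ht.1, norm_nonneg (h s - c)]
  choose D hD hDc using hloc
  obtain ⟨t, -, ht⟩ := hK.elim_nhds_subcover D fun c _ => hD c
  refine (t.isCompact_biUnion fun c _ => hDc c).of_isClosed_subset
    (hK.isClosed.preimage hb.continuous) fun s hs => ?_
  simpa using ht hs

omit [T2Space S] in
/-- Off the singular set a branched covering which is locally injective is a local
homeomorphism. -/
theorem IsBranchedLocalHomeo.isLocalHomeomorphOn (hb : IsBranchedLocalHomeo h)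
    (hinj : ∀ s ∉ Fs, ∃ V ∈ 𝓝 s, InjOn h V) : IsLocalHomeomorphOn h Fsᶜ := by
  refine IsLocalHomeomorphOn.mk h _ fun s hs => ?_
  obtain ⟨n, e₁, e₂, ch⟩ := hb.exists_chart s
  obtain ⟨V, hV, hVinj⟩ := hinj s hs
  -- Otherwise two points with coordinates `z` and `exp (2πi/n) z` would have the same image.
  have hn : n = 1 := by
    by_contra hn1
    have hn0 : n ≠ 0 := by have := ch.one_le; omega
    set ρ := Complex.exp (2 * Real.pi * Complex.I / n) with hρ
    have hprim : IsPrimitiveRoot ρ n := Complex.isPrimitiveRoot_exp n hn0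
    have hρ1 : ρ ≠ 1 := hprim.ne_one (by have := ch.one_le; omega)
    have h0t : (0 : ℂ) ∈ e₁.target := ch.target₁ ▸ mem_ball_self one_pos
    have hsymm : e₁.symm 0 = s := by rw [← ch.map_zero]; exact e₁.left_inv ch.mem_source
    have h1 : ∀ᶠ z in 𝓝 (0 : ℂ), e₁.symm z ∈ V ∧ z ∈ e₁.target :=
      ((e₁.continuousAt_symm h0t).eventually_mem (hsymm.symm ▸ hV)).and (e₁.open_target.mem_nhds h0t)
    have h2 : ∀ᶠ z in 𝓝 (0 : ℂ), e₁.symm (ρ * z) ∈ V ∧ ρ * z ∈ e₁.target := by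
      have : Tendsto (fun z => ρ * z) (𝓝 0) (𝓝 0) := by
        simpa using (continuous_const_mul ρ).tendsto 0
      exact this.eventually h1
    obtain ⟨z, ⟨⟨hz1, hz2⟩, hz3, hz4⟩, hz0⟩ :=
      (((h1.and h2).filter_mono nhdsWithin_le_nhds).and
        (self_mem_nhdsWithin (s := {0}ᶜ) (a := (0 : ℂ)))).exists
    have heq : h (e₁.symm z) = h (e₁.symm (ρ * z)) := by
      refine e₂.injOn (ch.map_mem (e₁.map_target hz2)) (ch.map_mem (e₁.map_target hz4)) ?_
      rw [ch.eq_pow _ (e₁.map_target hz2), ch.eq_pow _ (e₁.map_target hz4), e₁.right_inv hz2,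
        e₁.right_inv hz4, mul_pow, hprim.pow_eq_one, one_mul]
    have := e₁.symm.injOn hz2 hz4 (hVinj hz1 hz3 heq)
    exact hρ1 (mul_right_cancel₀ hz0 (by rw [← this, one_mul]))
  subst hn
  refine ⟨e₁.trans e₂.symm, ?_, fun q hq => ?_⟩
  · rw [OpenPartialHomeomorph.trans_source]
    refine ⟨ch.mem_source, ?_⟩
    simp [ch.target₂, ch.map_zero]
  · have hq1 : q ∈ e₁.source := by
      rw [OpenPartialHomeomorph.trans_source] at hq; exact hq.1
    simp only [OpenPartialHomeomorph.coe_trans, Function.comp_apply]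
    rw [← pow_one (e₁ q), ← ch.eq_pow q hq1, e₂.left_inv (ch.map_mem hq1)]

/-- Over a half plane without singular values the branched covering consists of sheets: each point
lies on the image of a continuous section. -/
theorem IsBranchedCovering.exists_section (hb : IsBranchedCovering h)
    (hinj : ∀ s ∉ Fs, ∃ V ∈ 𝓝 s, InjOn h V) (hfin : ∀ c, (h ⁻¹' {c}).Finite) {y₀ : ℝ}
    (hy : ∀ s ∈ Fs, (h s).im ≤ y₀) {s₀ : S} (hs₀ : y₀ < (h s₀).im) :
    ∃ σ : ℂ → S, ContinuousOn σ {c | y₀ < c.im} ∧ (∀ c, y₀ < c.im → h (σ c) = c) ∧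
      σ (h s₀) = s₀ := by
  have hcov : IsCoveringMapOn h {c | y₀ < c.im} :=
    (hb.isProperMap hfin).isClosedMap.isCoveringMapOn_of_isLocalHomeomorphOn
      (fun c _ => hfin c) ((hb.branched.isLocalHomeomorphOn hinj).mono
        fun s hs hsF => (hy s hsF).not_gt hs)
  have hconv : Convex ℝ {c : ℂ | y₀ < c.im} := convex_halfSpace_im_gt y₀
  have hop : IsOpen {c : ℂ | y₀ < c.im} := isOpen_lt continuous_const Complex.continuous_im
  have hc : ContractibleSpace {c : ℂ | y₀ < c.im} := hconv.contractibleSpace ⟨h s₀, hs₀⟩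
  have hl : LocallyPathConnectedSpace {c : ℂ | y₀ < c.im} := hop.locallyPathConnectedSpace
  obtain ⟨σ, ⟨h1, h2⟩, -⟩ := hcov.existsUnique_continuousMap_lifts
    (⟨Subtype.val, continuous_subtype_val⟩ : C({c : ℂ | y₀ < c.im}, ℂ)) (a₀ := ⟨h s₀, hs₀⟩)
    (e₀ := s₀) rfl fun a => a.2
  classical
  refine ⟨fun c => if hc : y₀ < c.im then σ ⟨c, hc⟩ else s₀, ?_, fun c hc => ?_, ?_⟩
  · rw [continuousOn_iff_continuous_domRestrict]
    convert! σ.continuous using 1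
    ext c
    have hc : y₀ < (c : ℂ).im := c.2
    simp [hc]
  · simp only [hc, dif_pos]
    exact congrFun h2 ⟨c, hc⟩
  · simp only [hs₀, dif_pos]
    exact h1

/-- Sections over a connected set without singular values that agree at one point agree. -/
theorem section_eqOn (hinj : ∀ s ∉ Fs, ∃ V ∈ 𝓝 s, InjOn h V) {U : Set ℂ} (hU : IsPreconnected U)
    (hUF : ∀ s ∈ Fs, h s ∉ U) {σ σ' : ℂ → S} (hσ : ContinuousOn σ U) (hσ' : ContinuousOn σ' U)
    (h1 : ∀ c ∈ U, h (σ c) = c) (h2 : ∀ c ∈ U, h (σ' c) = c) {c₀ : ℂ} (hc₀ : c₀ ∈ U)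
    (heq : σ c₀ = σ' c₀) : EqOn σ σ' U := by
  have : PreconnectedSpace U := isPreconnected_iff_preconnectedSpace.mp hU
  have k1 : Continuous (U.domRestrict σ) := hσ.domRestrict
  have k2 : Continuous (U.domRestrict σ') := hσ'.domRestrict
  have hclopen : IsClopen {c : U | U.domRestrict σ c = U.domRestrict σ' c} := by
    refine ⟨isClosed_eq k1 k2, isOpen_iff_mem_nhds.mpr fun c hc => ?_⟩
    have hc' : U.domRestrict σ c = U.domRestrict σ' c := hc
    have hns : U.domRestrict σ c ∉ Fs := fun hs => hUF _ hs (by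
      rw [domRestrict_apply, h1 _ c.2]; exact c.2)
    obtain ⟨V, hV, hVinj⟩ := hinj _ hns
    filter_upwards [k1.continuousAt hV, k2.continuousAt (hc' ▸ hV)] with c' e1 e2
    refine hVinj e1 e2 ?_
    rw [domRestrict_apply, domRestrict_apply, h1 _ c'.2, h2 _ c'.2]
  have huniv := hclopen.eq_univ ⟨⟨c₀, hc₀⟩, heq⟩
  intro c hc
  have : (⟨c, hc⟩ : U) ∈ {c : U | U.domRestrict σ c = U.domRestrict σ' c} := huniv ▸ mem_univ _
  exact this

omit [T2Space S] in
/-- The image of a section is locally the preimage of its domain, by local injectivity. -/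
theorem isOpen_section_image (hh : Continuous h) (hinj : ∀ s ∉ Fs, ∃ V ∈ 𝓝 s, InjOn h V)
    {U : Set ℂ} (hU : IsOpen U) (hUF : ∀ s ∈ Fs, h s ∉ U) {σ : ℂ → S} (hσ : ContinuousOn σ U)
    (h1 : ∀ c ∈ U, h (σ c) = c) {W : Set ℂ} (hW : IsOpen W) (hWU : W ⊆ U) :
    IsOpen (σ '' W) := by
  rw [isOpen_iff_mem_nhds]
  rintro _ ⟨c, hc, rfl⟩
  have hcU := hWU hc
  have hns : σ c ∉ Fs := fun hs => hUF _ hs (by rw [h1 c hcU]; exact hcU)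
  obtain ⟨V, hV, hVinj⟩ := hinj _ hns
  have h2 : ∀ᶠ c' in 𝓝 c, σ c' ∈ V ∧ c' ∈ W :=
    ((hσ.continuousAt (hU.mem_nhds hcU)).eventually_mem hV).and (hW.mem_nhds hc)
  have h3 : Tendsto h (𝓝 (σ c)) (𝓝 c) := by
    have := hh.tendsto (σ c)
    rwa [h1 c hcU] at this
  filter_upwards [hV, h3.eventually h2] with q hq hq2
  exact ⟨h q, hq2.2, hVinj hq2.1 hq (h1 _ (hWU hq2.2))⟩

end Branched

/-! ### The mean curvature equation and its invariance under changes of parameter -/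

theorem two_le_infty : (2 : WithTop ℕ∞) ≤ ∞ := by
  exact WithTop.coe_le_coe.mpr (le_top : (2 : ℕ∞) ≤ ⊤)

section ZMC

variable {E E' : Type*} [NormedAddCommGroup E] [NormedSpace ℝ E] [NormedAddCommGroup E']
  [NormedSpace ℝ E']

/-- The numerator `G e - 2 F f + E g` of the mean curvature in the normal direction `ν`, computed in
the basis `c₀, c₁` of the parameter plane. -/
def zmcForm (Y : E → L3) (x : E) (ν : L3) (c₀ c₁ : E) : ℝ :=
  lor (fderiv ℝ Y x c₁) (fderiv ℝ Y x c₁) * lor (fderiv ℝ (fderiv ℝ Y) x c₀ c₀) ν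
    - 2 * lor (fderiv ℝ Y x c₀) (fderiv ℝ Y x c₁) * lor (fderiv ℝ (fderiv ℝ Y) x c₀ c₁) ν
    + lor (fderiv ℝ Y x c₀) (fderiv ℝ Y x c₀) * lor (fderiv ℝ (fderiv ℝ Y) x c₁ c₁) ν

theorem zmcForm_congr {Y Y' : E → L3} {x : E} (h : Y =ᶠ[𝓝 x] Y') (ν : L3) (c₀ c₁ : E) :
    zmcForm Y x ν c₀ c₁ = zmcForm Y' x ν c₀ c₁ := by
  have h1 : fderiv ℝ Y =ᶠ[𝓝 x] fderiv ℝ Y' := h.fderiv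
  rw [zmcForm, zmcForm, h1.eq_of_nhds, h1.fderiv_eq]

/-- The chain rule for second derivatives. -/
theorem fderiv_fderiv_comp {F : Type*} [NormedAddCommGroup F] [NormedSpace ℝ F]
    {Y : E' → F} {θ : E → E'} {z : E} (hY : ContDiffAt ℝ 2 Y (θ z)) (hθ : ContDiffAt ℝ 2 θ z)
    (u w : E) : fderiv ℝ (fderiv ℝ (Y ∘ θ)) z u w =
      fderiv ℝ (fderiv ℝ Y) (θ z) (fderiv ℝ θ z u) (fderiv ℝ θ z w)
        + fderiv ℝ Y (θ z) (fderiv ℝ (fderiv ℝ θ) z u w) := by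
  have hYe : ∀ᶠ y in 𝓝 (θ z), DifferentiableAt ℝ Y y :=
    (hY.eventually (by simp)).mono fun y hy => hy.differentiableAt (by simp)
  have hθe : ∀ᶠ y in 𝓝 z, DifferentiableAt ℝ θ y :=
    (hθ.eventually (by simp)).mono fun y hy => hy.differentiableAt (by simp)
  have h1 : fderiv ℝ (Y ∘ θ) =ᶠ[𝓝 z] fun y => (fderiv ℝ Y (θ y)).comp (fderiv ℝ θ y) := by
    filter_upwards [hθ.continuousAt.eventually hYe, hθe] with y h1 h2
    exact fderiv_comp y h1 h2
  have d1 : DifferentiableAt ℝ (fderiv ℝ Y) (θ z) :=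
    (hY.fderiv_right (m := 1) (by norm_num)).differentiableAt (by simp)
  have d2 : DifferentiableAt ℝ (fderiv ℝ θ) z :=
    (hθ.fderiv_right (m := 1) (by norm_num)).differentiableAt (by simp)
  have d3 : HasFDerivAt (fun y => fderiv ℝ Y (θ y))
      ((fderiv ℝ (fderiv ℝ Y) (θ z)).comp (fderiv ℝ θ z)) z :=
    d1.hasFDerivAt.comp z hθe.self_of_nhds.hasFDerivAt
  rw [h1.fderiv_eq, (d3.clm_comp d2.hasFDerivAt).fderiv]
  simp [add_comm]

/-- Vanishing of the mean curvature does not depend on the parameter: the two fundamental forms are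
pulled back by the differential, so that the numerator is multiplied by the square of a
determinant. -/
theorem zmcForm_comp {Y : E' → L3} {θ : E → E'} {z : E} (hY : ContDiffAt ℝ 2 Y (θ z))
    (hθ : ContDiffAt ℝ 2 θ z) {c₀ c₁ : E'} (hspan : ∀ w : E', ∃ s t : ℝ, w = s • c₀ + t • c₁)
    {ν : L3} (hν : ∀ w, lor (fderiv ℝ Y (θ z) w) ν = 0) (h : zmcForm Y (θ z) ν c₀ c₁ = 0)
    (u₀ u₁ : E) : zmcForm (Y ∘ θ) z ν u₀ u₁ = 0 := by
  have hd : fderiv ℝ (Y ∘ θ) z = (fderiv ℝ Y (θ z)).comp (fderiv ℝ θ z) :=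
    fderiv_comp z (hY.differentiableAt (by simp)) (hθ.differentiableAt (by simp))
  have hsymm := hY.isSymmSndFDerivAt (by simp) c₀ c₁
  obtain ⟨p, q, h0⟩ := hspan (fderiv ℝ θ z u₀)
  obtain ⟨r, s, h1⟩ := hspan (fderiv ℝ θ z u₁)
  simp only [zmcForm, fderiv_fderiv_comp hY hθ, hd, ContinuousLinearMap.comp_apply, h0, h1,
    map_add, map_smul, _root_.add_apply, _root_.smul_apply,
    lor_add_left, lor_add_right, lor_smul_left, lor_smul_right, hν, ← hsymm] at h ⊢
  rw [lor_comm (fderiv ℝ Y (θ z) c₁) (fderiv ℝ Y (θ z) c₀)]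
  linear_combination (p * s - q * r) ^ 2 * h

end ZMC

/-! ### Surfaces as local graphs -/

/-- The orthogonal projection to the plane spanned by `a` and `b`, identified with `ℂ`. -/
def planeProj (a b : L3) : L3 →L[ℝ] ℂ :=
  Complex.ofRealCLM.comp (lorL a) + Complex.I • Complex.ofRealCLM.comp (lorL b)

theorem planeProj_apply (a b x : L3) : planeProj a b x = ⟨lor x a, lor x b⟩ := by
  simp [planeProj, Complex.ext_iff]

@[simp] theorem planeProj_re (a b x : L3) : (planeProj a b x).re = lor x a := by
  rw [planeProj_apply]

@[simp] theorem planeProj_im (a b x : L3) : (planeProj a b x).im = lor x b := by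
  rw [planeProj_apply]

/-- The height over the plane orthogonal to the timelike vector `n`. -/
def height (n : L3) : L3 →L[ℝ] ℝ := -lorL n

@[simp] theorem height_apply (n x : L3) : height n x = -lor x n := by simp [height]

/-- The inclusion `x + i y ↦ x a + y b` of the plane spanned by `a` and `b`. -/
def planeIncl (a b : L3) : ℂ →L[ℝ] L3 :=
  Complex.reCLM.smulRight a + Complex.imCLM.smulRight b

theorem planeIncl_apply (a b : L3) (c : ℂ) : planeIncl a b c = c.re • a + c.im • b := by
  simp [planeIncl]

/-- The parametrization `c ↦ c + φ(c) n` of the graph of `φ` over the plane spanned by `a, b`. -/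
def graphMap (a b n : L3) (φ : ℂ → ℝ) (c : ℂ) : L3 := planeIncl a b c + φ c • n

theorem LorFrame.norm_planeProj_sq {a b n : L3} (h : LorFrame a b n) (x : L3) :
    ‖planeProj a b x‖ ^ 2 = lor x x + height n x ^ 2 := by
  rw [h.lor_eq x x, ← Complex.normSq_eq_norm_sq, Complex.normSq_apply]
  simp; ring

theorem LorFrame.planeIncl_planeProj {a b n : L3} (h : LorFrame a b n) (x : L3) :
    planeIncl a b (planeProj a b x) + height n x • n = x := by
  conv_rhs => rw [h.expand x]
  rw [planeIncl_apply]
  simp [sub_eq_add_neg]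

theorem LorFrame.graphMap_eq {a b n : L3} (h : LorFrame a b n) {φ : ℂ → ℝ} {x : L3}
    (hx : height n x = φ (planeProj a b x)) : graphMap a b n φ (planeProj a b x) = x := by
  rw [graphMap, ← hx, h.planeIncl_planeProj]

theorem LorFrame.planeProj_graphMap {a b n : L3} (h : LorFrame a b n) (φ : ℂ → ℝ) (c : ℂ) :
    planeProj a b (graphMap a b n φ c) = c := by
  simp [Complex.ext_iff, graphMap, planeIncl_apply, h.aa, h.bb, h.ab, lor_comm b a, h.bn, h.an,
    lor_comm n]

/-- `φ` satisfies the maximal surface equation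
`(1 - φ_y²) φ_xx + 2 φ_x φ_y φ_xy + (1 - φ_x²) φ_yy = 0`, and `|∇φ| < 1`, at `c`. -/
structure IsMaximalGraphAt (φ : ℂ → ℝ) (c : ℂ) : Prop where
  contDiffAt : ContDiffAt ℝ ∞ φ c
  short : ∀ w ≠ 0, |fderiv ℝ φ c w| < ‖w‖
  eq : (1 - fderiv ℝ φ c Complex.I ^ 2) * fderiv ℝ (fderiv ℝ φ) c 1 1
    + 2 * fderiv ℝ φ c 1 * fderiv ℝ φ c Complex.I * fderiv ℝ (fderiv ℝ φ) c 1 Complex.I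
    + (1 - fderiv ℝ φ c 1 ^ 2) * fderiv ℝ (fderiv ℝ φ) c Complex.I Complex.I = 0

theorem IsMaximalGraphAt.congr {φ φ' : ℂ → ℝ} {c : ℂ} (h : IsMaximalGraphAt φ c)
    (he : φ =ᶠ[𝓝 c] φ') : IsMaximalGraphAt φ' c := by
  have h1 : fderiv ℝ φ =ᶠ[𝓝 c] fderiv ℝ φ' := he.fderiv
  refine ⟨h.contDiffAt.congr_of_eventuallyEq he.symm, ?_, ?_⟩
  · rw [← h1.eq_of_nhds]; exact h.short
  · rw [← h1.eq_of_nhds, ← h1.fderiv_eq]; exact h.eq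

theorem clm_apply_complex (ℓ : ℂ →L[ℝ] ℝ) (w : ℂ) : ℓ w = w.re * ℓ 1 + w.im * ℓ Complex.I := by
  have h : w = w.re • (1 : ℂ) + w.im • Complex.I := by simp [Complex.re_add_im]
  refine (congrArg ℓ h).trans ?_
  rw [map_add, map_smul, map_smul, smul_eq_mul, smul_eq_mul]

/-- A functional that is short on nonzero vectors has a gradient of length less than `1`. -/
theorem grad_sq_lt_one {ℓ : ℂ →L[ℝ] ℝ} (h : ∀ w ≠ 0, |ℓ w| < ‖w‖) :
    ℓ 1 ^ 2 + ℓ Complex.I ^ 2 < 1 := by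
  by_cases h0 : (⟨ℓ 1, ℓ Complex.I⟩ : ℂ) = 0
  · have h1 : ℓ 1 = 0 := congrArg Complex.re h0
    have h2 : ℓ Complex.I = 0 := congrArg Complex.im h0
    rw [h1, h2]; norm_num
  · have h1 := h _ h0
    rw [clm_apply_complex] at h1
    have h2 : ‖(⟨ℓ 1, ℓ Complex.I⟩ : ℂ)‖ ^ 2 = ℓ 1 ^ 2 + ℓ Complex.I ^ 2 := by
      rw [← Complex.normSq_eq_norm_sq, Complex.normSq_apply]; ring
    have h3 := norm_pos_iff.mpr h0
    have h4 := (le_abs_self _).trans_lt h1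
    simp only at h4
    nlinarith

theorem norm_lt_one_of_short {ℓ : ℂ →L[ℝ] ℝ} (h : ∀ w ≠ 0, |ℓ w| < ‖w‖) : ‖ℓ‖ < 1 := by
  have h1 := grad_sq_lt_one h
  have h2 : √(ℓ 1 ^ 2 + ℓ Complex.I ^ 2) < 1 := by
    rw [Real.sqrt_lt' one_pos]; simpa using h1
  refine (ContinuousLinearMap.opNorm_le_bound _ (Real.sqrt_nonneg _) fun w => ?_).trans_lt h2
  rw [clm_apply_complex, Real.norm_eq_abs, Complex.norm_eq_sqrt_sq_add_sq,
    ← Real.sqrt_mul (by positivity), ← Real.sqrt_sq_eq_abs]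
  refine Real.sqrt_le_sqrt ?_
  nlinarith [sq_nonneg (w.re * ℓ Complex.I - w.im * ℓ 1)]

theorem hasFDerivAt_graphMap (a b n : L3) {φ : ℂ → ℝ} {c : ℂ} (h : DifferentiableAt ℝ φ c) :
    HasFDerivAt (graphMap a b n φ) (planeIncl a b + (fderiv ℝ φ c).smulRight n) c :=
  (planeIncl a b).hasFDerivAt.add (h.hasFDerivAt.smul_const n)

theorem contDiffAt_graphMap (a b n : L3) {φ : ℂ → ℝ} {c : ℂ} {m : WithTop ℕ∞}
    (h : ContDiffAt ℝ m φ c) : ContDiffAt ℝ m (graphMap a b n φ) c :=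
  (planeIncl a b).contDiff.contDiffAt.add (h.smul contDiffAt_const)

theorem fderiv_fderiv_graphMap (a b n : L3) {φ : ℂ → ℝ} {c : ℂ} (h : ContDiffAt ℝ 2 φ c)
    (u w : ℂ) : fderiv ℝ (fderiv ℝ (graphMap a b n φ)) c u w =
      fderiv ℝ (fderiv ℝ φ) c u w • n := by
  have hφe : ∀ᶠ y in 𝓝 c, DifferentiableAt ℝ φ y :=
    (h.eventually (by simp)).mono fun y hy => hy.differentiableAt (by simp)
  have h1 : fderiv ℝ (graphMap a b n φ) =ᶠ[𝓝 c]
      fun y => planeIncl a b + ContinuousLinearMap.smulRightL ℝ ℂ L3 (fderiv ℝ φ y) n :=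
    hφe.mono fun y hy => (hasFDerivAt_graphMap a b n hy).fderiv
  have d2 : DifferentiableAt ℝ (fderiv ℝ φ) c :=
    (h.fderiv_right (m := 1) (by norm_num)).differentiableAt (by simp)
  have d3 : HasFDerivAt (fun y => planeIncl a b +
      ContinuousLinearMap.smulRightL ℝ ℂ L3 (fderiv ℝ φ y) n)
      (((ContinuousLinearMap.smulRightL ℝ ℂ L3).flip n).comp (fderiv ℝ (fderiv ℝ φ) c)) c :=
    (((ContinuousLinearMap.smulRightL ℝ ℂ L3).flip n).hasFDerivAt.comp c
      d2.hasFDerivAt).const_add _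
  rw [h1.fderiv_eq, d3.fderiv]
  simp

/-- The upward normal of the graph of `φ`. -/
def graphNormal (a b n : L3) (φ : ℂ → ℝ) (c : ℂ) : L3 :=
  fderiv ℝ φ c 1 • a + fderiv ℝ φ c Complex.I • b + n

theorem LorFrame.lor_graphNormal {a b n : L3} (h : LorFrame a b n) {φ : ℂ → ℝ} {c : ℂ}
    (hφ : DifferentiableAt ℝ φ c) (w : ℂ) :
    lor (fderiv ℝ (graphMap a b n φ) c w) (graphNormal a b n φ c) = 0 := by
  rw [(hasFDerivAt_graphMap a b n hφ).fderiv, graphNormal]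
  simp [planeIncl_apply, h.aa, h.bb, h.ab, lor_comm b a, h.bn, h.an, lor_comm n, h.nn,
    clm_apply_complex (fderiv ℝ φ c) w]
  ring

/-- The mean curvature of a graph, in terms of the maximal surface equation. -/
theorem LorFrame.zmcForm_graphMap {a b n : L3} (h : LorFrame a b n) {φ : ℂ → ℝ} {c : ℂ}
    (hφ : ContDiffAt ℝ 2 φ c) (ν : L3) : zmcForm (graphMap a b n φ) c ν 1 Complex.I =
      lor n ν * ((1 - fderiv ℝ φ c Complex.I ^ 2) * fderiv ℝ (fderiv ℝ φ) c 1 1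
    + 2 * fderiv ℝ φ c 1 * fderiv ℝ φ c Complex.I * fderiv ℝ (fderiv ℝ φ) c 1 Complex.I
    + (1 - fderiv ℝ φ c 1 ^ 2) * fderiv ℝ (fderiv ℝ φ) c Complex.I Complex.I) := by
  have hd := (hasFDerivAt_graphMap a b n (hφ.differentiableAt (by simp))).fderiv
  simp only [zmcForm, fderiv_fderiv_graphMap a b n hφ, hd]
  simp [planeIncl_apply, h.aa, h.bb, h.ab, h.bn, h.an, lor_comm n, h.nn]
  ring

section LocalGraph

variable {M : Type*} [TopologicalSpace M]

/-- The projection of the lifting of a surface to the plane spanned by `a` and `b`. -/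
def liftProj (a b v : L3) (X : M → Quo v) (q : Lifting v X) : ℂ := planeProj a b (liftMap v X q)

theorem continuous_liftMap (v : L3) (X : M → Quo v) : Continuous (liftMap v X) :=
  continuous_snd.comp continuous_subtype_val

theorem continuous_liftProj (a b v : L3) (X : M → Quo v) : Continuous (liftProj a b v X) :=
  (planeProj a b).continuous.comp (continuous_liftMap v X)

/-- Near a regular point, the lifting of a maximal surface is the graph of a solution of the
maximal surface equation over the plane orthogonal to `n`. -/
theorem MaximalAt.exists_local_graph [ChartedSpace E2 M] {a b n v : L3} (hf : LorFrame a b n)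
    (hv : v ≠ 0) {X : M → Quo v} (q₀ : Lifting v X) (hp : MaximalAt v X q₀.1.1) :
    ∃ φ : ℂ → ℝ, IsMaximalGraphAt φ (liftProj a b v X q₀) ∧
      ∃ V ∈ 𝓝 q₀, Set.InjOn (liftProj a b v X) V ∧
        ∀ q ∈ V, height n (liftMap v X q) = φ (liftProj a b v X q) := by
  obtain ⟨⟨p, x⟩, hx⟩ := q₀
  simp only at hx hp
  obtain ⟨U, f₀, hpU, hlift, hsm, hsp, hzmc⟩ := hp
  have hf0p : toQuo v (f₀ p) = toQuo v x := (hlift.lifts p hpU).trans hx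
  -- Translate the local lift so that it passes through `x`.
  set f : M → L3 := fun p' => f₀ p' + (x - f₀ p) with hfdef
  have hfp : f p = x := by simp [hfdef]
  obtain ⟨k, hk⟩ := toQuo_eq_iff.mp hf0p
  have hfl : ∀ p' ∈ U, toQuo v (f p') = X p' := fun p' hp' => by
    rw [hfdef]; simp only
    rw [hk, add_sub_cancel_left, toQuo_add_int, hlift.lifts p' hp']
  set ch := extChartAt (𝓡 2) p with hch
  set Y : E2 → L3 := f ∘ ch.symm with hY
  have hYY : Y = fun y => (f₀ ∘ ch.symm) y + (x - f₀ p) := rfl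
  have hYd : fderiv ℝ Y = fderiv ℝ (f₀ ∘ ch.symm) := by
    rw [hYY]; ext1 y; exact fderiv_add_const _
  have hYs : ContDiffAt ℝ ∞ Y (ch p) := by rw [hYY]; exact hsm.add contDiffAt_const
  have hYp : Y (ch p) = x := by
    rw [hY, Function.comp_apply, hch, extChartAt_to_inv, hfp]
  have hYsp : ∀ w : E2, w ≠ 0 → 0 < lor (fderiv ℝ Y (ch p) w) (fderiv ℝ Y (ch p) w) := by
    rw [hYd]; exact hsp
  have hYz : ∀ ν : L3, (∀ w : E2, lor (fderiv ℝ Y (ch p) w) ν = 0) →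
      zmcForm Y (ch p) ν (coordVec 0) (coordVec 1) = 0 := by
    intro ν hν
    rw [hYd] at hν
    have := hzmc ν hν
    rw [zmcForm, hYd]
    exact this
  -- The projection to the plane is a local diffeomorphism in the chart.
  set D : E2 →L[ℝ] ℂ := (planeProj a b).comp (fderiv ℝ Y (ch p)) with hD
  have hDshort : ∀ w, w ≠ 0 → |height n (fderiv ℝ Y (ch p) w)| < ‖D w‖ := fun w hw => by
    have h1 := hf.norm_planeProj_sq (fderiv ℝ Y (ch p) w)
    have h2 := hYsp w hw
    exact abs_lt_of_sq_lt_sq (by rw [hD, ContinuousLinearMap.comp_apply, h1]; linarith)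
      (norm_nonneg _)
  have hDinj : Function.Injective (D : E2 →ₗ[ℝ] ℂ) := by
    rw [← LinearMap.ker_eq_bot, LinearMap.ker_eq_bot']
    intro w hw
    by_contra hw0
    have := hDshort w hw0
    rw [show D w = 0 from hw, norm_zero] at this
    exact (abs_nonneg _).not_gt this
  let D' : E2 ≃L[ℝ] ℂ := (LinearMap.linearEquivOfInjective (D : E2 →ₗ[ℝ] ℂ) hDinj
    (by simp [Complex.finrank_real_complex])).toContinuousLinearEquiv
  have hD' : (D' : E2 →L[ℝ] ℂ) = D := by ext1 w; rfl
  have hPs : ContDiffAt ℝ ∞ (fun y => planeProj a b (Y y)) (ch p) :=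
    (planeProj a b).contDiff.contDiffAt.comp _ hYs
  have hPd : HasFDerivAt (fun y => planeProj a b (Y y)) (D' : E2 →L[ℝ] ℂ) (ch p) := by
    rw [hD']
    exact (planeProj a b).hasFDerivAt.comp _ (hYs.differentiableAt (by simp)).hasFDerivAt
  -- `e` is the projection in the chart, and `φ` the height as a function of the projection.
  set e := hPs.toOpenPartialHomeomorph _ hPd (by simp) with he
  have hecoe : ∀ y, e y = planeProj a b (Y y) := fun y => rfl
  have hes : ch p ∈ e.source := hPs.mem_toOpenPartialHomeomorph_source hPd (by simp)
  have hec : e (ch p) = planeProj a b x := by rw [hecoe, hYp]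
  have het : planeProj a b x ∈ e.target := hec ▸ e.map_source hes
  have hesymm : e.symm (planeProj a b x) = ch p := by rw [← hec, e.left_inv hes]
  have hinvs : ContDiffAt ℝ ∞ e.symm (planeProj a b x) :=
    hec ▸ hPs.to_localInverse hPd (by simp)
  have hYs' : ContDiffAt ℝ ∞ Y (e.symm (planeProj a b x)) := by rw [hesymm]; exact hYs
  set φ : ℂ → ℝ := fun c => height n (Y (e.symm c)) with hφ
  have hφs : ContDiffAt ℝ ∞ φ (planeProj a b x) :=
    (height n).contDiff.contDiffAt.comp _ (hYs'.comp _ hinvs)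
  have hgraph : graphMap a b n φ =ᶠ[𝓝 (planeProj a b x)] Y ∘ e.symm := by
    filter_upwards [e.open_target.mem_nhds het] with c hc
    have h1 : planeProj a b (Y (e.symm c)) = c := e.right_inv hc
    have h2 := hf.graphMap_eq (φ := φ) (x := Y (e.symm c)) (by rw [h1])
    rwa [h1] at h2
  have hinvd : HasFDerivAt e.symm (D'.symm : ℂ →L[ℝ] E2) (planeProj a b x) :=
    e.hasFDerivAt_symm het (by rw [hesymm]; exact hPd)
  have hcompd : fderiv ℝ (graphMap a b n φ) (planeProj a b x) =
      (fderiv ℝ Y (ch p)).comp (D'.symm : ℂ →L[ℝ] E2) := by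
    rw [hgraph.fderiv_eq, fderiv_comp _ (hYs'.differentiableAt (by simp))
      hinvd.differentiableAt, hinvd.fderiv, hesymm]
  have hφd : ∀ w, fderiv ℝ φ (planeProj a b x) w = height n (fderiv ℝ Y (ch p) (D'.symm w)) := by
    intro w
    have h1 : fderiv ℝ φ (planeProj a b x) = (height n).comp
        ((fderiv ℝ Y (e.symm (planeProj a b x))).comp (D'.symm : ℂ →L[ℝ] E2)) :=
      ((height n).hasFDerivAt.comp _ (((hYs'.differentiableAt (by simp)).hasFDerivAt).comp _
        hinvd)).fderiv
    rw [h1, hesymm]; rfl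
  have hφmax : IsMaximalGraphAt φ (planeProj a b x) := by
    refine ⟨hφs, fun w hw => ?_, ?_⟩
    · rw [hφd]
      have h1 := hDshort (D'.symm w) (by simpa using hw)
      rwa [← hD', ContinuousLinearEquiv.coe_coe, D'.apply_symm_apply] at h1
    · have hspan : ∀ w : E2, ∃ s t : ℝ, w = s • coordVec 0 + t • coordVec 1 := fun w =>
        ⟨w 0, w 1, by ext i; fin_cases i <;> simp [coordVec]⟩
      have hφ2 : ContDiffAt ℝ 2 φ (planeProj a b x) := hφs.of_le two_le_infty
      have hνY : ∀ w, lor (fderiv ℝ Y (e.symm (planeProj a b x)) w)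
          (graphNormal a b n φ (planeProj a b x)) = 0 := by
        intro w
        have h1 := hf.lor_graphNormal (hφs.differentiableAt (by simp)) (D' w)
        rw [hcompd] at h1
        rw [hesymm]
        simpa using h1
      have h2 := zmcForm_comp (hYs'.of_le two_le_infty)
        (hinvs.of_le two_le_infty) hspan hνY
        (by rw [hesymm] at hνY ⊢; exact hYz _ hνY) 1 Complex.I
      rw [← zmcForm_congr hgraph, hf.zmcForm_graphMap hφ2] at h2
      have h3 : lor n (graphNormal a b n φ (planeProj a b x)) = -1 := by
        simp [graphNormal, lor_comm n a, lor_comm n b, hf.an, hf.bn, hf.nn]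
      rw [h3] at h2
      linarith
  refine ⟨φ, hφmax, ?_⟩
  set q₀ : Lifting v X := ⟨(p, x), hx⟩ with hq₀
  have hfst : ContinuousAt (fun q : Lifting v X => q.1.1) q₀ :=
    (continuous_fst.comp continuous_subtype_val).continuousAt
  have hchc : ContinuousAt (fun q : Lifting v X => ch q.1.1) q₀ :=
    ContinuousAt.comp (f := fun q : Lifting v X => q.1.1) (x := q₀)
      (continuousAt_extChartAt (I := 𝓡 2) p) hfst
  have hfc : ContinuousAt (fun q : Lifting v X => f q.1.1) q₀ := by
    have : ContinuousAt f p :=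
      ((hlift.continuousOn.continuousAt (hlift.isOpen.mem_nhds hpU))).add continuousAt_const
    exact ContinuousAt.comp (f := fun q : Lifting v X => q.1.1) (x := q₀) this hfst
  have hUe : ∀ᶠ q in 𝓝 q₀, q.1.1 ∈ U := hfst.eventually_mem (hlift.isOpen.mem_nhds hpU)
  have hse : ∀ᶠ q in 𝓝 q₀, q.1.1 ∈ ch.source :=
    hfst.eventually_mem (extChartAt_source_mem_nhds (I := 𝓡 2) p)
  have hee : ∀ᶠ q in 𝓝 q₀, ch q.1.1 ∈ e.source :=
    hchc.eventually_mem (e.open_source.mem_nhds hes)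
  -- The lifting `X̃` and the local lift agree near `q₀`, as they agree at `q₀`.
  have heq : ∀ᶠ q in 𝓝 q₀, liftMap v X q = f q.1.1 := by
    have := eventually_sub_eq_of_toQuo_eq hv hfc (continuous_liftMap v X).continuousAt
      (hUe.mono fun q hq => (hfl _ hq).trans q.2)
    filter_upwards [this] with q hq
    have h0 : liftMap v X q₀ - f q₀.1.1 = 0 := by simp [liftMap, hq₀, hfp]
    exact sub_eq_zero.mp (hq.trans h0)
  have hall := (hse.and (hee.and heq))
  refine ⟨{q | q.1.1 ∈ ch.source ∧ ch q.1.1 ∈ e.source ∧ liftMap v X q = f q.1.1}, hall, ?_, ?_⟩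
  · have hpr : ∀ q : Lifting v X, q.1.1 ∈ ch.source → liftMap v X q = f q.1.1 →
        liftProj a b v X q = e (ch q.1.1) := fun q h1 h2 => by
      rw [hecoe, liftProj, h2, hY, Function.comp_apply, ch.left_inv h1]
    rintro q ⟨h1, h2, h3⟩ q' ⟨h1', h2', h3'⟩ hqq
    rw [hpr q h1 h3, hpr q' h1' h3'] at hqq
    have h4 := ch.injOn h1 h1' (e.injOn h2 h2' hqq)
    refine Subtype.ext (Prod.ext h4 ?_)
    change liftMap v X q = liftMap v X q'
    rw [h3, h3', h4]
  · rintro q ⟨h1, h2, h3⟩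
    have hYq : Y (ch q.1.1) = liftMap v X q := by
      rw [hY, Function.comp_apply, ch.left_inv h1, h3]
    have h4 : liftProj a b v X q = e (ch q.1.1) := by rw [hecoe, hYq, liftProj]
    rw [hφ, h4]
    simp only
    rw [e.left_inv h2, hYq]

end LocalGraph

/-! ### The lifting of an entire maximal surface over a plane -/

section Surface

open Set Metric Filter

theorem IsBranchedCovering.comp_homeomorph {S P : Type*} [TopologicalSpace S] [TopologicalSpace P]
    {h : S → P} (hb : IsBranchedCovering h) (Ψ : P ≃ₜ ℂ) : IsBranchedCovering (Ψ ∘ h) where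
  continuous := Ψ.continuous.comp hb.continuous
  branched p := by
    obtain ⟨n, e₁, e₂, h1, h2, h3, h4, h5, h6, h7⟩ := hb.branched p
    refine ⟨n, e₁, Ψ.symm.toOpenPartialHomeomorph.trans e₂, h1, h2, h3, h4, ?_, ?_, ?_⟩
    · simp [h5]
    · rw [image_comp, h6]
      ext c
      simp [Ψ.image_eq_preimage_symm]
    · intro q hq
      simpa using h7 q hq
  path_lifting β p hp := by
    obtain ⟨α, h0, h1⟩ := hb.path_lifting ((⟨Ψ.symm, Ψ.symm.continuous⟩ : C(ℂ, P)).comp β) p (by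
      simp only [ContinuousMap.comp_apply, ContinuousMap.coe_mk, ← hp, Function.comp_apply,
        Homeomorph.symm_apply_apply])
    refine ⟨α, h0, fun t => ?_⟩
    rw [Function.comp_apply, h1]
    simp

/-- The plane orthogonal to the timelike vector of a frame is `ℂ`. -/
def LorFrame.planeHomeo {a b n : L3} (h : LorFrame a b n) : OrthPlane n ≃ₜ ℂ where
  toFun x := planeProj a b x
  invFun c := ⟨planeIncl a b c, by simp [planeIncl_apply, h.an, h.bn]⟩
  left_inv x := by
    ext1
    have h1 := h.planeIncl_planeProj x
    have h2 : height n x = 0 := by simp [x.2]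
    rwa [h2, zero_smul, add_zero] at h1
  right_inv c := by
    have := h.planeProj_graphMap 0 c
    simpa [graphMap] using this
  continuous_toFun := (planeProj a b).continuous.comp continuous_subtype_val
  continuous_invFun := (planeIncl a b).continuous.subtype_mk _

variable {M : Type*} [TopologicalSpace M] {v : L3} {X : M → Quo v}

theorem IsBranchedCovering.liftProj {a b n : L3} (hf : LorFrame a b n) (hn : lor n n = -1)
    (hb : IsBranchedCovering (orthProj n hn ∘ liftMap v X)) :
    IsBranchedCovering (liftProj a b v X) := by
  convert! hb.comp_homeomorph hf.planeHomeo using 1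
  ext1 q
  simp [LorFrame.planeHomeo, MaxSurf.liftProj, orthProj, Complex.ext_iff, lor_comm n a,
    lor_comm n b, hf.an, hf.bn]

/-- The points of the lifting over the singular set. -/
def liftSing (v : L3) (X : M → Quo v) (F : Set M) : Set (Lifting v X) := {q | q.1.1 ∈ F}

/-- The deck transformation `(p, x) ↦ (p, x + k v)`. -/
def deck (v : L3) (X : M → Quo v) (k : ℤ) (q : Lifting v X) : Lifting v X :=
  ⟨(q.1.1, q.1.2 + (k : ℝ) • v), by rw [toQuo_add_int]; exact q.2⟩

theorem continuous_deck (k : ℤ) : Continuous (deck v X k) := by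
  refine Continuous.subtype_mk ?_ _
  exact (continuous_fst.comp continuous_subtype_val).prodMk
    ((continuous_snd.comp continuous_subtype_val).add continuous_const)

omit [TopologicalSpace M] in
theorem deck_add (j k : ℤ) (q : Lifting v X) : deck v X (j + k) q = deck v X j (deck v X k q) := by
  refine Subtype.ext (Prod.ext rfl ?_)
  simp only [deck, Int.cast_add, add_smul]; abel

omit [TopologicalSpace M] in
theorem deck_zero (q : Lifting v X) : deck v X 0 q = q := by
  refine Subtype.ext (Prod.ext rfl ?_)
  simp [deck]

omit [TopologicalSpace M] in
/-- Two points of the lifting over the same point of `M` differ by a deck transformation. -/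
theorem exists_deck_eq {q q' : Lifting v X} (h : q.1.1 = q'.1.1) : ∃ k, q' = deck v X k q := by
  have h1 : toQuo v q.1.2 = toQuo v q'.1.2 := by rw [← q.2, ← q'.2, h]
  obtain ⟨k, hk⟩ := toQuo_eq_iff.mp h1
  exact ⟨k, Subtype.ext (Prod.ext h.symm hk)⟩

omit [TopologicalSpace M] in
theorem liftProj_deck {a b : L3} (hvb : lor v b = 0) (k : ℤ) (q : Lifting v X) :
    liftProj a b v X (deck v X k q) = liftProj a b v X q + ((k * lor v a : ℝ) : ℂ) := by
  simp [liftProj, deck, liftMap, Complex.ext_iff, hvb]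

/-- The projection of the lifting `M̃` to `M` is open. -/
theorem isOpenMap_fst_lifting (hX : Continuous X) :
    IsOpenMap (fun q : Lifting v X => q.1.1) := by
  rw [isOpenMap_iff_nhds_le]
  intro q A hA
  -- A neighbourhood `{(p, x) | p ∈ U, x ∈ W}` projects onto `U ∩ X ⁻¹' (toQuo '' W)`.
  rw [Filter.mem_map] at hA
  obtain ⟨B, hB, hBA⟩ := mem_nhds_induced _ _ _ |>.mp hA
  obtain ⟨U, hU, W, hW, hUW⟩ := mem_nhds_prod_iff.mp hB
  have h1 : toQuo v '' W ∈ 𝓝 (X q.1.1) := by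
    rw [q.2]; exact (isOpenMap_toQuo v).image_mem_nhds hW
  filter_upwards [hU, hX.continuousAt h1] with p hp hp2
  obtain ⟨x, hx, hxp⟩ := hp2
  exact hBA (show (⟨(p, x), hxp.symm⟩ : Lifting v X) ∈ _ from hUW ⟨hp, hx⟩)

omit [TopologicalSpace M] in
theorem exists_lifting (p : M) : ∃ q : Lifting v X, q.1.1 = p := by
  obtain ⟨x, hx⟩ := QuotientAddGroup.mk_surjective (X p)
  exact ⟨⟨(p, x), hx.symm⟩, rfl⟩

omit [TopologicalSpace M] in
theorem liftProj_im {a b : L3} (hvb : lor v b = 0) (q : Lifting v X) :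
    (liftProj a b v X q).im = quoCoord v b hvb (X q.1.1) := by
  rw [q.2]; simp [liftProj, liftMap]

omit [TopologicalSpace M] in
/-- The singular values are locally finite: they are the translates of finitely many points by the
multiples of `⟨v, a⟩ > 0`. -/
theorem finite_singular_values {a b : L3} (hvb : lor v b = 0) (hva : 0 < lor v a) {F : Set M}
    (hF : F.Finite) (R : ℝ) :
    (liftProj a b v X '' liftSing v X F ∩ closedBall 0 R).Finite := by
  choose s hs using fun p => exists_lifting (X := X) p
  have h1 : ∀ p ∈ F, ((fun k : ℤ => liftProj a b v X (deck v X k (s p))) ''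
      {k : ℤ | |(liftProj a b v X (s p)).re + k * lor v a| ≤ R}).Finite := by
    intro p _
    refine Finite.image _ ?_
    refine (finite_Icc (⌈(-R - (liftProj a b v X (s p)).re) / lor v a⌉)
      (⌊(R - (liftProj a b v X (s p)).re) / lor v a⌋)).subset fun k hk => ?_
    have hk' : |(liftProj a b v X (s p)).re + k * lor v a| ≤ R := hk
    rw [abs_le] at hk'
    refine ⟨Int.ceil_le.mpr ?_, Int.le_floor.mpr ?_⟩
    · rw [div_le_iff₀ hva]; linarith [hk'.1]
    · rw [le_div_iff₀ hva]; linarith [hk'.2]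
  refine (hF.biUnion h1).subset ?_
  rintro _ ⟨⟨q, hq, rfl⟩, hR⟩
  obtain ⟨k, hk⟩ := exists_deck_eq (q := s q.1.1) (q' := q) (hs _)
  refine mem_biUnion (x := q.1.1) hq ⟨k, ?_, congrArg (MaxSurf.liftProj a b v X) hk.symm⟩
  rw [hk, mem_closedBall_zero_iff] at hR
  refine le_trans (le_trans (le_of_eq ?_) (Complex.abs_re_le_norm _)) hR
  rw [liftProj_deck hvb]
  simp

/-- An entire surface of finite type, seen over the plane with orthonormal basis `(a, b)`, `b ⊥ v`:
the geometric data shared by the description of its ends. -/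
structure EntireData [ChartedSpace E2 M] (v : L3) (X : M → Quo v) (F : Set M) (a b n : L3) :
    Prop where
  continuous : Continuous X
  isClosed : IsClosed F
  finite : F.Finite
  maximalAt : ∀ p, p ∉ F → MaximalAt v X p
  ne_zero : v ≠ 0
  frame : LorFrame a b n
  orth : lor v b = 0
  pos : 0 < lor v a
  branched : IsBranchedCovering (liftProj a b v X)
  sheeted : FinitelySheeted v X

namespace EntireData

variable [ChartedSpace E2 M] {F : Set M} {a b n : L3}

theorem locallyInjective (D : EntireData v X F a b n) :
    ∀ q ∉ liftSing v X F, ∃ V ∈ 𝓝 q, InjOn (MaxSurf.liftProj a b v X) V := fun q hq => by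
  obtain ⟨φ, -, V, hV, hinj, -⟩ :=
    MaximalAt.exists_local_graph D.frame D.ne_zero q (D.maximalAt _ hq)
  exact ⟨V, hV, hinj⟩

theorem locallyShort (D : EntireData v X F a b n) :
    IsLocallyShort (MaxSurf.liftProj a b v X) (fun q => height n (liftMap v X q))
      (liftSing v X F) := fun q hq => by
  obtain ⟨φ, hφ, V, hV, -, hgr⟩ :=
    MaximalAt.exists_local_graph D.frame D.ne_zero q (D.maximalAt _ hq)
  have h1 := (hφ.contDiffAt.hasStrictFDerivAt (by simp)).exists_lipschitzOnWith_of_nnnorm_lt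
    1 (by exact_mod_cast norm_lt_one_of_short hφ.short)
  obtain ⟨A, hA, hlip⟩ := h1
  refine ⟨V ∩ MaxSurf.liftProj a b v X ⁻¹' A, inter_mem hV
    ((continuous_liftProj a b v X).continuousAt hA), ?_⟩
  rintro q₁ ⟨h1, h2⟩ q₂ ⟨h3, h4⟩
  simp only [hgr q₁ h1, hgr q₂ h3]
  simpa [Real.dist_eq, dist_eq_norm] using hlip.dist_le_mul _ h2 _ h4

theorem finite_fiber [T2Space M] (D : EntireData v X F a b n) (c : ℂ) :
    (MaxSurf.liftProj a b v X ⁻¹' {c}).Finite := by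
  obtain ⟨x₀, d, hd, hfin⟩ := D.sheeted
  have hd2 : ‖planeProj a b d‖ < |height n d| := by
    have := D.frame.norm_planeProj_sq d
    rw [← abs_of_nonneg (norm_nonneg (planeProj a b d))]
    exact sq_lt_sq.mp (by linarith)
  refine D.branched.finite_fiber D.locallyInjective
    (finite_singular_values D.orth D.pos D.finite)
    ((height n).continuous.comp (continuous_liftMap v X)) D.locallyShort
    (a := planeProj a b x₀) (a₃ := height n x₀) hd2 ?_ c
  -- A point over the projected line at the height of the line lies on the line.
  have key : ∀ x : Lifting v X × ℝ, MaxSurf.liftProj a b v X x.1 =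
      planeProj a b x₀ + x.2 * planeProj a b d ∧
      height n (liftMap v X x.1) = height n x₀ + x.2 * height n d → x.1.1.2 = x₀ + x.2 • d := by
    rintro ⟨q, t⟩ ⟨h1, h2⟩
    rw [← D.frame.planeIncl_planeProj (x₀ + t • d), ← D.frame.planeIncl_planeProj q.1.2]
    have h1' : planeProj a b q.1.2 = planeProj a b (x₀ + t • d) := by
      rw [map_add, map_smul, Complex.real_smul]; exact h1
    have h2' : height n q.1.2 = height n (x₀ + t • d) := by
      rw [map_add, map_smul, smul_eq_mul]; exact h2
    rw [h1', h2']
  refine Finite.of_finite_image (f := fun x : Lifting v X × ℝ => (x.1.1.1, x.2))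
    (hfin.subset ?_) ?_
  · rintro _ ⟨x, hx, rfl⟩
    have := x.1.2
    rw [key x hx] at this
    exact this
  · rintro x hx y hy hxy
    obtain ⟨h0, h1⟩ := Prod.ext_iff.mp hxy
    refine Prod.ext (Subtype.ext (Prod.ext h0 ?_)) h1
    rw [key x hx, key y hy, show x.2 = y.2 from h1]

/-- The axial coordinate `⟨X, b⟩` is proper on `M`: every point of `M` lifts to the strip
`0 ≤ re ≤ ⟨v, a⟩`, and the projection of the lifting to the plane is proper. -/
theorem isCompact_setOf_abs_le [T2Space M] (D : EntireData v X F a b n) (R : ℝ) :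
    IsCompact {p | |quoCoord v b D.orth (X p)| ≤ R} := by
  have h1 := (D.branched.isProperMap D.finite_fiber).isCompact_preimage
    (K := Icc 0 (lor v a) ×ℂ Icc (-R) R) (isCompact_Icc.reProdIm isCompact_Icc)
  have hc : Continuous fun q : Lifting v X => q.1.1 := continuous_fst.comp continuous_subtype_val
  convert! h1.image hc using 1
  ext p
  constructor
  · intro hp
    obtain ⟨q, hq⟩ := exists_lifting (X := X) p
    -- Translate the lift `q` of `p` into the strip.
    set k := -⌊(MaxSurf.liftProj a b v X q).re / lor v a⌋ with hk
    refine ⟨deck v X k q, ?_, hq⟩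
    have h3 : |quoCoord v b D.orth (X p)| ≤ R := hp
    rw [← hq, ← liftProj_im (a := a), abs_le] at h3
    have h4 := Int.floor_le ((MaxSurf.liftProj a b v X q).re / lor v a)
    have h5 := Int.lt_floor_add_one ((MaxSurf.liftProj a b v X q).re / lor v a)
    rw [le_div_iff₀ D.pos] at h4
    rw [div_lt_iff₀ D.pos] at h5
    rw [mem_preimage, Complex.mem_reProdIm, liftProj_deck D.orth]
    simp only [Complex.add_re, Complex.ofReal_re, Complex.add_im, Complex.ofReal_im, add_zero,
      mem_Icc]
    refine ⟨⟨?_, ?_⟩, h3⟩ <;> rw [hk] <;> push_cast <;> linarith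
  · rintro ⟨q, hq, rfl⟩
    have h3 := hq.2
    rw [mem_preimage, liftProj_im D.orth] at h3
    exact abs_le.mpr h3

end EntireData

end Surface

section Sheets

open Set Metric Filter

/-! ### Sheets over a half plane -/

variable {M : Type*} [TopologicalSpace M] {v : L3} {X : M → Quo v} {F : Set M} {a b n : L3}

/-- `σ` is a sheet of the lifting over the half plane `{im > y₀}`, invariant under `T ^ w` and no
smaller power of `T`; it covers a `w`-fold half cylinder in `M`. -/
structure IsSheet (v : L3) (X : M → Quo v) (a b : L3) (y₀ : ℝ) (w : ℕ) (σ : ℂ → Lifting v X) :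
    Prop where
  one_le : 1 ≤ w
  continuousOn : ContinuousOn σ {c | y₀ < c.im}
  proj : ∀ c, y₀ < c.im → liftProj a b v X (σ c) = c
  period : ∀ c, y₀ < c.im → ∀ k : ℤ,
    σ (c + ((k * (w * lor v a) : ℝ) : ℂ)) = deck v X (k * w) (σ c)
  fst_eq : ∀ c c', y₀ < c.im → y₀ < c'.im → (σ c).1.1 = (σ c').1.1 →
    ∃ k : ℤ, c' = c + ((k * (w * lor v a) : ℝ) : ℂ)

theorem isOpen_halfPlane (y₀ : ℝ) : IsOpen {c : ℂ | y₀ < c.im} :=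
  isOpen_lt continuous_const Complex.continuous_im

theorem isPreconnected_halfPlane (y₀ : ℝ) : IsPreconnected {c : ℂ | y₀ < c.im} :=
  (convex_halfSpace_im_gt y₀).isPreconnected

namespace EntireData

variable [ChartedSpace E2 M]

theorem exists_singular_bound (D : EntireData v X F a b n) :
    ∃ y₀, ∀ q ∈ liftSing v X F, (MaxSurf.liftProj a b v X q).im ≤ y₀ := by
  obtain ⟨y₀, hy₀⟩ := (D.finite.image fun p => quoCoord v b D.orth (X p)).bddAbove
  exact ⟨y₀, fun q hq => by
    rw [liftProj_im D.orth]; exact hy₀ (mem_image_of_mem _ hq)⟩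

/-- The translate of a section by a deck transformation. -/
theorem section_deck (D : EntireData v X F a b n) {y₀ : ℝ} {σ : ℂ → Lifting v X}
    (h1 : ContinuousOn σ {c | y₀ < c.im})
    (h2 : ∀ c, y₀ < c.im → MaxSurf.liftProj a b v X (σ c) = c) (k : ℤ) :
    ContinuousOn (fun c => deck v X k (σ (c - ((k * lor v a : ℝ) : ℂ)))) {c | y₀ < c.im} ∧
    ∀ c, y₀ < c.im →
      MaxSurf.liftProj a b v X (deck v X k (σ (c - ((k * lor v a : ℝ) : ℂ)))) = c := by
  constructor
  · refine (continuous_deck k).comp_continuousOn (h1.comp (by fun_prop) fun c hc => ?_)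
    simpa [-Complex.ofReal_mul] using hc
  · intro c hc
    rw [liftProj_deck D.orth, h2 _ (by simpa [-Complex.ofReal_mul] using hc)]
    ring

/-- Over a half plane without singular values there is a sheet through each point. Its translates by the
powers of `T` have values in the same finite fibres, so that some translate coincides with it. -/
theorem exists_sheet [T2Space M] (D : EntireData v X F a b n) {y₀ : ℝ}
    (hy : ∀ q ∈ liftSing v X F, (MaxSurf.liftProj a b v X q).im ≤ y₀) {q₀ : Lifting v X}
    (hq₀ : y₀ < (MaxSurf.liftProj a b v X q₀).im) :
    ∃ σ w, IsSheet v X a b y₀ w σ ∧ σ (MaxSurf.liftProj a b v X q₀) = q₀ := by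
  obtain ⟨σ, h1, h2, h3⟩ := D.branched.exists_section D.locallyInjective D.finite_fiber hy hq₀
  have hUF : ∀ q ∈ liftSing v X F, MaxSurf.liftProj a b v X q ∉ {c : ℂ | y₀ < c.im} :=
    fun q hq h => (hy q hq).not_gt h
  set c₀ := MaxSurf.liftProj a b v X q₀ with hc₀
  set σk : ℤ → ℂ → Lifting v X := fun k c => deck v X k (σ (c - ((k * lor v a : ℝ) : ℂ)))
    with hσk
  have hagree : ∀ j k : ℤ, ∀ c, y₀ < c.im → σk j c = σk k c → ∀ c', y₀ < c'.im →
      σk j c' = σk k c' := fun j k c hc heq c' hc' =>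
    section_eqOn D.locallyInjective (isPreconnected_halfPlane y₀) hUF
      (D.section_deck h1 h2 j).1 (D.section_deck h1 h2 k).1 (D.section_deck h1 h2 j).2
      (D.section_deck h1 h2 k).2 hc heq hc'
  -- The powers of `T` that preserve the sheet.
  have hshift : ∀ (c : ℂ) (r : ℝ), y₀ < c.im → y₀ < (c + (r : ℂ)).im := fun c r hc => by
    simpa using hc
  let G : AddSubgroup ℤ :=
    { carrier := {k | ∀ c, y₀ < c.im → σ (c + ((k * lor v a : ℝ) : ℂ)) = deck v X k (σ c)}
      zero_mem' := fun c _ => by simp [deck_zero]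
      add_mem' := by
        intro j k hj hk c hc
        have h4 := hj _ (hshift c (k * lor v a) hc)
        rw [deck_add, ← hk c hc, ← h4]
        congr 1; push_cast; ring
      neg_mem' := by
        intro k hk c hc
        have h4 := hk _ (hshift c ((-k : ℤ) * lor v a) hc)
        have h5 : c + (((-k : ℤ) * lor v a : ℝ) : ℂ) + ((k * lor v a : ℝ) : ℂ) = c := by
          push_cast; ring
        rw [h5] at h4
        rw [h4, ← deck_add]; simp [deck_zero] }
  have hG : ∀ k : ℤ, ∀ c, y₀ < c.im → σ (c + ((k * lor v a : ℝ) : ℂ)) = deck v X k (σ c) →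
      k ∈ G := by
    intro k c hc heq c' hc'
    have h4 := hagree 0 k _ (hshift c (k * lor v a) hc) (by
      simp only [hσk, add_sub_cancel_right]
      simpa [deck_zero] using heq) _ (hshift c' (k * lor v a) hc')
    simp only [hσk, add_sub_cancel_right] at h4
    simpa [deck_zero] using h4
  -- The fibre over `c₀` is finite, so two translates agree there, and hence everywhere.
  obtain ⟨j, k, hjk, heq⟩ : ∃ j k : ℤ, j ≠ k ∧ σk j c₀ = σk k c₀ := by
    by_contra! hcon
    have hinj : Function.Injective fun k : ℤ => σk k c₀ := fun j k hjk => by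
      by_contra hne; exact hcon j k hne hjk
    refine (infinite_range_of_injective hinj) ((D.finite_fiber c₀).subset ?_)
    rintro _ ⟨k, rfl⟩
    exact (D.section_deck h1 h2 k).2 c₀ hq₀
  have hmem : k - j ∈ G := by
    refine hG _ c₀ hq₀ ?_
    have h4 := hagree j k c₀ hq₀ heq _ (hshift c₀ (k * lor v a) hq₀)
    simp only [hσk, add_sub_cancel_right] at h4
    have h5 : c₀ + (((k - j : ℤ) * lor v a : ℝ) : ℂ)
        = c₀ + ((k * lor v a : ℝ) : ℂ) - ((j * lor v a : ℝ) : ℂ) := by push_cast; ring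
    rw [h5]
    have h6 := congrArg (deck v X (-j)) h4
    rw [← deck_add, ← deck_add, neg_add_cancel, deck_zero] at h6
    rw [h6]; congr 1; ring
  obtain ⟨g, hg⟩ := Int.subgroup_cyclic G
  rw [← AddSubgroup.zmultiples_eq_closure] at hg
  have hg0 : g ≠ 0 := by
    rintro rfl
    rw [hg, AddSubgroup.mem_zmultiples_iff] at hmem
    obtain ⟨m, hm⟩ := hmem
    simp at hm; omega
  have hGw : ∀ k : ℤ, k ∈ G ↔ ∃ m : ℤ, k = m * (g.natAbs : ℤ) := by
    intro k
    rw [hg, AddSubgroup.mem_zmultiples_iff]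
    rcases Int.natAbs_eq g with h | h
    · rw [← h]; exact exists_congr fun m => by rw [smul_eq_mul, eq_comm]
    · constructor
      · rintro ⟨m, rfl⟩
        exact ⟨-m, by rw [smul_eq_mul]; conv_lhs => rw [h]
                      ring⟩
      · rintro ⟨m, rfl⟩
        exact ⟨-m, by rw [smul_eq_mul]; conv_lhs => rw [h]
                      ring⟩
  obtain ⟨w, hw, hGw⟩ : ∃ w : ℕ, 1 ≤ w ∧ ∀ k : ℤ, k ∈ G ↔ ∃ m : ℤ, k = m * (w : ℤ) :=
    ⟨g.natAbs, Int.natAbs_pos.mpr hg0, hGw⟩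
  refine ⟨σ, w, ⟨hw, h1, h2, fun c hc k => ?_,
    fun c c' hc hc' heq => ?_⟩, h3⟩
  · have h4 : k * (w : ℤ) ∈ G := (hGw _).mpr ⟨k, rfl⟩
    rw [← h4 c hc]; congr 1; push_cast; ring
  · obtain ⟨m, hm⟩ := exists_deck_eq heq
    have h4 : c' = c + ((m * lor v a : ℝ) : ℂ) := by
      rw [← h2 c' hc', hm, liftProj_deck D.orth, h2 c hc]
    obtain ⟨m', hm'⟩ := (hGw m).mp (hG m c hc (by rw [← h4, hm]))
    exact ⟨m', by rw [h4, hm']; push_cast; ring⟩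

/-- The part of `M` covered by a sheet is a union of components of the part of `M` over the half
plane. -/
theorem sheet_covers [T2Space M] (D : EntireData v X F a b n) {y₀ : ℝ}
    (hy : ∀ q ∈ liftSing v X F, (MaxSurf.liftProj a b v X q).im ≤ y₀) {w : ℕ}
    {σ : ℂ → Lifting v X} (hσ : IsSheet v X a b y₀ w σ) {K : Set M} (hK : IsPreconnected K)
    (hKy : ∀ p ∈ K, y₀ < quoCoord v b D.orth (X p)) {c₀ : ℂ} (hc₀ : y₀ < c₀.im)
    (hc₀K : (σ c₀).1.1 ∈ K) : K ⊆ (fun c => (σ c).1.1) '' {c | y₀ < c.im} := by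
  have hUF : ∀ q ∈ liftSing v X F, MaxSurf.liftProj a b v X q ∉ {c : ℂ | y₀ < c.im} :=
    fun q hq h => (hy q hq).not_gt h
  have himg : ∀ {w' : ℕ} {σ' : ℂ → Lifting v X}, IsSheet v X a b y₀ w' σ' →
      IsOpen ((fun c => (σ' c).1.1) '' {c | y₀ < c.im}) := by
    intro w' σ' hσ'
    have h1 := isOpen_section_image (continuous_liftProj a b v X) D.locallyInjective
      (isOpen_halfPlane y₀) hUF hσ'.continuousOn hσ'.proj (isOpen_halfPlane y₀) subset_rfl
    have h2 := isOpenMap_fst_lifting D.continuous _ h1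
    rwa [← image_comp] at h2
  set A := (fun c => (σ c).1.1) '' {c | y₀ < c.im} with hA
  -- Two sheets covering a common point of `M` are translates of each other, so they have the same image.
  have hB : IsOpen {p | p ∉ A ∧ y₀ < quoCoord v b D.orth (X p)} := by
    rw [isOpen_iff_mem_nhds]
    rintro p ⟨hpA, hpy⟩
    obtain ⟨q, rfl⟩ := exists_lifting (X := X) p
    rw [← liftProj_im (a := a)] at hpy
    obtain ⟨σ', w', hσ', hq⟩ := D.exists_sheet hy hpy
    have hmem : q.1.1 ∈ (fun c => (σ' c).1.1) '' {c | y₀ < c.im} :=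
      ⟨_, hpy, congrArg (fun q : Lifting v X => q.1.1) hq⟩
    filter_upwards [(himg hσ').mem_nhds hmem]
    rintro _ ⟨c', hc', rfl⟩
    refine ⟨?_, ?_⟩
    · rintro ⟨c, hc, heq⟩
      obtain ⟨k, hk⟩ := exists_deck_eq heq
      have h4 : c' = c + ((k * lor v a : ℝ) : ℂ) := by
        rw [← hσ'.proj c' hc', hk, liftProj_deck D.orth, hσ.proj c hc]
      have h5 := D.section_deck hσ.continuousOn hσ.proj k
      have h6 := section_eqOn D.locallyInjective (isPreconnected_halfPlane y₀) hUF
        hσ'.continuousOn h5.1 hσ'.proj h5.2 hc' (by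
          rw [h4, add_sub_cancel_right, ← h4]; exact hk) hpy
      apply hpA
      rw [hq] at h6
      refine ⟨_, ?_, (congrArg (fun q : Lifting v X => q.1.1) h6).symm⟩
      simpa [-Complex.ofReal_mul] using hpy
    · rw [← liftProj_im (a := a), hσ'.proj c' hc']; exact hc'
  have := isPreconnected_iff_subset_of_disjoint.mp hK A _ (himg hσ) hB
    (fun p hp => by
      by_cases h : p ∈ A
      · exact Or.inl h
      · exact Or.inr ⟨h, hKy p hp⟩)
    (by ext p; simp; tauto)
  rcases this with h | h
  · exact h
  · exact absurd ⟨c₀, hc₀, rfl⟩ (h hc₀K).1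

/-- The height of a sheet, as a function on the half plane. -/
def sheetHeight (n : L3) (σ : ℂ → Lifting v X) (c : ℂ) : ℝ := height n (liftMap v X (σ c))

theorem liftMap_sheet (D : EntireData v X F a b n) {y₀ : ℝ} {w : ℕ} {σ : ℂ → Lifting v X}
    (hσ : IsSheet v X a b y₀ w σ) {c : ℂ} (hc : y₀ < c.im) :
    liftMap v X (σ c) = graphMap a b n (sheetHeight n σ) c := by
  have h1 : planeProj a b (liftMap v X (σ c)) = c := hσ.proj c hc
  have h2 := D.frame.graphMap_eq (φ := sheetHeight n σ) (x := liftMap v X (σ c)) (by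
    rw [h1]; rfl)
  rw [h1] at h2
  exact h2.symm

/-- The height of a sheet solves the maximal surface equation. -/
theorem isMaximalGraphAt_sheet (D : EntireData v X F a b n) {y₀ : ℝ}
    (hy : ∀ q ∈ liftSing v X F, (MaxSurf.liftProj a b v X q).im ≤ y₀) {w : ℕ}
    {σ : ℂ → Lifting v X} (hσ : IsSheet v X a b y₀ w σ) {c : ℂ} (hc : y₀ < c.im) :
    IsMaximalGraphAt (sheetHeight n σ) c := by
  have hns : σ c ∉ liftSing v X F := fun h => (hy _ h).not_gt (by rw [hσ.proj c hc]; exact hc)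
  obtain ⟨φ, hφ, V, hV, -, hgr⟩ :=
    MaximalAt.exists_local_graph D.frame D.ne_zero (σ c) (D.maximalAt _ hns)
  rw [hσ.proj c hc] at hφ
  refine hφ.congr ?_
  have hop := (isOpen_halfPlane y₀).mem_nhds hc
  filter_upwards [(hσ.continuousOn.continuousAt hop).eventually_mem hV, hop] with c' h1 h2
  rw [sheetHeight, hgr _ h1, hσ.proj c' h2]

omit [ChartedSpace E2 M] in
theorem sheetHeight_period {y₀ : ℝ} {w : ℕ} {σ : ℂ → Lifting v X}
    (hσ : IsSheet v X a b y₀ w σ) {c : ℂ} (hc : y₀ < c.im) :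
    sheetHeight n σ (c + ((w * lor v a : ℝ) : ℂ)) = sheetHeight n σ c + w * height n v := by
  have h1 := hσ.period c hc 1
  rw [Int.cast_one, one_mul] at h1
  rw [sheetHeight, h1, sheetHeight, liftMap, deck]
  simp only [map_add, map_smul, smul_eq_mul]
  simp [liftMap]

end EntireData

end Sheets

section EndTopology

open Set Metric Filter

/-! ### Topology of an end -/

/-- Polar coordinates. -/
theorem isPreconnected_ball_diff_center {E : Type*} [NormedAddCommGroup E] [NormedSpace ℝ E]
    (hE : 1 < Module.rank ℝ E) (x : E) (r : ℝ) : IsPreconnected (ball x r \ {x}) := by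
  have h1 : IsPreconnected (Ioo 0 r ×ˢ sphere (0 : E) 1) :=
    isPreconnected_Ioo.prod (isPreconnected_sphere hE 0 1)
  convert! h1.image (fun t : ℝ × E => x + t.1 • t.2) (by fun_prop) using 1
  ext y
  simp only [Set.mem_sdiff, mem_ball, mem_singleton_iff, mem_image, mem_prod, mem_Ioo,
    mem_sphere_zero_iff_norm, Prod.exists]
  constructor
  · rintro ⟨h1, h2⟩
    have h3 : 0 < ‖y - x‖ := norm_pos_iff.mpr (sub_ne_zero.mpr h2)
    rw [dist_eq_norm] at h1
    refine ⟨‖y - x‖, ‖y - x‖⁻¹ • (y - x), ⟨⟨h3, h1⟩, ?_⟩, ?_⟩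
    · rw [norm_smul, norm_inv, norm_norm, inv_mul_cancel₀ h3.ne']
    · rw [smul_smul, mul_inv_cancel₀ h3.ne', one_smul]; abel
  · rintro ⟨t, u, ⟨⟨h1, h2⟩, h3⟩, rfl⟩
    refine ⟨?_, ?_⟩
    · rw [dist_eq_norm, add_sub_cancel_left, norm_smul, h3, mul_one, Real.norm_eq_abs,
        abs_of_pos h1]
      exact h2
    · intro h4
      have h5 : t • u = 0 := by simpa using h4
      rcases smul_eq_zero.mp h5 with h6 | h6
      · exact h1.ne' h6
      · rw [h6, norm_zero] at h3; exact zero_ne_one h3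

theorem one_lt_rank_E2 : 1 < Module.rank ℝ E2 := by
  rw [← Module.finrank_eq_rank]
  simp

/-- In a surface the punctured neighbourhoods of a point have a basis of nonempty preconnected
sets. -/
theorem exists_preconnected_punctured_nhds {N : Type*} [TopologicalSpace N] [ChartedSpace E2 N]
    (P : N) {W : Set N} (hW : W ∈ 𝓝 P) :
    ∃ U, IsOpen U ∧ P ∈ U ∧ U ⊆ W ∧ IsPreconnected (U \ {P}) ∧ (U \ {P}).Nonempty := by
  set e := chartAt E2 P with he
  have hP : P ∈ e.source := mem_chart_source E2 P
  have ht : e P ∈ e.target := e.map_source hP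
  have h1 : e.target ∩ e.symm ⁻¹' W ∈ 𝓝 (e P) :=
    inter_mem (e.open_target.mem_nhds ht) (e.continuousAt_symm ht (by rwa [e.left_inv hP]))
  obtain ⟨r, hr, hrs⟩ := Metric.mem_nhds_iff.mp h1
  have hsub : ball (e P) r ⊆ e.target := fun y hy => (hrs hy).1
  have hpunct : e.symm '' ball (e P) r \ {P} = e.symm '' (ball (e P) r \ {e P}) := by
    ext x
    constructor
    · rintro ⟨⟨y, hy, rfl⟩, hx⟩
      refine ⟨y, ⟨hy, fun h => hx ?_⟩, rfl⟩
      rw [mem_singleton_iff] at h ⊢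
      rw [h, e.left_inv hP]
    · rintro ⟨y, ⟨hy, hy2⟩, rfl⟩
      refine ⟨⟨y, hy, rfl⟩, fun h => hy2 ?_⟩
      rw [mem_singleton_iff] at h ⊢
      rw [← h, e.right_inv (hsub hy)]
  refine ⟨e.symm '' ball (e P) r, ?_, ⟨e P, mem_ball_self hr, e.left_inv hP⟩, ?_, ?_, ?_⟩
  · exact e.symm.isOpen_image_of_subset_source isOpen_ball hsub
  · rintro _ ⟨y, hy, rfl⟩; exact (hrs hy).2
  · rw [hpunct]
    exact (isPreconnected_ball_diff_center one_lt_rank_E2 _ _).image _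
      (e.continuousOn_symm.mono fun y hy => hsub hy.1)
  · rw [hpunct]
    refine Nonempty.image _ ⟨e P + (r / 2) • coordVec 0, ?_, ?_⟩
    · rw [mem_ball, dist_eq_norm, add_sub_cancel_left, norm_smul]
      simp [coordVec, abs_of_pos hr, hr]
    · intro h
      have h2 : (r / 2) • coordVec 0 = 0 := by simpa using h
      have h3 := congrArg (fun z : E2 => z 0) h2
      simp [coordVec] at h3
      exact hr.ne' h3

variable {M : Type*} [TopologicalSpace M] {N : Type*} [TopologicalSpace N] [T2Space N]
  {ι : M → N} {P : N} {v : L3} {X : M → Quo v} {F : Set M} {a b n : L3}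

theorem IsEndCompactification.exists_nhds_diff_subset (hι : IsEndCompactification ι) (P : N) :
    ∃ W ∈ 𝓝 P, W \ {P} ⊆ range ι := by
  refine ⟨((range ι)ᶜ \ {P})ᶜ, hι.finite_ends.sdiff.isClosed.isOpen_compl.mem_nhds (by simp), ?_⟩
  rintro x ⟨h1, h2⟩
  by_contra h3
  exact h1 ⟨h3, h2⟩

namespace EntireData

variable [ChartedSpace E2 M] [ChartedSpace E2 N]

omit [ChartedSpace E2 N] in
/-- The axial coordinate is proper, hence unbounded at an end. -/
theorem tendsto_abs [T2Space M] (D : EntireData v X F a b n) (hι : IsEndCompactification ι)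
    (hP : P ∉ range ι) :
    Tendsto (fun p => |quoCoord v b D.orth (X p)|) (comap ι (𝓝 P)) atTop := by
  rw [Filter.tendsto_atTop]
  intro R
  have h1 : IsClosed (ι '' {p | |quoCoord v b D.orth (X p)| ≤ R}) :=
    ((D.isCompact_setOf_abs_le R).image hι.isOpenEmbedding.continuous).isClosed
  have h2 : P ∉ ι '' {p | |quoCoord v b D.orth (X p)| ≤ R} := by
    rintro ⟨p, -, rfl⟩; exact hP (mem_range_self p)
  refine ⟨_, h1.isOpen_compl.mem_nhds h2, fun p hp => ?_⟩
  by_contra h3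
  exact hp ⟨p, show |quoCoord v b D.orth (X p)| ≤ R from (not_le.mp h3).le, rfl⟩

/-- The axial coordinate tends to `+∞` or to `-∞` at an end. -/
theorem tendsto_atTop_or [T2Space M] (D : EntireData v X F a b n)
    (hι : IsEndCompactification ι) (hP : P ∉ range ι) :
    Tendsto (fun p => quoCoord v b D.orth (X p)) (comap ι (𝓝 P)) atTop ∨
    Tendsto (fun p => -quoCoord v b D.orth (X p)) (comap ι (𝓝 P)) atTop := by
  have habs := D.tendsto_abs hι hP
  obtain ⟨W₁, hW₁, hW₁s⟩ := hι.exists_nhds_diff_subset P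
  obtain ⟨W₂, hW₂, hW₂s⟩ := habs (Ioi_mem_atTop (0 : ℝ))
  obtain ⟨U, hU, hPU, hUW, hUc, -⟩ := exists_preconnected_punctured_nhds P (inter_mem hW₁ hW₂)
  have hK : IsPreconnected (ι ⁻¹' (U \ {P})) :=
    hUc.preimage_of_isOpenMap hι.isOpenEmbedding.injective hι.isOpenEmbedding.isOpenMap
      fun x hx => hW₁s ⟨(hUW hx.1).1, hx.2⟩
  have hcont : Continuous fun p => quoCoord v b D.orth (X p) :=
    (continuous_quoCoord D.orth).comp D.continuous
  have hne : ∀ p ∈ ι ⁻¹' (U \ {P}), 0 < |quoCoord v b D.orth (X p)| := fun p hp =>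
    hW₂s (hUW hp.1).2
  have hUe : ∀ᶠ p in comap ι (𝓝 P), p ∈ ι ⁻¹' (U \ {P}) := by
    refine ⟨U, hU.mem_nhds hPU, fun p hp => ⟨hp, fun h => hP ?_⟩⟩
    rw [← mem_singleton_iff.mp h]; exact mem_range_self p
  have hsplit := isPreconnected_iff_subset_of_disjoint.mp hK
    {p | 0 < quoCoord v b D.orth (X p)} {p | quoCoord v b D.orth (X p) < 0}
    (isOpen_lt continuous_const hcont) (isOpen_lt hcont continuous_const)
    (fun p hp => by
      rcases abs_pos.mp (hne p hp) |>.lt_or_gt with h | h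
      · exact Or.inr h
      · exact Or.inl h)
    (by ext p; simp; intros; linarith)
  rcases hsplit with h | h
  · exact Or.inl (habs.congr' (hUe.mono fun p hp => abs_of_pos (h hp)))
  · exact Or.inr (habs.congr' (hUe.mono fun p hp => abs_of_neg (h hp)))

/-- An end is covered by a sheet: the sheet tends to the end at infinity, and covers punctured
neighbourhoods of it. -/
theorem exists_sheet_at_end [T2Space M] [CompactSpace N] (D : EntireData v X F a b n)
    (hι : IsEndCompactification ι)
    (htop : Tendsto (fun p => quoCoord v b D.orth (X p)) (comap ι (𝓝 P)) atTop) :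
    ∃ y₀ w σ, (∀ q ∈ liftSing v X F, (MaxSurf.liftProj a b v X q).im ≤ y₀) ∧
      IsSheet v X a b y₀ w σ ∧
      Tendsto (fun c => ι (σ c).1.1) (comap Complex.im atTop) (𝓝 P) ∧
      ∀ R : ℝ, insert P ((fun c => ι (σ c).1.1) '' {c | R < c.im}) ∈ 𝓝 P := by
  obtain ⟨y₀, hy⟩ := D.exists_singular_bound
  obtain ⟨W₁, hW₁, hW₁s⟩ := hι.exists_nhds_diff_subset P
  obtain ⟨W₂, hW₂, hW₂s⟩ := htop (Ioi_mem_atTop y₀)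
  obtain ⟨U, hU, hPU, hUW, hUc, hUn⟩ := exists_preconnected_punctured_nhds P (inter_mem hW₁ hW₂)
  have hUr : U \ {P} ⊆ range ι := fun x hx => hW₁s ⟨(hUW hx.1).1, hx.2⟩
  have hK : IsPreconnected (ι ⁻¹' (U \ {P})) :=
    hUc.preimage_of_isOpenMap hι.isOpenEmbedding.injective hι.isOpenEmbedding.isOpenMap hUr
  have hKy : ∀ p ∈ ι ⁻¹' (U \ {P}), y₀ < quoCoord v b D.orth (X p) := fun p hp =>
    hW₂s (hUW hp.1).2
  obtain ⟨x₁, hx₁⟩ := hUn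
  obtain ⟨p₁, rfl⟩ := hUr hx₁
  obtain ⟨q₁, rfl⟩ := exists_lifting (X := X) p₁
  have hq₁ : y₀ < (MaxSurf.liftProj a b v X q₁).im := by
    rw [liftProj_im D.orth]; exact hKy _ hx₁
  obtain ⟨σ, w, hσ, hσq⟩ := D.exists_sheet hy hq₁
  have hcov := D.sheet_covers hy hσ hK hKy hq₁ (by rw [hσq]; exact hx₁)
  have hnh : ∀ R : ℝ, insert P ((fun c => ι (σ c).1.1) '' {c | R < c.im}) ∈ 𝓝 P := by
    intro R
    obtain ⟨W₃, hW₃, hW₃s⟩ := htop (Ioi_mem_atTop R)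
    filter_upwards [hU.mem_nhds hPU, hW₃] with x hx hx3
    by_cases hxP : x = P
    · exact Or.inl hxP
    obtain ⟨p, rfl⟩ := hUr ⟨hx, hxP⟩
    obtain ⟨c, hc, rfl⟩ := hcov (show p ∈ ι ⁻¹' (U \ {P}) from ⟨hx, hxP⟩)
    refine Or.inr ⟨c, ?_, rfl⟩
    have h1 : R < quoCoord v b D.orth (X (σ c).1.1) := hW₃s hx3
    rwa [← liftProj_im (a := a), hσ.proj c hc] at h1
  refine ⟨y₀, w, σ, hy, hσ, ?_, hnh⟩
  intro W hW
  -- Separate `P` from the other ends; the complement of the two neighbourhoods is compact in `M`,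
  -- so that the sheet eventually avoids it.
  obtain ⟨V₁, V₂, hV₁, hV₂, h1, h2, hdis⟩ := SeparatedNhds.of_isCompact_isCompact
    (isCompact_singleton (x := P)) (hι.finite_ends.sdiff (t := {P})).isCompact
    disjoint_sdiff_self_right
  have hV₁P : P ∈ V₁ := h1 rfl
  have hdis' : Disjoint (V₁ ∩ interior W) V₂ := hdis.mono_left inter_subset_left
  have hVP : P ∈ V₁ ∩ interior W := ⟨hV₁P, mem_interior_iff_mem_nhds.mpr hW⟩
  have hK₀ : IsCompact (((V₁ ∩ interior W) ∪ V₂)ᶜ) :=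
    ((hV₁.inter isOpen_interior).union hV₂).isClosed_compl.isCompact
  have hK₀r : ((V₁ ∩ interior W) ∪ V₂)ᶜ ⊆ range ι := by
    intro x hx
    by_contra h3
    by_cases hxP : x = P
    · rw [hxP] at hx; exact hx (Or.inl hVP)
    · exact hx (Or.inr (h2 ⟨h3, hxP⟩))
  have hK₁ : IsCompact (ι ⁻¹' ((V₁ ∩ interior W) ∪ V₂)ᶜ) :=
    hι.isOpenEmbedding.isInducing.isCompact_preimage' hK₀ hK₀r
  have hcont : Continuous fun p => quoCoord v b D.orth (X p) :=
    (continuous_quoCoord D.orth).comp D.continuous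
  obtain ⟨R₀, hR₀⟩ := (hK₁.image hcont).bddAbove
  set R₁ := max R₀ y₀ with hR₁
  have hy₁ : ∀ {c : ℂ}, R₁ < c.im → y₀ < c.im := fun h => (le_max_right _ _).trans_lt h
  have hσc : ContinuousOn (fun c => ι (σ c).1.1) {c | R₁ < c.im} :=
    hι.isOpenEmbedding.continuous.comp_continuousOn ((continuous_fst.comp
      continuous_subtype_val).comp_continuousOn (hσ.continuousOn.mono fun c hc => hy₁ hc))
  have hin : (fun c => ι (σ c).1.1) '' {c | R₁ < c.im} ⊆ (V₁ ∩ interior W) ∪ V₂ := by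
    rintro _ ⟨c, hc, rfl⟩
    by_contra h3
    have h4 : quoCoord v b D.orth (X (σ c).1.1) ≤ R₀ :=
      hR₀ (mem_image_of_mem _ (show (σ c).1.1 ∈ ι ⁻¹' _ from h3))
    rw [← liftProj_im (a := a), hσ.proj c (hy₁ hc)] at h4
    exact (le_max_left R₀ y₀ |>.trans_lt hc).not_ge h4
  have hsub := isPreconnected_iff_subset_of_disjoint.mp
    ((isPreconnected_halfPlane R₁).image _ hσc) _ _ (hV₁.inter isOpen_interior) hV₂ hin
    (by rw [hdis'.inter_eq, inter_empty])
  have hsub1 : (fun c => ι (σ c).1.1) '' {c | R₁ < c.im} ⊆ V₁ ∩ interior W := by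
    rcases hsub with h | h
    · exact h
    · exfalso
      obtain ⟨U', -, -, hU's, -, x, hx, hxP⟩ := exists_preconnected_punctured_nhds P
        (inter_mem (hnh R₁) ((hV₁.inter isOpen_interior).mem_nhds hVP))
      obtain ⟨h3, h4⟩ := hU's hx
      exact hdis'.ne_of_mem h4 (h (h3.resolve_left hxP)) rfl
  rw [Filter.mem_map, mem_comap]
  refine ⟨Ioi R₁, Ioi_mem_atTop R₁, fun c hc => ?_⟩
  show ι (σ c).1.1 ∈ W
  exact interior_subset (hsub1 ⟨c, hc, rfl⟩).2

end EntireData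

end EndTopology

/-! ### Isothermal coordinates of a maximal graph -/

section Lewy

open Complex Set

/-- The area density `√(1 - |∇φ|²)` of the graph of `φ`. -/
def areaDensity (φ : ℂ → ℝ) (c : ℂ) : ℝ :=
  √(1 - fderiv ℝ φ c 1 ^ 2 - fderiv ℝ φ c I ^ 2)

/-- The pairing of a covector `e` of the plane with the gradient of `φ`. -/
def pairGrad (φ : ℂ → ℝ) (e : ℂ →L[ℝ] ℝ) (c : ℂ) : ℝ :=
  e 1 * fderiv ℝ φ c 1 + e I * fderiv ℝ φ c I

/-- The 1-form `(e - e(∇φ) dφ) / √(1 - |∇φ|²)`, which is closed when `φ` solves the maximal surface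
equation: it is the flux of a horizontal translation. -/
def fluxForm (φ : ℂ → ℝ) (e : ℂ →L[ℝ] ℝ) (c : ℂ) : ℂ →L[ℝ] ℝ :=
  (areaDensity φ c)⁻¹ • (e - pairGrad φ e c • fderiv ℝ φ c)

theorem IsMaximalGraphAt.areaDensity_pos {φ : ℂ → ℝ} {c : ℂ} (h : IsMaximalGraphAt φ c) :
    0 < areaDensity φ c :=
  Real.sqrt_pos.mpr (by have := grad_sq_lt_one h.short; linarith)

theorem IsMaximalGraphAt.areaDensity_sq {φ : ℂ → ℝ} {c : ℂ} (h : IsMaximalGraphAt φ c) :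
    areaDensity φ c ^ 2 = 1 - fderiv ℝ φ c 1 ^ 2 - fderiv ℝ φ c I ^ 2 :=
  Real.sq_sqrt (by have := grad_sq_lt_one h.short; linarith)

theorem IsMaximalGraphAt.contDiffAt_fderiv {φ : ℂ → ℝ} {c : ℂ} (h : IsMaximalGraphAt φ c) :
    ContDiffAt ℝ ∞ (fderiv ℝ φ) c :=
  h.contDiffAt.fderiv_right (by simp)

theorem IsMaximalGraphAt.contDiffAt_areaDensity {φ : ℂ → ℝ} {c : ℂ} (h : IsMaximalGraphAt φ c) :
    ContDiffAt ℝ ∞ (areaDensity φ) c := by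
  have h1 := h.contDiffAt_fderiv
  have h2 : ∀ u, ContDiffAt ℝ ∞ (fun c => fderiv ℝ φ c u) c := fun u =>
    h1.clm_apply contDiffAt_const
  refine ContDiffAt.sqrt ((contDiffAt_const.sub ((h2 1).pow 2)).sub ((h2 I).pow 2)) ?_
  have := grad_sq_lt_one h.short
  linarith

theorem IsMaximalGraphAt.contDiffAt_fluxForm {φ : ℂ → ℝ} {c : ℂ} (h : IsMaximalGraphAt φ c)
    (e : ℂ →L[ℝ] ℝ) : ContDiffAt ℝ ∞ (fluxForm φ e) c := by
  have h1 := h.contDiffAt_fderiv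
  have h2 : ∀ u, ContDiffAt ℝ ∞ (fun c => fderiv ℝ φ c u) c := fun u =>
    h1.clm_apply contDiffAt_const
  exact (h.contDiffAt_areaDensity.inv h.areaDensity_pos.ne').smul (contDiffAt_const.sub
    (((contDiffAt_const.mul (h2 1)).add (contDiffAt_const.mul (h2 I))).smul h1))

theorem IsMaximalGraphAt.hasFDerivAt_fderiv_apply {φ : ℂ → ℝ} {c : ℂ} (h : IsMaximalGraphAt φ c)
    (u : ℂ) : HasFDerivAt (fun c => fderiv ℝ φ c u) ((fderiv ℝ (fderiv ℝ φ) c).flip u) c := by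
  have h1 := (h.contDiffAt_fderiv.differentiableAt (by simp)).hasFDerivAt
  exact (ContinuousLinearMap.apply ℝ ℝ u).hasFDerivAt.comp c h1

theorem IsMaximalGraphAt.symm_fderiv_fderiv {φ : ℂ → ℝ} {c : ℂ} (h : IsMaximalGraphAt φ c)
    (u w : ℂ) : fderiv ℝ (fderiv ℝ φ) c u w = fderiv ℝ (fderiv ℝ φ) c w u :=
  (h.contDiffAt.isSymmSndFDerivAt (by simpa using two_le_infty)) u w

/-- The derivative of the area density, from `W² = 1 - |∇φ|²`. -/
theorem IsMaximalGraphAt.areaDensity_mul_fderiv {φ : ℂ → ℝ} {c : ℂ} (h : IsMaximalGraphAt φ c)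
    (u : ℂ) : areaDensity φ c * fderiv ℝ (areaDensity φ) c u =
      -(fderiv ℝ φ c 1 * fderiv ℝ (fderiv ℝ φ) c u 1
        + fderiv ℝ φ c I * fderiv ℝ (fderiv ℝ φ) c u I) := by
  have hW := h.areaDensity_pos
  have h0 : (1 - fderiv ℝ φ c 1 ^ 2 - fderiv ℝ φ c I ^ 2) ≠ 0 := by
    rw [← h.areaDensity_sq]; positivity
  have dW : HasFDerivAt (areaDensity φ) _ c :=
    (((((h.hasFDerivAt_fderiv_apply 1).pow 2).const_sub 1).sub
      ((h.hasFDerivAt_fderiv_apply I).pow 2)).sqrt h0)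
  have hW' : √(1 - fderiv ℝ φ c 1 ^ 2 - fderiv ℝ φ c I ^ 2) = areaDensity φ c := rfl
  rw [dW.fderiv]
  simp [hW']
  field_simp
  ring

/-- A bilinear form on the plane is symmetric if it is so on the basis `1, i`. -/
theorem bilin_symm_of_one_I {B : ℂ →L[ℝ] ℂ →L[ℝ] ℝ} (h : B 1 I = B I 1) (u w : ℂ) :
    B u w = B w u := by
  have h1 : ∀ u w, B u w = u.re * (w.re * B 1 1 + w.im * B 1 I)
      + u.im * (w.re * B I 1 + w.im * B I I) := by
    intro u w
    have := clm_apply_complex (B.flip w) u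
    simp only [ContinuousLinearMap.flip_apply] at this
    rw [this, clm_apply_complex (B 1) w, clm_apply_complex (B I) w]
  rw [h1 u w, h1 w u, h]
  ring

/-- The flux form is closed. Differentiating `W • fluxForm = e - e(∇φ) dφ`, with `W` the area density,
reduces this to the maximal surface equation. -/
theorem IsMaximalGraphAt.fderiv_fluxForm_symm {φ : ℂ → ℝ} {c : ℂ} (h : IsMaximalGraphAt φ c)
    (he : ∀ᶠ c' in 𝓝 c, IsMaximalGraphAt φ c') (e : ℂ →L[ℝ] ℝ) (u w : ℂ) :
    fderiv ℝ (fluxForm φ e) c u w = fderiv ℝ (fluxForm φ e) c w u := by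
  refine bilin_symm_of_one_I ?_ u w
  have hW := h.areaDensity_pos
  have hW2 := h.areaDensity_sq
  have hD := h.areaDensity_mul_fderiv
  have hd := (h.contDiffAt_fderiv.differentiableAt (by simp)).hasFDerivAt
  have d1 : HasFDerivAt (fun c => areaDensity φ c • fluxForm φ e c) _ c :=
    ((h.contDiffAt_areaDensity.differentiableAt (by simp)).hasFDerivAt).smul
      ((h.contDiffAt_fluxForm e).differentiableAt (by simp)).hasFDerivAt
  have d2 : HasFDerivAt (fun c => e - pairGrad φ e c • fderiv ℝ φ c) _ c :=
    ((((h.hasFDerivAt_fderiv_apply 1).const_mul (e 1)).add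
      ((h.hasFDerivAt_fderiv_apply I).const_mul (e I))).smul hd).const_sub e
  have heq : (fun c => areaDensity φ c • fluxForm φ e c)
      =ᶠ[𝓝 c] fun c => e - pairGrad φ e c • fderiv ℝ φ c := by
    filter_upwards [he] with c' hc'
    rw [fluxForm, smul_inv_smul₀ hc'.areaDensity_pos.ne']
  have h3 := (d1.congr_of_eventuallyEq heq.symm).unique d2
  have h4 := fun u w => congrArg (fun B : ℂ →L[ℝ] ℂ →L[ℝ] ℝ => B u w) h3
  have h5 := h4 1 I
  have h6 := h4 I 1
  simp [fluxForm, pairGrad] at h5 h6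
  have hs := h.symm_fderiv_fderiv I 1
  have hE := h.eq
  have hD1 := hD 1
  have hDI := hD I
  rw [hs] at h6 hDI
  have hS := mul_inv_cancel₀ hW.ne'
  refine mul_left_cancel₀ (pow_ne_zero 3 hW.ne') ?_
  generalize areaDensity φ c = W at *
  generalize W⁻¹ = S at *
  generalize (fderiv ℝ (areaDensity φ) c) 1 = W1 at *
  generalize (fderiv ℝ (areaDensity φ) c) I = W2 at *
  generalize fderiv ℝ φ c 1 = p at *
  generalize fderiv ℝ φ c I = q at *
  generalize fderiv ℝ (fderiv ℝ φ) c 1 1 = p1 at *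
  generalize fderiv ℝ (fderiv ℝ φ) c 1 I = p2 at *
  generalize fderiv ℝ (fderiv ℝ φ) c I I = q2 at *
  generalize e 1 = e1 at *
  generalize e I = e2 at *
  linear_combination W ^ 2 * h5 - W ^ 2 * h6
    - (W * W1 * (e2 - (e1 * p + e2 * q) * q) - W * W2 * (e1 - (e1 * p + e2 * q) * p)) * hS
    - (e2 - (e1 * p + e2 * q) * q) * hD1 + (e1 - (e1 * p + e2 * q) * p) * hDI
    + (-(e1 * p1 + e2 * p2) * q + (e1 * p2 + e2 * q2) * p) * hW2 + (e2 * p - e1 * q) * hE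

/-- The differential `w ↦ w + (w - dφ(w) ∇φ) / √(1 - |∇φ|²)` of Lewy's map. -/
def lewyDeriv (φ : ℂ → ℝ) (c : ℂ) : ℂ →L[ℝ] ℂ :=
  ContinuousLinearMap.id ℝ ℂ + ofRealCLM.comp (fluxForm φ reCLM c)
    + (I • ofRealCLM).comp (fluxForm φ imCLM c)

theorem lewyDeriv_re (φ : ℂ → ℝ) (c w : ℂ) : (lewyDeriv φ c w).re =
    w.re + (areaDensity φ c)⁻¹ * (w.re - fderiv ℝ φ c 1 * fderiv ℝ φ c w) := by
  simp [lewyDeriv, fluxForm, pairGrad]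

theorem lewyDeriv_im (φ : ℂ → ℝ) (c w : ℂ) : (lewyDeriv φ c w).im =
    w.im + (areaDensity φ c)⁻¹ * (w.im - fderiv ℝ φ c I * fderiv ℝ φ c w) := by
  simp [lewyDeriv, fluxForm, pairGrad]

/-- Lewy's map is conformal for the metric that the graph inherits from Minkowski space. -/
theorem IsMaximalGraphAt.lewyDeriv_conformal {φ : ℂ → ℝ} {c : ℂ} (h : IsMaximalGraphAt φ c)
    (u w : ℂ) :
    (lewyDeriv φ c u).re * (lewyDeriv φ c w).re + (lewyDeriv φ c u).im * (lewyDeriv φ c w).im =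
      (1 + (areaDensity φ c)⁻¹) ^ 2
        * (u.re * w.re + u.im * w.im - fderiv ℝ φ c u * fderiv ℝ φ c w) := by
  have hS := mul_inv_cancel₀ h.areaDensity_pos.ne'
  have hW2 := h.areaDensity_sq
  simp only [lewyDeriv_re, lewyDeriv_im]
  rw [clm_apply_complex _ u, clm_apply_complex _ w]
  have hSS : (areaDensity φ c)⁻¹ ^ 2 * (1 - fderiv ℝ φ c 1 ^ 2 - fderiv ℝ φ c I ^ 2) = 1 := by
    rw [← hW2, ← mul_pow, mul_comm, hS, one_pow]
  linear_combination (-(u.re * fderiv ℝ φ c 1 + u.im * fderiv ℝ φ c I)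
    * (w.re * fderiv ℝ φ c 1 + w.im * fderiv ℝ φ c I)) * hSS

/-- Lewy's map is expanding. -/
theorem IsMaximalGraphAt.le_lewyDeriv {φ : ℂ → ℝ} {c : ℂ} (h : IsMaximalGraphAt φ c) (w : ℂ) :
    ‖w‖ ^ 2 ≤ w.re * (lewyDeriv φ c w).re + w.im * (lewyDeriv φ c w).im := by
  have hS := inv_pos.mpr h.areaDensity_pos
  have h1 : fderiv ℝ φ c w ^ 2 ≤ ‖w‖ ^ 2 := by
    by_cases hw : w = 0
    · simp [hw]
    · exact sq_le_sq' (abs_lt.mp (h.short w hw)).1.le (abs_lt.mp (h.short w hw)).2.le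
  rw [lewyDeriv_re, lewyDeriv_im]
  rw [Complex.sq_norm, normSq_apply] at *
  have h2 := mul_nonneg hS.le (sub_nonneg.mpr h1)
  have h3 := clm_apply_complex (fderiv ℝ φ c) w
  have h4 : w.re * (fderiv ℝ φ c 1 * fderiv ℝ φ c w) + w.im * (fderiv ℝ φ c I * fderiv ℝ φ c w) =
      fderiv ℝ φ c w ^ 2 := by
    linear_combination (-fderiv ℝ φ c w) * h3
  linear_combination h2 + (areaDensity φ c)⁻¹ * h4

/-- Lewy's map is a primitive of the closed forms `lewyDeriv` on the half plane. -/
theorem exists_lewyMap {φ : ℂ → ℝ} {y₀ : ℝ} (h : ∀ c : ℂ, y₀ < c.im → IsMaximalGraphAt φ c) :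
    ∃ ζ : ℂ → ℂ, ∀ c : ℂ, y₀ < c.im → ContDiffAt ℝ ∞ ζ c ∧ HasFDerivAt ζ (lewyDeriv φ c) c := by
  have hU := isOpen_halfPlane y₀
  have hprim : ∀ e : ℂ →L[ℝ] ℝ, ∃ A : ℂ → ℝ, ∀ c ∈ {c : ℂ | y₀ < c.im},
      HasFDerivAt A (fluxForm φ e c) c := fun e =>
    (convex_halfSpace_im_gt y₀).exists_forall_hasFDerivAt_of_fderiv_symmetric hU
      (fun c hc => (((h c hc).contDiffAt_fluxForm e).differentiableAt
        (by simp)).differentiableWithinAt)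
      fun c hc u w => (h c hc).fderiv_fluxForm_symm
        ((hU.eventually_mem hc).mono fun c' hc' => h c' hc') e u w
  have hsm : ∀ (e : ℂ →L[ℝ] ℝ) (A : ℂ → ℝ), (∀ c ∈ {c : ℂ | y₀ < c.im},
      HasFDerivAt A (fluxForm φ e c) c) → ∀ c ∈ {c : ℂ | y₀ < c.im}, ContDiffAt ℝ ∞ A c := by
    intro e A hA c hc
    refine ((contDiffOn_infty_iff_fderiv_of_isOpen hU).mpr
      ⟨fun c hc => (hA c hc).differentiableAt.differentiableWithinAt, fun c hc => ?_⟩).contDiffAt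
      (hU.mem_nhds hc)
    refine (((h c hc).contDiffAt_fluxForm e).congr_of_eventuallyEq ?_).contDiffWithinAt
    filter_upwards [hU.mem_nhds hc] with c' hc' using (hA c' hc').fderiv
  obtain ⟨A, hA⟩ := hprim reCLM
  obtain ⟨B, hB⟩ := hprim imCLM
  refine ⟨fun c => c + ofRealCLM (A c) + (I • ofRealCLM) (B c), fun c hc => ⟨?_, ?_⟩⟩
  · exact (contDiffAt_id.add (ofRealCLM.contDiff.contDiffAt.comp c (hsm _ A hA c hc))).add
      ((I • ofRealCLM).contDiff.contDiffAt.comp c (hsm _ B hB c hc))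
  · exact ((hasFDerivAt_id c).add (ofRealCLM.hasFDerivAt.comp c (hA c hc))).add
      ((I • ofRealCLM).hasFDerivAt.comp c (hB c hc))

/-- `ζ` is Lewy's map, a smooth primitive of `lewyDeriv φ`, on the half plane `im > y₀` on which `φ`
solves the maximal surface equation. -/
structure IsLewyMap (φ : ℂ → ℝ) (y₀ : ℝ) (ζ : ℂ → ℂ) : Prop where
  maximal : ∀ c : ℂ, y₀ < c.im → IsMaximalGraphAt φ c
  contDiffAt : ∀ c : ℂ, y₀ < c.im → ContDiffAt ℝ ∞ ζ c
  hasFDerivAt : ∀ c : ℂ, y₀ < c.im → HasFDerivAt ζ (lewyDeriv φ c) c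

namespace IsLewyMap

variable {φ : ℂ → ℝ} {y₀ : ℝ} {ζ : ℂ → ℂ}

/-- Lewy's map does not decrease distances. -/
theorem expanding (hζ : IsLewyMap φ y₀ ζ) {c c' : ℂ} (hc : y₀ < c.im) (hc' : y₀ < c'.im) :
    ‖c' - c‖ ≤ ‖ζ c' - ζ c‖ := by
  obtain ⟨d, hd⟩ : ∃ d, d = c' - c := ⟨_, rfl⟩
  rw [← hd]
  -- The scalar product of `ζ` with the direction `d` has derivative at least `|d|²` along `[c, c']`.
  have hmem : ∀ t ∈ Icc (0 : ℝ) 1, y₀ < (c + t * d).im := by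
    intro t ht
    have h1 := (convex_halfSpace_im_gt y₀) hc hc' (sub_nonneg.mpr ht.2) ht.1 (by ring)
    have h2 : (1 - t) • c + t • c' = c + t * d := by
      rw [hd, real_smul, real_smul]; push_cast; ring
    rwa [h2] at h1
  have hder : ∀ t ∈ Icc (0 : ℝ) 1, HasDerivAt
      (fun t : ℝ => d.re * (ζ (c + t * d)).re + d.im * (ζ (c + t * d)).im)
      (d.re * (lewyDeriv φ (c + t * d) d).re + d.im * (lewyDeriv φ (c + t * d) d).im) t := by
    intro t ht
    have h1 : HasDerivAt (fun t : ℝ => c + t * d) d t := by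
      simpa using ((hasDerivAt_id t).ofReal_comp.mul_const d).const_add c
    have h2 := (hζ.hasFDerivAt _ (hmem t ht)).comp_hasDerivAt t h1
    exact ((reCLM.hasFDerivAt.comp_hasDerivAt t h2).const_mul d.re).add
      ((imCLM.hasFDerivAt.comp_hasDerivAt t h2).const_mul d.im)
  have h1 := (convex_Icc (0 : ℝ) 1).mul_sub_le_image_sub_of_le_deriv
    (fun t ht => (hder t ht).continuousAt.continuousWithinAt)
    (fun t ht => (hder t (interior_subset ht)).differentiableAt.differentiableWithinAt)
    (C := ‖d‖ ^ 2) (fun t ht => by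
      rw [(hder t (interior_subset ht)).deriv]
      exact (hζ.maximal _ (hmem t (interior_subset ht))).le_lewyDeriv d)
    0 (by simp) 1 (by simp) zero_le_one
  have h2 : c + ((1 : ℝ) : ℂ) * d = c' := by rw [hd]; push_cast; ring
  have h3 : c + ((0 : ℝ) : ℂ) * d = c := by simp
  simp only [h2, h3] at h1
  have h4 : d.re * (ζ c' - ζ c).re + d.im * (ζ c' - ζ c).im ≤ ‖d‖ * ‖ζ c' - ζ c‖ := by
    have := real_inner_le_norm d (ζ c' - ζ c)
    rw [Complex.inner] at this
    simpa [mul_comm] using this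
  rw [sub_re, sub_im] at h4
  by_cases h0 : ‖d‖ = 0
  · rw [h0]; exact norm_nonneg _
  · have h5 : 0 < ‖d‖ := lt_of_le_of_ne (norm_nonneg _) (Ne.symm h0)
    refine le_of_mul_le_mul_left ?_ h5
    linear_combination h1 + h4

/-- Lewy's map has a period, because `lewyDeriv φ` only depends on the periodic differential of `φ`. It
is nonzero, because Lewy's map is expanding. -/
theorem exists_period (hζ : IsLewyMap φ y₀ ζ) {L h : ℝ}
    (hper : ∀ c : ℂ, y₀ < c.im → φ (c + L) = φ c + h) :
    ∃ Λ : ℂ, |L| ≤ ‖Λ‖ ∧ ∀ c : ℂ, y₀ < c.im → ζ (c + L) = ζ c + Λ := by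
  have him : ∀ {c : ℂ}, y₀ < c.im → y₀ < (c + L).im := fun h => by simpa using h
  have hd : ∀ c : ℂ, y₀ < c.im → lewyDeriv φ (c + L) = lewyDeriv φ c := by
    intro c hc
    have h1 : fderiv ℝ φ (c + L) = fderiv ℝ φ c := by
      have h2 : (fun c : ℂ => φ (c + L)) =ᶠ[𝓝 c] fun c => φ c + h := by
        filter_upwards [(isOpen_halfPlane y₀).mem_nhds hc] with c' hc' using hper c' hc'
      have h3 := h2.fderiv_eq (𝕜 := ℝ)
      rwa [fderiv_comp_add_right, fderiv_add_const] at h3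
    simp only [lewyDeriv, fluxForm, pairGrad, areaDensity, h1]
  have hder : ∀ c ∈ {c : ℂ | y₀ < c.im},
      HasFDerivAt (fun c => ζ (c + L) - ζ c) (0 : ℂ →L[ℝ] ℂ) c := by
    intro c hc
    have h1 : HasFDerivAt (fun c : ℂ => ζ (c + L)) (lewyDeriv φ (c + L)) c := by
      have h2 := (hζ.hasFDerivAt _ (him hc)).comp c ((hasFDerivAt_id c).add_const (L : ℂ))
      rw [ContinuousLinearMap.comp_id] at h2
      exact h2
    rw [hd c hc] at h1
    have h2 := h1.sub (hζ.hasFDerivAt c hc)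
    rw [sub_self] at h2
    exact h2
  have hc₀ : ((y₀ + 1 : ℝ) * I) ∈ {c : ℂ | y₀ < c.im} := by simp
  refine ⟨ζ ((y₀ + 1 : ℝ) * I + L) - ζ ((y₀ + 1 : ℝ) * I), ?_, fun c hc => ?_⟩
  · have := hζ.expanding hc₀ (him hc₀)
    simpa using this
  · have := (convex_halfSpace_im_gt y₀).is_const_of_fderivWithin_eq_zero (𝕜 := ℝ)
      (fun c hc => (hder c hc).differentiableAt.differentiableWithinAt)
      (fun c hc => by
        rw [fderivWithin_of_isOpen (isOpen_halfPlane y₀) hc, (hder c hc).fderiv]) hc hc₀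
    rw [← this]; ring

end IsLewyMap

theorem apply_add_int_mul {f : ℂ → ℂ} {y₀ L : ℝ} {Λ : ℂ}
    (h : ∀ c : ℂ, y₀ < c.im → f (c + L) = f c + Λ) (k : ℤ) :
    ∀ c : ℂ, y₀ < c.im → f (c + ((k * L : ℝ) : ℂ)) = f c + k * Λ := by
  induction k using Int.induction_on with
  | zero => intro c _; simp
  | succ j ih =>
    intro c hc
    have h1 := h (c + (((j : ℤ) * L : ℝ) : ℂ)) (by simpa using hc)
    rw [ih c hc] at h1
    have h2 : c + ((((j : ℤ) + 1 : ℤ) * L : ℝ) : ℂ) = c + (((j : ℤ) * L : ℝ) : ℂ) + L := by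
      push_cast; ring
    rw [h2, h1]; push_cast; ring
  | pred j ih =>
    intro c hc
    have h1 := h (c + (((-(j : ℤ) - 1 : ℤ) * L : ℝ) : ℂ)) (by simpa using hc)
    have h2 : c + (((-(j : ℤ) - 1 : ℤ) * L : ℝ) : ℂ) + L = c + (((-(j : ℤ) : ℤ) * L : ℝ) : ℂ) := by
      push_cast; ring
    rw [h2, ih c hc] at h1
    rw [eq_sub_of_add_eq h1.symm]; push_cast; ring

theorem exists_int_eq_of_abs_eq_one {ε : ℝ} (hε : |ε| = 1) : ∃ k : ℤ, (k : ℝ) = ε := by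
  rcases (abs_eq zero_le_one).mp hε with h | h
  · exact ⟨1, by simp [h]⟩
  · exact ⟨-1, by simp [h]⟩

namespace IsLewyMap

variable {φ : ℂ → ℝ} {y₀ : ℝ} {ζ : ℂ → ℂ}

/-- As Lewy's map is expanding and periodic, its coordinate orthogonal to the period is large high
up in the half-plane. -/
theorem exists_le_abs_im (hζ : IsLewyMap φ y₀ ζ) {L : ℝ} {Λ κ : ℂ} {ε : ℝ}
    (hΛ : ∀ c : ℂ, y₀ < c.im → ζ (c + L) = ζ c + Λ) (hε : |ε| = 1) (hκ : κ * Λ = ε) (C : ℝ) :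
    ∃ R, y₀ < R ∧ ∀ c : ℂ, R ≤ c.im → C ≤ |(κ * ζ c).im| := by
  have hκ0 : 0 < ‖κ‖ := by
    refine norm_pos_iff.mpr fun h0 => ?_
    rw [h0, zero_mul] at hκ
    have : ε = 0 := by exact_mod_cast hκ.symm
    rw [this, abs_zero] at hε
    exact zero_ne_one hε
  set c₀ : ℂ := (y₀ + 1 : ℝ) * I with hc₀d
  have hc₀ : y₀ < c₀.im := by simp [hc₀d]
  refine ⟨max (y₀ + 1) (c₀.im + (C + 2 + ‖κ * ζ c₀‖) / ‖κ‖), by simp, fun c hc => ?_⟩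
  by_contra! hlt
  have hcy : y₀ < c.im := by have := (le_max_left _ _).trans hc; linarith
  have hcR := (le_max_right _ _).trans hc
  -- Translate `c` by a multiple of the period, so that the other coordinate is bounded.
  set k : ℤ := ⌊ε * (κ * ζ c).re⌋ with hk
  have h1 := apply_add_int_mul hΛ (-k) c hcy
  set c' : ℂ := c + (((-k : ℤ) * L : ℝ) : ℂ) with hc'
  have hc'i : c'.im = c.im := by simp [hc']
  have h2 : κ * ζ c' = κ * ζ c - ((k * ε : ℝ) : ℂ) := by
    rw [h1, mul_add, mul_left_comm, hκ]; push_cast; ring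
  have hεε : ε * ε = 1 := by rw [← abs_mul_abs_self, hε, one_mul]
  have h3 : |(κ * ζ c').re| ≤ 1 := by
    have h4 : (κ * ζ c').re = ε * Int.fract (ε * (κ * ζ c).re) := by
      rw [h2, sub_re, ofReal_re, Int.fract, ← hk]
      linear_combination (-(κ * ζ c).re) * hεε
    rw [h4, abs_mul, hε, one_mul, Int.abs_fract]
    exact (Int.fract_lt_one _).le
  have h4 : (κ * ζ c').im = (κ * ζ c).im := by rw [h2, sub_im, ofReal_im, sub_zero]
  have h5 : ‖κ * ζ c'‖ ≤ 1 + C := by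
    refine (norm_le_abs_re_add_abs_im _).trans ?_
    rw [h4]; linarith
  have h6 : ‖κ‖ * ‖c' - c₀‖ ≤ ‖κ * ζ c' - κ * ζ c₀‖ := by
    rw [← mul_sub, norm_mul]
    exact mul_le_mul_of_nonneg_left (hζ.expanding hc₀ (hc'i ▸ hcy)) hκ0.le
  have h7 : c.im - c₀.im ≤ ‖c' - c₀‖ := by
    have := (le_abs_self _).trans (abs_im_le_norm (c' - c₀))
    rwa [sub_im, hc'i] at this
  have h8 := norm_sub_le (κ * ζ c') (κ * ζ c₀)
  have h9 : (C + 2 + ‖κ * ζ c₀‖) / ‖κ‖ ≤ c.im - c₀.im := by linarith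
  rw [div_le_iff₀ hκ0] at h9
  nlinarith [mul_le_mul_of_nonneg_left h7 hκ0.le]

/-- Lewy's map, normalized so that its period is `±1`, tends to `+i∞` at infinity for a choice of
the sign. -/
theorem exists_normalization (hζ : IsLewyMap φ y₀ ζ) {L h : ℝ} (hL : 0 < L)
    (hper : ∀ c : ℂ, y₀ < c.im → φ (c + L) = φ c + h) :
    ∃ (κ : ℂ) (ε : ℝ), |ε| = 1 ∧ κ ≠ 0 ∧
      (∀ c : ℂ, y₀ < c.im → κ * ζ (c + L) = κ * ζ c + ε) ∧
      ∀ C : ℝ, ∃ R, y₀ < R ∧ ∀ c : ℂ, R ≤ c.im → C ≤ (κ * ζ c).im := by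
  obtain ⟨Λ, hΛL, hΛ⟩ := hζ.exists_period hper
  have hΛ0 : Λ ≠ 0 := by
    rw [← norm_pos_iff]; exact (abs_pos.mpr hL.ne').trans_le hΛL
  have hcont : ContinuousOn (fun c => (Λ⁻¹ * ζ c).im) {c : ℂ | y₀ < c.im} := fun c hc =>
    (continuous_im.continuousAt.comp
      (continuousAt_const.mul (hζ.contDiffAt c hc).continuousAt)).continuousWithinAt
  have habs := fun C => hζ.exists_le_abs_im hΛ (ε := 1) (κ := Λ⁻¹) (by simp)
    (by rw [inv_mul_cancel₀ hΛ0, ofReal_one]) C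
  obtain ⟨R₁, hR₁, hR₁'⟩ := habs 1
  have hsub : {c : ℂ | R₁ < c.im} ⊆ {c : ℂ | y₀ < c.im} := fun c hc => hR₁.trans hc
  have hpre := (isPreconnected_halfPlane R₁).image _ (hcont.mono hsub)
  have hsign : (∀ c : ℂ, R₁ < c.im → 0 < (Λ⁻¹ * ζ c).im) ∨
      ∀ c : ℂ, R₁ < c.im → (Λ⁻¹ * ζ c).im < 0 := by
    by_contra! hcon
    obtain ⟨⟨c₁, hc₁, h1⟩, c₂, hc₂, h2⟩ := hcon
    obtain ⟨c, hc, h3⟩ := hpre.Icc_subset ⟨c₁, hc₁, rfl⟩ ⟨c₂, hc₂, rfl⟩ ⟨h1, h2⟩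
    have h4 := hR₁' c (le_of_lt hc)
    simp only at h3
    rw [h3, abs_zero] at h4
    exact absurd h4 (by norm_num)
  rcases hsign with hs | hs
  · refine ⟨Λ⁻¹, 1, by simp, inv_ne_zero hΛ0, fun c hc => ?_, fun C => ?_⟩
    · rw [hΛ c hc, mul_add, inv_mul_cancel₀ hΛ0, ofReal_one]
    · obtain ⟨R, hR, hR'⟩ := habs C
      refine ⟨max R (R₁ + 1), hR.trans_le (le_max_left _ _), fun c hc => ?_⟩
      have h1 := hR' c ((le_max_left _ _).trans hc)
      rwa [abs_of_pos (hs c (by have := (le_max_right R _).trans hc; linarith))] at h1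
  · refine ⟨-Λ⁻¹, -1, by simp, neg_ne_zero.mpr (inv_ne_zero hΛ0), fun c hc => ?_, fun C => ?_⟩
    · rw [hΛ c hc, mul_add, neg_mul _ Λ, inv_mul_cancel₀ hΛ0]; push_cast; ring
    · obtain ⟨R, hR, hR'⟩ := habs C
      refine ⟨max R (R₁ + 1), hR.trans_le (le_max_left _ _), fun c hc => ?_⟩
      have h1 := hR' c ((le_max_left _ _).trans hc)
      rw [abs_of_neg (hs c (by have := (le_max_right R _).trans hc; linarith))] at h1
      rwa [neg_mul, neg_im]

theorem exists_hasStrictFDerivAt (hζ : IsLewyMap φ y₀ ζ) {κ : ℂ} (hκ : κ ≠ 0) {c : ℂ}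
    (hc : y₀ < c.im) : ∃ D : ℂ ≃L[ℝ] ℂ, (∀ w, D w = κ * lewyDeriv φ c w) ∧
      HasStrictFDerivAt (fun c => κ * ζ c) (D : ℂ →L[ℝ] ℂ) c := by
  have hinj : Function.Injective (κ • lewyDeriv φ c : ℂ →L[ℝ] ℂ) := by
    rw [injective_iff_map_eq_zero]
    intro w hw
    have h1 : lewyDeriv φ c w = 0 := by
      have : κ * lewyDeriv φ c w = 0 := hw
      exact (mul_eq_zero.mp this).resolve_left hκ
    have h2 := (hζ.maximal c hc).le_lewyDeriv w
    rw [h1] at h2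
    simpa using h2
  let D : ℂ ≃L[ℝ] ℂ := (LinearMap.linearEquivOfInjective ((κ • lewyDeriv φ c : ℂ →L[ℝ] ℂ) :
    ℂ →ₗ[ℝ] ℂ) hinj rfl).toContinuousLinearEquiv
  have hD : (D : ℂ →L[ℝ] ℂ) = κ • lewyDeriv φ c := by ext w; rfl
  refine ⟨D, fun w => rfl, ?_⟩
  rw [hD]
  exact (contDiffAt_const.mul (hζ.contDiffAt c hc)).hasStrictFDerivAt'
    ((hζ.hasFDerivAt c hc).const_mul κ) (by simp)

theorem isOpen_image (hζ : IsLewyMap φ y₀ ζ) {κ : ℂ} (hκ : κ ≠ 0) {U : Set ℂ} (hU : IsOpen U)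
    (hUy : U ⊆ {c : ℂ | y₀ < c.im}) : IsOpen ((fun c => κ * ζ c) '' U) := by
  rw [isOpen_iff_mem_nhds]
  rintro _ ⟨c, hc, rfl⟩
  obtain ⟨D, -, hD⟩ := hζ.exists_hasStrictFDerivAt hκ (hUy hc)
  rw [← hD.map_nhds_eq_of_equiv]
  exact Filter.image_mem_map (hU.mem_nhds hc)

/-- The normalized Lewy map covers a half plane: the image of `{im > R₁}` is open, and its boundary is
mapped from the line `im = R₁`, since Lewy's map is expanding. -/
theorem exists_halfPlane_subset (hζ : IsLewyMap φ y₀ ζ) {L : ℝ} (hL : 0 < L) {κ : ℂ} {ε : ℝ}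
    (hκ : κ ≠ 0) (hper : ∀ c : ℂ, y₀ < c.im → κ * ζ (c + L) = κ * ζ c + ε)
    (htop : ∀ C : ℝ, ∃ R, y₀ < R ∧ ∀ c : ℂ, R ≤ c.im → C ≤ (κ * ζ c).im) (R : ℝ) :
    ∃ C, ∀ z : ℂ, C < z.im → ∃ c : ℂ, y₀ < c.im ∧ R < c.im ∧ κ * ζ c = z := by
  set f : ℂ → ℂ := fun c => κ * ζ c with hf
  have hfc : ∀ c : ℂ, y₀ < c.im → ContinuousAt f c := fun c hc =>
    continuousAt_const.mul (hζ.contDiffAt c hc).continuousAt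
  set R₁ := max R y₀ + 1 with hR₁d
  have hR₁ : y₀ < R₁ := (le_max_right R y₀).trans_lt (lt_add_one _)
  have hR₁' : R < R₁ := (le_max_left R y₀).trans_lt (lt_add_one _)
  -- By periodicity the imaginary part is bounded on the line `im = R₁`.
  obtain ⟨B, hB⟩ : ∃ B, ∀ c : ℂ, c.im = R₁ → (f c).im ≤ B := by
    have h1 : ContinuousOn (fun t : ℝ => (f (t + R₁ * I)).im) (Icc 0 L) := fun t _ =>
      (continuous_im.continuousAt.comp (ContinuousAt.comp (g := f)
        (f := fun t : ℝ => (t + R₁ * I : ℂ)) (hfc _ (by simpa using hR₁))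
        (by fun_prop))).continuousWithinAt
    obtain ⟨B, hB⟩ := (isCompact_Icc.image_of_continuousOn h1).bddAbove
    refine ⟨B, fun c hc => ?_⟩
    have h2 := apply_add_int_mul (f := f) hper (-⌊c.re / L⌋) c (hc ▸ hR₁)
    have h3 : (f (c + (((-⌊c.re / L⌋ : ℤ) * L : ℝ) : ℂ))).im = (f c).im := by
      rw [h2]; simp
    have h4 : c + (((-⌊c.re / L⌋ : ℤ) * L : ℝ) : ℂ) =
        ((Int.fract (c.re / L) * L : ℝ) : ℂ) + R₁ * I := by
      have h5 : Int.fract (c.re / L) * L = c.re - ⌊c.re / L⌋ * L := by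
        rw [Int.fract, sub_mul, div_mul_cancel₀ _ hL.ne']
      rw [h5]
      apply Complex.ext
      · simp [sub_eq_add_neg]
      · simp [hc]
    rw [← h3, h4]
    refine hB ⟨Int.fract (c.re / L) * L, ⟨by positivity, ?_⟩, rfl⟩
    exact mul_le_of_le_one_left hL.le (Int.fract_lt_one _).le
  have hu := hζ.isOpen_image hκ (isOpen_halfPlane R₁) fun c (hc : R₁ < c.im) => hR₁.trans hc
  -- Preimages of a convergent sequence form a Cauchy sequence.
  have hcl : closure (f '' {c : ℂ | R₁ < c.im}) ⊆ f '' {c : ℂ | R₁ ≤ c.im} := by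
    intro z hz
    obtain ⟨x, hx, hxz⟩ := mem_closure_iff_seq_limit.mp hz
    choose c hc hcx using hx
    have hcau : CauchySeq c := by
      rw [Metric.cauchySeq_iff]
      intro δ hδ
      have hκ0 : 0 < ‖κ‖ := norm_pos_iff.mpr hκ
      obtain ⟨j, hj⟩ := Metric.cauchySeq_iff.mp hxz.cauchySeq (‖κ‖ * δ) (by positivity)
      refine ⟨j, fun k hk l hl => ?_⟩
      have h1 := hj k hk l hl
      rw [← hcx, ← hcx, dist_eq_norm, hf, ← mul_sub, norm_mul] at h1
      rw [dist_eq_norm]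
      exact (hζ.expanding (hR₁.trans (hc l)) (hR₁.trans (hc k))).trans_lt
        (lt_of_mul_lt_mul_left h1 hκ0.le)
    obtain ⟨c₀, hc₀⟩ := cauchySeq_tendsto_of_complete hcau
    have h1 : R₁ ≤ c₀.im := (isClosed_le continuous_const continuous_im).mem_of_tendsto hc₀
      (Filter.Eventually.of_forall fun k => show R₁ ≤ (c k).im from le_of_lt (hc k))
    refine ⟨c₀, h1, tendsto_nhds_unique ((hfc c₀ (hR₁.trans_le h1)).tendsto.comp hc₀) ?_⟩
    exact hxz.congr fun k => (hcx k).symm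
  refine ⟨B, ?_⟩
  have hsub : {z : ℂ | B < z.im} ⊆ f '' {c : ℂ | R₁ < c.im} := by
    refine (isPreconnected_halfPlane B).subset_of_closure_inter_subset hu ?_ ?_
    · obtain ⟨R₂, hR₂, hR₂'⟩ := htop (B + 1)
      refine ⟨f (((max R₁ R₂ + 1 : ℝ) : ℂ) * I), ?_, _, ?_, rfl⟩
      · have := hR₂' (((max R₁ R₂ + 1 : ℝ) : ℂ) * I) (by
          simpa using (le_max_right R₁ R₂).trans (le_of_lt (lt_add_one _)))
        exact (lt_add_one B).trans_le this
      · simpa using (le_max_left R₁ R₂).trans_lt (lt_add_one _)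
    · rintro _ ⟨hz, hzB⟩
      obtain ⟨c, hc, rfl⟩ := hcl hz
      rcases (show R₁ ≤ c.im from hc).lt_or_eq with h | h
      · exact ⟨c, h, rfl⟩
      · exact absurd (hB c h.symm) (not_le.mpr hzB)
  intro z hz
  obtain ⟨c, hc, rfl⟩ := hsub hz
  exact ⟨c, hR₁.trans hc, hR₁'.trans hc, rfl⟩

end IsLewyMap

/-- `τ` is a conformal parametrization of the end of the half-plane `im > y₀`, with the metric of
the graph of `φ`, by the half-plane `im > C`; the translation by `1` corresponds to the translation
by `±L`. -/
structure IsGraphParam (φ : ℂ → ℝ) (y₀ L C : ℝ) (ε : ℝ) (τ : ℂ → ℂ) : Prop where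
  sign : |ε| = 1
  mem : ∀ z : ℂ, C < z.im → y₀ < (τ z).im
  contDiffAt : ∀ z : ℂ, C < z.im → ContDiffAt ℝ ∞ τ z
  conformal : ∀ z : ℂ, C < z.im → ∃ m : ℝ, 0 < m ∧ ∀ u w : ℂ,
    (fderiv ℝ τ z u).re * (fderiv ℝ τ z w).re + (fderiv ℝ τ z u).im * (fderiv ℝ τ z w).im
      - fderiv ℝ φ (τ z) (fderiv ℝ τ z u) * fderiv ℝ φ (τ z) (fderiv ℝ τ z w)
      = m * (u.re * w.re + u.im * w.im)
  injOn : InjOn τ {z | C < z.im}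
  isOpen_image : ∀ V : Set ℂ, IsOpen V → V ⊆ {z | C < z.im} → IsOpen (τ '' V)
  translate : ∀ z : ℂ, C < z.im → τ (z + 1) = τ z + ((ε * L : ℝ) : ℂ)
  tendsto : ∀ R : ℝ, ∃ C' : ℝ, ∀ z : ℂ, C' < z.im → R < (τ z).im
  covers : ∀ C' : ℝ, ∃ R : ℝ, ∀ c : ℂ, R < c.im → ∃ z : ℂ, C < z.im ∧ C' < z.im ∧ τ z = c

/-- The graph of a maximal graph function on a half plane, with periodic differential, is conformally a
half plane: the parametrization is the inverse of the normalized Lewy map. -/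
theorem exists_isGraphParam {φ : ℂ → ℝ} {y₀ L h : ℝ} (hL : 0 < L)
    (hmax : ∀ c : ℂ, y₀ < c.im → IsMaximalGraphAt φ c)
    (hper : ∀ c : ℂ, y₀ < c.im → φ (c + L) = φ c + h) :
    ∃ C ε τ, IsGraphParam φ y₀ L C ε τ := by
  obtain ⟨ζ, hζ'⟩ := exists_lewyMap hmax
  have hζ : IsLewyMap φ y₀ ζ := ⟨hmax, fun c hc => (hζ' c hc).1, fun c hc => (hζ' c hc).2⟩
  obtain ⟨κ, ε, hε, hκ, hκL, htop⟩ := hζ.exists_normalization hL hper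
  have hcov := hζ.exists_halfPlane_subset hL hκ hκL htop
  have hinj : ∀ c c' : ℂ, y₀ < c.im → y₀ < c'.im → κ * ζ c = κ * ζ c' → c = c' := by
    intro c c' hc hc' heq
    have h1 := hζ.expanding hc hc'
    rw [mul_left_cancel₀ hκ heq, sub_self, norm_zero] at h1
    exact (sub_eq_zero.mp (norm_le_zero_iff.mp h1)).symm
  obtain ⟨C, hC⟩ := hcov y₀
  have hex : ∀ z : ℂ, ∃ c : ℂ, C < z.im → y₀ < c.im ∧ κ * ζ c = z := by
    intro z
    by_cases hz : C < z.im
    · obtain ⟨c, h1, -, h2⟩ := hC z hz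
      exact ⟨c, fun _ => ⟨h1, h2⟩⟩
    · exact ⟨0, fun h => absurd h hz⟩
  choose τ hτ using hex
  have hτmem := fun z hz => (hτ z hz).1
  have hτr := fun z hz => (hτ z hz).2
  have hτl : ∀ c : ℂ, y₀ < c.im → C < (κ * ζ c).im → τ (κ * ζ c) = c := fun c hc hcC =>
    hinj _ _ (hτmem _ hcC) hc (hτr _ hcC)
  have hεε : ε * ε = 1 := by rw [← abs_mul_abs_self, hε, one_mul]
  -- `τ` coincides with the local inverse given by the inverse function theorem.
  have hloc : ∀ z : ℂ, C < z.im → ContDiffAt ℝ ∞ τ z ∧ ∀ u : ℂ,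
      κ * lewyDeriv φ (τ z) (fderiv ℝ τ z u) = u := by
    intro z hz
    obtain ⟨D, hD, hDs⟩ := hζ.exists_hasStrictFDerivAt hκ (hτmem z hz)
    have hsm : ContDiffAt ℝ ∞ (fun c => κ * ζ c) (τ z) :=
      contDiffAt_const.mul (hζ.contDiffAt _ (hτmem z hz))
    have h1 := hsm.to_localInverse hDs.hasFDerivAt (by simp)
    have h2 := hDs.to_localInverse
    have h3 := hDs.eventually_right_inverse
    have h4 : Filter.Tendsto (hDs.localInverse _ _ _) (𝓝 (κ * ζ (τ z))) (𝓝 (τ z)) := by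
      have := hDs.localInverse_continuousAt
      rwa [ContinuousAt, hDs.localInverse_apply_image] at this
    rw [hτr z hz] at h1 h2 h3 h4
    have h5 : hDs.localInverse _ _ _ =ᶠ[𝓝 z] τ := by
      filter_upwards [h3, h4 ((isOpen_halfPlane y₀).mem_nhds (hτmem z hz)),
        (isOpen_halfPlane C).mem_nhds hz] with z' h6 h7 h8
      exact hinj _ _ h7 (hτmem z' h8) (h6.trans (hτr z' h8).symm)
    refine ⟨h1.congr_of_eventuallyEq h5.symm, fun u => ?_⟩
    rw [(h2.hasFDerivAt.congr_of_eventuallyEq h5.symm).fderiv, ← hD]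
    exact D.apply_symm_apply u
  refine ⟨C, ε, τ, hε, hτmem, fun z hz => (hloc z hz).1, fun z hz => ?_, ?_, ?_, ?_, ?_, ?_⟩
  · have h1 := hmax _ (hτmem z hz)
    have hS : 0 < 1 + (areaDensity φ (τ z))⁻¹ := by
      have := inv_pos.mpr h1.areaDensity_pos; linarith
    have hκ2 : 0 < κ.re * κ.re + κ.im * κ.im := by
      rw [← normSq_apply]; exact normSq_pos.mpr hκ
    refine ⟨((κ.re * κ.re + κ.im * κ.im) * (1 + (areaDensity φ (τ z))⁻¹) ^ 2)⁻¹, by positivity,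
      fun u w => ?_⟩
    rw [eq_inv_mul_iff_mul_eq₀ (by positivity), mul_assoc, ← h1.lewyDeriv_conformal]
    conv_rhs => rw [← (hloc z hz).2 u, ← (hloc z hz).2 w]
    simp only [mul_re, mul_im]
    ring
  · intro z hz z' hz' heq
    rw [← hτr z hz, ← hτr z' hz', heq]
  · intro V hV hVC
    have h1 : τ '' V = {c | y₀ < c.im} ∩ (fun c => κ * ζ c) ⁻¹' V := by
      ext c
      constructor
      · rintro ⟨z, hz, rfl⟩
        refine ⟨hτmem z (hVC hz), ?_⟩
        rw [mem_preimage, hτr z (hVC hz)]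
        exact hz
      · rintro ⟨hc, hcV⟩
        exact ⟨_, hcV, hτl c hc (hVC hcV)⟩
    rw [h1]
    refine ContinuousOn.isOpen_inter_preimage (fun c hc => ?_) (isOpen_halfPlane y₀) hV
    exact (continuousAt_const.mul (hζ.contDiffAt c hc).continuousAt).continuousWithinAt
  · intro z hz
    have hz1 : C < (z + 1).im := by simpa using hz
    have him : y₀ < (τ z + ((ε * L : ℝ) : ℂ)).im := by simpa using hτmem z hz
    refine hinj _ _ (hτmem _ hz1) him ?_
    rw [hτr _ hz1]
    obtain ⟨k, hk⟩ := exists_int_eq_of_abs_eq_one hε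
    have h1 := apply_add_int_mul (f := fun c => κ * ζ c) hκL k (τ z) (hτmem z hz)
    rw [hk, hτr z hz] at h1
    rw [h1]
    have h2 : (k : ℂ) = ε := by rw [← hk]; simp
    rw [h2, ← ofReal_mul, hεε, ofReal_one]
  · intro R
    obtain ⟨C', hC'⟩ := hcov R
    refine ⟨max C C', fun z hz => ?_⟩
    obtain ⟨c, hc, hcR, rfl⟩ := hC' z ((le_max_right _ _).trans_lt hz)
    rwa [hτl c hc ((le_max_left _ _).trans_lt hz)]
  · intro C'
    obtain ⟨R, hR, hR'⟩ := htop (max C C' + 1)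
    refine ⟨R, fun c hc => ⟨κ * ζ c, ?_, ?_, ?_⟩⟩
    · exact (le_max_left C C').trans_lt ((lt_add_one _).trans_le (hR' c (le_of_lt hc)))
    · exact (le_max_right C C').trans_lt ((lt_add_one _).trans_le (hR' c (le_of_lt hc)))
    · exact hτl c (hR.trans hc)
        ((le_max_left C C').trans_lt ((lt_add_one _).trans_le (hR' c (le_of_lt hc))))

end Lewy

/-! ### Isothermal punctured discs at the ends -/

section EndParam

open Complex Set Function.Periodic

theorem mem_puncturedDisc_iff {C : ℝ} {q : ℂ} (hq : q ≠ 0) :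
    q ∈ puncturedDisc (Real.exp (-2 * Real.pi * C)) ↔ C < (invQParam 1 q).im := by
  have h1 := norm_qParam_lt_iff one_pos C (invQParam 1 q)
  rw [qParam_right_inv one_ne_zero hq, div_one] at h1
  rw [← h1]
  exact ⟨fun h => h.2, fun h => ⟨norm_pos_iff.mpr hq, h⟩⟩

theorem ne_zero_of_mem_puncturedDisc {r : ℝ} {q : ℂ} (hq : q ∈ puncturedDisc r) : q ≠ 0 :=
  norm_pos_iff.mp hq.1

theorem isOpen_puncturedDisc (r : ℝ) : IsOpen (puncturedDisc r) :=
  (isOpen_lt continuous_const continuous_norm).inter (isOpen_lt continuous_norm continuous_const)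

/-- A local inverse of `z ↦ exp (2πiz)` near `q`. -/
def localQLog (q q' : ℂ) : ℂ := invQParam 1 q + (2 * Real.pi * I)⁻¹ * log (q' / q)

theorem localQLog_self {q : ℂ} (hq : q ≠ 0) : localQLog q q = invQParam 1 q := by
  simp [localQLog, div_self hq]

theorem qParam_localQLog {q q' : ℂ} (hq : q ≠ 0) (hq' : q' ≠ 0) :
    qParam 1 (localQLog q q') = q' := by
  have h1 := qParam_right_inv (h := 1) one_ne_zero hq
  rw [qParam] at h1 ⊢
  rw [localQLog, mul_add, add_div, exp_add, h1, ← mul_assoc, mul_inv_cancel₀ two_pi_I_ne_zero,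
    one_mul, ofReal_one, div_one, exp_log (div_ne_zero hq' hq), mul_div_cancel₀ _ hq]

theorem contDiffAt_localQLog {q : ℂ} (hq : q ≠ 0) : ContDiffAt ℝ ∞ (localQLog q) q := by
  have h1 : ContDiffAt ℂ ∞ (localQLog q) q := by
    refine contDiffAt_const.add (contDiffAt_const.mul
      (ContDiffAt.comp (g := log) q (contDiffAt_log ?_) (contDiffAt_id.div_const q)))
    rw [div_self hq]
    exact one_mem_slitPlane
  exact h1.restrict_scalars ℝ

theorem fderiv_localQLog {q : ℂ} (hq : q ≠ 0) (u : ℂ) :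
    fderiv ℝ (localQLog q) q u = ((2 * Real.pi * I)⁻¹ * q⁻¹) * u := by
  have h1 : HasDerivAt (localQLog q) ((2 * Real.pi * I)⁻¹ * (q⁻¹)) q := by
    have h2 : HasDerivAt (fun q' => log (q' / q)) (1 / q / (q / q)) q :=
      ((hasDerivAt_id q).div_const q).clog (by rw [id, div_self hq]; exact one_mem_slitPlane)
    rw [div_self hq, div_one, one_div] at h2
    exact (h2.const_mul _).const_add _
  have h2 := (h1.hasFDerivAt.restrictScalars ℝ).fderiv
  rw [h2]
  simp [mul_comm]

theorem eventually_im_localQLog {q : ℂ} (hq : q ≠ 0) {C : ℝ} (h : C < (invQParam 1 q).im) :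
    ∀ᶠ q' in 𝓝 q, C < (localQLog q q').im := by
  have h1 := (contDiffAt_localQLog hq).continuousAt
  exact h1.eventually (by rw [localQLog_self hq]; exact (isOpen_halfPlane C).mem_nhds h)

variable {M : Type*} [TopologicalSpace M] {N : Type*} [TopologicalSpace N]
  {ι : M → N} {P : N} {v : L3} {X : M → Quo v} {F : Set M} {a b n : L3}

/-- The projection to the surface of a reparametrized sheet, as a function of `exp (2πiz)`. -/
def discMap (σ : ℂ → Lifting v X) (τ : ℂ → ℂ) (q : ℂ) : M := (σ (τ (invQParam 1 q))).1.1

section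

variable {y₀ C ε : ℝ} {w : ℕ} {σ : ℂ → Lifting v X} {τ : ℂ → ℂ} {φ : ℂ → ℝ}

theorem IsGraphParam.translate_int {L : ℝ} (hτ : IsGraphParam φ y₀ L C ε τ) (k : ℤ) {z : ℂ}
    (hz : C < z.im) : τ (z + k) = τ z + ((k * (ε * L) : ℝ) : ℂ) := by
  have h1 := apply_add_int_mul (f := τ) (L := 1) (Λ := ((ε * L : ℝ) : ℂ))
    (fun c hc => by rw [ofReal_one]; exact hτ.translate c hc) k z hz
  rw [mul_one, ofReal_intCast] at h1
  rw [h1]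
  push_cast
  ring

theorem IsSheet.fst_period (hσ : IsSheet v X a b y₀ w σ)
    (hτ : IsGraphParam φ y₀ (w * lor v a) C ε τ) (k : ℤ) {z : ℂ} (hz : C < z.im) :
    (σ (τ (z + k))).1.1 = (σ (τ z)).1.1 := by
  obtain ⟨j, hj⟩ := exists_int_eq_of_abs_eq_one hτ.sign
  have h1 := hσ.period (τ z) (hτ.mem z hz) (k * j)
  have h2 : (((k * j : ℤ) : ℝ) * (w * lor v a)) = k * (ε * (w * lor v a)) := by
    rw [Int.cast_mul, hj]; ring
  rw [hτ.translate_int k hz, ← h2, h1]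
  rfl

theorem IsSheet.discMap_qParam (hσ : IsSheet v X a b y₀ w σ)
    (hτ : IsGraphParam φ y₀ (w * lor v a) C ε τ) {z : ℂ} (hz : C < z.im) :
    discMap σ τ (qParam 1 z) = (σ (τ z)).1.1 := by
  obtain ⟨k, hk⟩ := qParam_left_inv_mod_period (h := 1) one_ne_zero z
  rw [ofReal_one, mul_one] at hk
  rw [discMap, hk, hσ.fst_period hτ k hz]

theorem IsSheet.discMap_eventuallyEq (hσ : IsSheet v X a b y₀ w σ)
    (hτ : IsGraphParam φ y₀ (w * lor v a) C ε τ) {q : ℂ} (hq : q ≠ 0)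
    (hqC : C < (invQParam 1 q).im) :
    ∀ᶠ q' in 𝓝 q, C < (localQLog q q').im ∧
      discMap σ τ q' = (σ (τ (localQLog q q'))).1.1 := by
  filter_upwards [eventually_im_localQLog hq hqC, isOpen_ne.mem_nhds hq] with q' h1 h2
  refine ⟨h1, ?_⟩
  rw [← hσ.discMap_qParam hτ h1, qParam_localQLog hq h2]

theorem LorFrame.lor_fderiv_graphMap (h : LorFrame a b n) {c : ℂ} (hφ : DifferentiableAt ℝ φ c)
    (u w : ℂ) : lor (fderiv ℝ (graphMap a b n φ) c u) (fderiv ℝ (graphMap a b n φ) c w) =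
      u.re * w.re + u.im * w.im - fderiv ℝ φ c u * fderiv ℝ φ c w := by
  rw [(hasFDerivAt_graphMap a b n hφ).fderiv]
  simp [planeIncl_apply, h.aa, h.bb, h.ab, lor_comm b a, h.bn, h.an, lor_comm n, h.nn]
  ring

end

namespace EntireData

variable [ChartedSpace E2 M] [ChartedSpace E2 N] {y₀ C ε : ℝ} {w : ℕ} {σ : ℂ → Lifting v X}
  {τ : ℂ → ℂ}

omit [ChartedSpace E2 N] in
/-- A reparametrized sheet, which covers `M` with the period of `exp (2πiz)`, descends to an
isothermal parametrization by a punctured disc. -/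
theorem isIsothermal_discMap (D : EntireData v X F a b n)
    (hy : ∀ q ∈ liftSing v X F, (MaxSurf.liftProj a b v X q).im ≤ y₀)
    (hσ : IsSheet v X a b y₀ w σ)
    (hτ : IsGraphParam (sheetHeight n σ) y₀ (w * lor v a) C ε τ) :
    ∃ H, IsIsothermal v X F (puncturedDisc (Real.exp (-2 * Real.pi * C))) (discMap σ τ) H := by
  have hUF : ∀ q ∈ liftSing v X F, MaxSurf.liftProj a b v X q ∉ {c : ℂ | y₀ < c.im} :=
    fun q hq h => (hy q hq).not_gt h
  set φ := sheetHeight n σ with hφ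
  have hmax : ∀ c : ℂ, y₀ < c.im → IsMaximalGraphAt φ c := fun c hc =>
    D.isMaximalGraphAt_sheet hy hσ hc
  have hL : 0 < w * lor v a := mul_pos (by exact_mod_cast hσ.one_le) D.pos
  -- The local lifts of the parametrization.
  let f : ℂ → ℂ → L3 := fun q q' => graphMap a b n φ (τ (localQLog q q'))
  refine ⟨fun q => lor (fderiv ℝ (f q) q 1) (fderiv ℝ (f q) q 1), isOpen_puncturedDisc _,
    fun q hq => ?_, fun q hq q' hq' heq => ?_, ?_, fun q hq => ?_, fun q hq => ?_⟩
  · have hq0 := ne_zero_of_mem_puncturedDisc hq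
    have hqC := (mem_puncturedDisc_iff hq0).mp hq
    have h1 := hσ.discMap_eventuallyEq hτ hq0 hqC
    have h2 : ContinuousAt (fun q' => (σ (τ (localQLog q q'))).1.1) q := by
      have h3 : ContinuousAt (fun q' => τ (localQLog q q')) q :=
        ContinuousAt.comp (g := τ)
          (by rw [localQLog_self hq0]; exact (hτ.contDiffAt _ hqC).continuousAt)
          (contDiffAt_localQLog hq0).continuousAt
      have h4 : ContinuousAt (fun q' => σ (τ (localQLog q q'))) q :=
        ContinuousAt.comp (g := σ) (by
          rw [localQLog_self hq0]
          exact hσ.continuousOn.continuousAt ((isOpen_halfPlane y₀).mem_nhds (hτ.mem _ hqC))) h3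
      exact (continuous_fst.comp continuous_subtype_val).continuousAt.comp h4
    exact (h2.congr (h1.mono fun q' h => h.2.symm)).continuousWithinAt
  · have hq0 := ne_zero_of_mem_puncturedDisc hq
    have hqC := (mem_puncturedDisc_iff hq0).mp hq
    have hq0' := ne_zero_of_mem_puncturedDisc hq'
    have hqC' := (mem_puncturedDisc_iff hq0').mp hq'
    obtain ⟨k, hk⟩ := hσ.fst_eq _ _ (hτ.mem _ hqC) (hτ.mem _ hqC') heq
    obtain ⟨j, hj⟩ := exists_int_eq_of_abs_eq_one hτ.sign
    have hεε : ε * ε = 1 := by rw [← abs_mul_abs_self, hτ.sign, one_mul]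
    have h1 := hτ.translate_int (k * j) hqC
    have h2 : ((k * j : ℤ) * (ε * (w * lor v a)) : ℝ) = k * (w * lor v a) := by
      rw [Int.cast_mul, hj]; linear_combination (k * (w * lor v a)) * hεε
    rw [h2, ← hk] at h1
    have h3 := hτ.injOn (by simpa using hqC) hqC' h1
    rw [← qParam_right_inv (h := 1) one_ne_zero hq0,
      ← qParam_right_inv (h := 1) one_ne_zero hq0', ← h3, qParam, qParam, ofReal_one, div_one,
      div_one, exp_eq_exp_iff_exists_int]
    refine ⟨-(k * j), ?_⟩
    push_cast; ring
  · have h1 : discMap σ τ '' puncturedDisc (Real.exp (-2 * Real.pi * C)) =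
        (fun q : Lifting v X => q.1.1) '' (σ '' (τ '' {z | C < z.im})) := by
      ext p
      constructor
      · rintro ⟨q, hq, rfl⟩
        exact ⟨_, ⟨_, ⟨_, (mem_puncturedDisc_iff (ne_zero_of_mem_puncturedDisc hq)).mp hq, rfl⟩,
          rfl⟩, rfl⟩
      · rintro ⟨_, ⟨_, ⟨z, hz, rfl⟩, rfl⟩, rfl⟩
        refine ⟨qParam 1 z, ⟨norm_pos_iff.mpr (qParam_ne_zero z), ?_⟩, hσ.discMap_qParam hτ hz⟩
        have := (norm_qParam_lt_iff one_pos C z).mpr hz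
        rwa [div_one] at this
    rw [h1]
    refine isOpenMap_fst_lifting D.continuous _ ?_
    refine isOpen_section_image (continuous_liftProj a b v X) D.locallyInjective
      (isOpen_halfPlane y₀) hUF hσ.continuousOn hσ.proj
      (hτ.isOpen_image _ (isOpen_halfPlane C) subset_rfl) ?_
    rintro _ ⟨z, hz, rfl⟩
    exact hτ.mem z hz
  · intro hF
    have hqC := (mem_puncturedDisc_iff (ne_zero_of_mem_puncturedDisc hq)).mp hq
    exact hUF (σ (τ (invQParam 1 q))) hF (by
      rw [hσ.proj _ (hτ.mem _ hqC)]; exact hτ.mem _ hqC)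
  · have hq0 := ne_zero_of_mem_puncturedDisc hq
    have hqC := (mem_puncturedDisc_iff hq0).mp hq
    set z := invQParam 1 q with hz
    obtain ⟨V, hV, hVo, hqV⟩ := eventually_nhds_iff.mp ((hσ.discMap_eventuallyEq hτ hq0 hqC).and
      (((((contDiffAt_localQLog hq0).of_le (m := 1) (by simp)).eventually (by simp)).and
        (isOpen_ne.mem_nhds hq0))))
    have hφz := hmax _ (hτ.mem z hqC)
    have hdτ := (hτ.contDiffAt z hqC).differentiableAt (by simp)
    have hsm : ContDiffAt ℝ ∞ (f q) q := by
      have h1 : ContDiffAt ℝ ∞ (fun q' => τ (localQLog q q')) q :=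
        ContDiffAt.comp (g := τ) q (by rw [localQLog_self hq0]; exact hτ.contDiffAt z hqC)
          (contDiffAt_localQLog hq0)
      refine ContDiffAt.comp (g := graphMap a b n φ) q ?_ h1
      rw [localQLog_self hq0]
      exact contDiffAt_graphMap a b n hφz.contDiffAt
    have hfd : ∀ u : ℂ, fderiv ℝ (f q) q u = fderiv ℝ (graphMap a b n φ) (τ z)
        (fderiv ℝ τ z (((2 * Real.pi * I)⁻¹ * q⁻¹) * u)) := by
      intro u
      have h0 := ((contDiffAt_localQLog hq0).differentiableAt (by simp)).hasFDerivAt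
      have h1 : HasFDerivAt τ (fderiv ℝ τ z) (localQLog q q) := by
        rw [localQLog_self hq0]; exact hdτ.hasFDerivAt
      have h2 : HasFDerivAt (graphMap a b n φ) (fderiv ℝ (graphMap a b n φ) (τ z))
          (τ (localQLog q q)) := by
        rw [localQLog_self hq0]
        exact ((contDiffAt_graphMap a b n hφz.contDiffAt).differentiableAt (by simp)).hasFDerivAt
      have h3 : HasFDerivAt (f q) _ q := HasFDerivAt.comp (g := graphMap a b n φ)
        (f := fun q' => τ (localQLog q q')) q h2 (h1.comp q h0)
      rw [h3.fderiv, ← fderiv_localQLog hq0]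
      rfl
    obtain ⟨m, hm, hmc⟩ := hτ.conformal z hqC
    have hconf : ∀ u u' : ℂ, lor (fderiv ℝ (f q) q u) (fderiv ℝ (f q) q u') =
        m * normSq ((2 * Real.pi * I)⁻¹ * q⁻¹) * (u.re * u'.re + u.im * u'.im) := by
      intro u u'
      rw [hfd, hfd, D.frame.lor_fderiv_graphMap (hφz.contDiffAt.differentiableAt (by simp)), hmc,
        normSq_apply]
      simp only [mul_re ((2 * Real.pi * I)⁻¹ * q⁻¹), mul_im ((2 * Real.pi * I)⁻¹ * q⁻¹)]
      ring
    have hk : 0 < normSq ((2 * Real.pi * I)⁻¹ * q⁻¹) := normSq_pos.mpr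
      (mul_ne_zero (inv_ne_zero two_pi_I_ne_zero) (inv_ne_zero hq0))
    refine ⟨V, f q, hqV, ⟨hVo, fun q' hq' => ?_, fun q' hq' => ?_⟩, hsm, ?_, rfl, ?_, ?_⟩
    · obtain ⟨⟨h1, -⟩, h2, -⟩ := hV q' hq'
      refine ContinuousAt.continuousWithinAt ?_
      refine ContinuousAt.comp (g := graphMap a b n φ)
        (contDiffAt_graphMap a b n (hmax _ (hτ.mem _ h1)).contDiffAt).continuousAt ?_
      exact ContinuousAt.comp (g := τ) (hτ.contDiffAt _ h1).continuousAt h2.continuousAt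
    · obtain ⟨⟨h1, h2⟩, -⟩ := hV q' hq'
      have h3 := D.liftMap_sheet hσ (hτ.mem _ h1)
      rw [Function.comp_apply, h2, (σ (τ (localQLog q q'))).2]
      exact congrArg _ h3.symm
    · rw [hconf]
      simpa using mul_pos hm hk
    · rw [hconf, hconf]; simp
    · rw [hconf]; simp

/-- At an end where the axial coordinate tends to `+∞`, a punctured neighbourhood is
parametrized isothermally by a punctured disc. -/
theorem exists_isothermal_end [T2Space N] [T2Space M] [CompactSpace N]
    (D : EntireData v X F a b n) (hι : IsEndCompactification ι)
    (htop : Filter.Tendsto (fun p => quoCoord v b D.orth (X p)) (Filter.comap ι (𝓝 P))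
      Filter.atTop) :
    ∃ (r : ℝ) (ψ : ℂ → M) (H : ℂ → ℝ), 0 < r ∧ IsIsothermal v X F (puncturedDisc r) ψ H ∧
      Filter.Tendsto (ι ∘ ψ) (𝓝[≠] 0) (𝓝 P) ∧
      ∀ r' > 0, insert P ((ι ∘ ψ) '' puncturedDisc r') ∈ 𝓝 P := by
  obtain ⟨y₀, w, σ, hy, hσ, hlim, hnh⟩ := D.exists_sheet_at_end hι htop
  have hL : 0 < w * lor v a := mul_pos (by exact_mod_cast hσ.one_le) D.pos
  obtain ⟨C, ε, τ, hτ⟩ := exists_isGraphParam hL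
    (fun c hc => D.isMaximalGraphAt_sheet hy hσ hc)
    (fun c hc => sheetHeight_period (n := n) hσ hc)
  obtain ⟨H, hH⟩ := D.isIsothermal_discMap hy hσ hτ
  refine ⟨_, _, H, Real.exp_pos _, hH, ?_, fun r' hr' => ?_⟩
  · refine hlim.comp ?_
    rw [Filter.tendsto_comap_iff, Filter.tendsto_atTop]
    intro R
    obtain ⟨C', hC'⟩ := hτ.tendsto R
    have h1 := invQParam_tendsto one_pos
    rw [Filter.tendsto_comap_iff] at h1
    filter_upwards [h1 (Filter.Ioi_mem_atTop C')] with q hq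
    exact (hC' _ hq).le
  · obtain ⟨R, hR⟩ := hτ.covers (-Real.log r' / (2 * Real.pi))
    refine Filter.mem_of_superset (hnh R) (insert_subset_insert ?_)
    rintro _ ⟨c, hc, rfl⟩
    obtain ⟨z, hz, hz', rfl⟩ := hR c hc
    refine ⟨qParam 1 z, ⟨norm_pos_iff.mpr (qParam_ne_zero z), ?_⟩, ?_⟩
    · have h1 := (norm_qParam_lt_iff one_pos _ z).mpr hz'
      have h2 : -2 * Real.pi * (-Real.log r' / (2 * Real.pi)) / 1 = Real.log r' := by
        have := Real.pi_pos.ne'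
        field_simp
      rwa [h2, Real.exp_log hr'] at h1
    · rw [Function.comp_apply, hσ.discMap_qParam hτ hz]

end EntireData

end EndParam

/-! ### The holomorphic form of a maximal surface -/

section HolomorphicForm

open Complex Set

variable {M : Type*} [TopologicalSpace M] {v : L3} {X : M → Quo v} {F : Set M} {Ω : Set ℂ}
  {ψ : ℂ → M} {H : ℂ → ℝ} {a b n : L3}

/-- Two local lifts differ by a constant. -/
theorem IsLocalLift.eventuallyEq_add_const (hv : v ≠ 0) {Y : ℂ → Quo v} {U U' : Set ℂ}
    {f f' : ℂ → L3} (h : IsLocalLift v Y U f) (h' : IsLocalLift v Y U' f') {z : ℂ} (hz : z ∈ U)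
    (hz' : z ∈ U') : f' =ᶠ[𝓝 z] fun w => f w + (f' z - f z) := by
  have h1 := eventually_sub_eq_of_toQuo_eq (f := f) (g := f') (z := z) hv
    (h.continuousOn.continuousAt (h.isOpen.mem_nhds hz))
    (h'.continuousOn.continuousAt (h'.isOpen.mem_nhds hz')) (by
      filter_upwards [h.isOpen.mem_nhds hz, h'.isOpen.mem_nhds hz'] with w hw hw'
      rw [h.lifts w hw, h'.lifts w hw'])
  filter_upwards [h1] with w hw
  rw [← hw]; abel

theorem IsLocalLift.fderiv_eq (hv : v ≠ 0) {Y : ℂ → Quo v} {U U' : Set ℂ}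
    {f f' : ℂ → L3} (h : IsLocalLift v Y U f) (h' : IsLocalLift v Y U' f') {z : ℂ} (hz : z ∈ U)
    (hz' : z ∈ U') : fderiv ℝ f' z = fderiv ℝ f z := by
  rw [(h.eventuallyEq_add_const hv h' hz hz').fderiv_eq, fderiv_add_const]

/-- Every local lift of an isothermal parametrization is smooth and conformal. -/
theorem IsIsothermal.conformal_lift (hv : v ≠ 0) (hI : IsIsothermal v X F Ω ψ H) {U : Set ℂ}
    {f : ℂ → L3} (hf : IsLocalLift v (X ∘ ψ) U f) {z : ℂ} (hz : z ∈ U) (hzΩ : z ∈ Ω) :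
    ContDiffAt ℝ ∞ f z ∧ 0 < H z ∧ lor (fderiv ℝ f z 1) (fderiv ℝ f z 1) = H z ∧
    lor (fderiv ℝ f z I) (fderiv ℝ f z I) = H z ∧ lor (fderiv ℝ f z 1) (fderiv ℝ f z I) = 0 := by
  obtain ⟨U', f', hz', hf', h1, h2⟩ := hI.conformal z hzΩ
  rw [← hf'.fderiv_eq hv hf hz' hz] at h2
  exact ⟨(h1.add contDiffAt_const).congr_of_eventuallyEq
    (hf'.eventuallyEq_add_const hv hf hz' hz), h2⟩

/-- A local lift is a graph reparametrized by its projection to the plane. -/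
theorem IsIsothermal.exists_eq_graphMap [ChartedSpace E2 M] (hv : v ≠ 0)
    (hfr : LorFrame a b n) (hmax : ∀ p, p ∉ F → MaximalAt v X p)
    (hI : IsIsothermal v X F Ω ψ H) {U : Set ℂ}
    {f : ℂ → L3} (hf : IsLocalLift v (X ∘ ψ) U f) {z : ℂ} (hz : z ∈ U) (hzΩ : z ∈ Ω) :
    ∃ φ, IsMaximalGraphAt φ (planeProj a b (f z)) ∧
      f =ᶠ[𝓝 z] graphMap a b n φ ∘ fun z' => planeProj a b (f z') := by
  let q₀ : Lifting v X := ⟨(ψ z, f z), (hf.lifts z hz).symm⟩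
  obtain ⟨φ, hφ, V, hV, -, hVg⟩ := MaximalAt.exists_local_graph hfr hv q₀
    (hmax _ (hI.avoids z hzΩ))
  refine ⟨φ, hφ, ?_⟩
  obtain ⟨O, hO, hOV⟩ := mem_nhds_subtype _ _ _ |>.mp hV
  have h1 : ContinuousAt (fun z' => (ψ z', f z')) z :=
    (hI.continuousOn.continuousAt (hI.isOpen.mem_nhds hzΩ)).prodMk
      (hf.continuousOn.continuousAt (hf.isOpen.mem_nhds hz))
  filter_upwards [h1 hO, hf.isOpen.mem_nhds hz] with z' h2 h3
  have h4 := hVg ⟨(ψ z', f z'), (hf.lifts z' h3).symm⟩ (hOV h2)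
  exact (hfr.graphMap_eq h4).symm

theorem hasFDerivAt_fderiv_apply {f : ℂ → L3} {z : ℂ} (h : ContDiffAt ℝ ∞ f z) (u : ℂ) :
    HasFDerivAt (fun z => fderiv ℝ f z u) ((fderiv ℝ (fderiv ℝ f) z).flip u) z := by
  have h1 := ((h.fderiv_right (m := ∞) (by simp)).differentiableAt (by simp)).hasFDerivAt
  exact (ContinuousLinearMap.apply ℝ L3 u).hasFDerivAt.comp z h1

theorem HasFDerivAt.lor {f g : ℂ → L3} {f' g' : ℂ →L[ℝ] L3} {z : ℂ} (hf : HasFDerivAt f f' z)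
    (hg : HasFDerivAt g g' z) : HasFDerivAt (fun z => lor (f z) (g z))
      ((lorL (g z)).comp f' + (lorL (f z)).comp g') z := by
  have h1 : ∀ {h : ℂ → L3} {h' : ℂ →L[ℝ] L3} (_ : HasFDerivAt h h' z) (i : Fin 3),
      HasFDerivAt (fun z => h z i) ((ContinuousLinearMap.proj i).comp h') z :=
    fun hh i => (hasFDerivAt_pi'.mp hh) i
  have h2 := (((h1 hf 0).mul (h1 hg 0)).add ((h1 hf 1).mul (h1 hg 1))).sub
    ((h1 hf 2).mul (h1 hg 2))
  refine h2.congr_fderiv ?_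
  ext u
  simp [MaxSurf.lor]
  ring

/-- Conformal parametrizations of maximal surfaces are harmonic: the Laplacian is orthogonal to the
tangent plane by conformality, and to the normal since the mean curvature vanishes. -/
theorem IsIsothermal.laplacian_eq_zero [ChartedSpace E2 M] (hv : v ≠ 0)
    (hfr : LorFrame a b n) (hmax : ∀ p, p ∉ F → MaximalAt v X p)
    (hI : IsIsothermal v X F Ω ψ H) {U : Set ℂ}
    {f : ℂ → L3} (hf : IsLocalLift v (X ∘ ψ) U f) {z : ℂ} (hz : z ∈ U) (hzΩ : z ∈ Ω) :
    fderiv ℝ (fderiv ℝ f) z 1 1 + fderiv ℝ (fderiv ℝ f) z I I = 0 := by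
  obtain ⟨hsm, hH, h11, hII, h1I⟩ := hI.conformal_lift hv hf hz hzΩ
  have hev : ∀ᶠ z' in 𝓝 z, z' ∈ U ∩ Ω := (hf.isOpen.inter hI.isOpen).mem_nhds ⟨hz, hzΩ⟩
  have d1 := hasFDerivAt_fderiv_apply hsm 1
  have dI := hasFDerivAt_fderiv_apply hsm I
  have e1 := ((HasFDerivAt.lor d1 d1).sub (HasFDerivAt.lor dI dI)).congr_of_eventuallyEq
    (f₁ := fun _ => (0 : ℝ)) (by
      filter_upwards [hev] with z' hz'
      obtain ⟨-, -, h1, h2, -⟩ := hI.conformal_lift hv hf hz'.1 hz'.2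
      simp [h1, h2]) |>.unique (hasFDerivAt_const 0 z)
  have e2 := (HasFDerivAt.lor d1 dI).congr_of_eventuallyEq
    (f₁ := fun _ => (0 : ℝ)) (by
      filter_upwards [hev] with z' hz'
      obtain ⟨-, -, -, -, h1⟩ := hI.conformal_lift hv hf hz'.1 hz'.2
      simp [h1]) |>.unique (hasFDerivAt_const 0 z)
  have hs : fderiv ℝ (fderiv ℝ f) z I 1 = fderiv ℝ (fderiv ℝ f) z 1 I :=
    (hsm.isSymmSndFDerivAt (by simpa using two_le_infty)) I 1
  have e11 := congrArg (fun ℓ : ℂ →L[ℝ] ℝ => ℓ 1) e1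
  have e1I := congrArg (fun ℓ : ℂ →L[ℝ] ℝ => ℓ I) e1
  have e21 := congrArg (fun ℓ : ℂ →L[ℝ] ℝ => ℓ 1) e2
  have e2I := congrArg (fun ℓ : ℂ →L[ℝ] ℝ => ℓ I) e2
  simp [hs] at e11 e1I e21 e2I
  set Δ := fderiv ℝ (fderiv ℝ f) z 1 1 + fderiv ℝ (fderiv ℝ f) z I I with hΔ
  -- The Laplacian `Δ` is orthogonal to the tangent plane, hence may serve as a normal vector in the
  -- equation of zero mean curvature, which then reads `⟨Δ, Δ⟩ = 0`.
  have o1 : lor Δ (fderiv ℝ f z 1) = 0 := by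
    rw [hΔ, lor_add_left]; linarith
  have oI : lor Δ (fderiv ℝ f z I) = 0 := by
    rw [hΔ, lor_add_left]; linarith
  have hfu : ∀ u : ℂ, fderiv ℝ f z u = u.re • fderiv ℝ f z 1 + u.im • fderiv ℝ f z I := by
    intro u
    have h : u = u.re • (1 : ℂ) + u.im • I := by simp [re_add_im]
    conv_lhs => rw [h]
    rw [map_add, map_smul, map_smul]
  have o : ∀ u, lor (fderiv ℝ f z u) Δ = 0 := by
    intro u
    rw [hfu, lor_comm, lor_add_right, lor_smul_right, lor_smul_right, o1, oI]; ring
  obtain ⟨φ, hφ, hgr⟩ := hI.exists_eq_graphMap hv hfr hmax hf hz hzΩ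
  set θ : ℂ → ℂ := fun z' => planeProj a b (f z') with hθ
  have hθs : ContDiffAt ℝ ∞ θ z := (planeProj a b).contDiff.contDiffAt.comp z hsm
  have hYs : ContDiffAt ℝ ∞ (graphMap a b n φ) (θ z) := contDiffAt_graphMap a b n hφ.contDiffAt
  have hDf : ∀ u, fderiv ℝ f z u = fderiv ℝ (graphMap a b n φ) (θ z) (fderiv ℝ θ z u) := by
    intro u
    rw [hgr.fderiv_eq, fderiv_comp z (hYs.differentiableAt (by simp))
      (hθs.differentiableAt (by simp))]
    rfl
  have hinj : Function.Injective (fderiv ℝ θ z) := by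
    rw [injective_iff_map_eq_zero]
    intro u hu
    have h1 := hDf u
    rw [hu, map_zero] at h1
    have h2 : lor (fderiv ℝ f z u) (fderiv ℝ f z u) = H z * (u.re * u.re + u.im * u.im) := by
      rw [hfu]
      simp only [lor_add_left, lor_add_right, lor_smul_left, lor_smul_right, h11, hII, h1I,
        lor_comm (fderiv ℝ f z I) (fderiv ℝ f z 1)]
      ring
    rw [h1, lor_zero_left, zero_eq_mul, ← normSq_apply] at h2
    exact normSq_eq_zero.mp (h2.resolve_left hH.ne')
  have hsurj : Function.Surjective (fderiv ℝ θ z) :=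
    (LinearMap.injective_iff_surjective (f := (fderiv ℝ θ z : ℂ →ₗ[ℝ] ℂ))).mp hinj
  have hzmc : zmcForm f z Δ 1 I = 0 := by
    rw [zmcForm_congr hgr]
    refine zmcForm_comp (c₀ := 1) (c₁ := I) (hYs.of_le two_le_infty) (hθs.of_le two_le_infty)
      (fun w => ⟨w.re, w.im, by simp [re_add_im]⟩) (fun w => ?_) ?_ 1 I
    · obtain ⟨u, rfl⟩ := hsurj w
      rw [← hDf]; exact o u
    · rw [hfr.zmcForm_graphMap (hφ.contDiffAt.of_le two_le_infty), hφ.eq, mul_zero]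
  have hΔΔ : lor Δ Δ = 0 := by
    rw [zmcForm, h11, hII, h1I] at hzmc
    have h1 : H z * lor Δ Δ = 0 := by
      conv_lhs => rw [hΔ, lor_add_left, ← hΔ]
      linarith
    exact (mul_eq_zero.mp h1).resolve_left hH.ne'
  exact eq_zero_of_null_of_orth hH h11 hII h1I o1 oI hΔΔ

/-- `Φ` is the holomorphic form `2 ∂X/∂z dz` of the surface in the parametrization `ψ`. -/
structure IsHolomorphicForm (v : L3) (X : M → Quo v) (Ω : Set ℂ) (ψ : ℂ → M)
    (Φ : Fin 3 → ℂ → ℂ) : Prop where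
  isOpen : IsOpen Ω
  exists_lift : ∀ z ∈ Ω, ∃ U f, z ∈ U ∧ IsLocalLift v (X ∘ ψ) U f
  differentiableOn : ∀ j, DifferentiableOn ℂ (Φ j) Ω
  phi_eq : ∀ U f, IsLocalLift v (X ∘ ψ) U f → ∀ z ∈ U, z ∈ Ω → DifferentiableAt ℝ f z ∧
    ∀ j, phi f z j = Φ j z
  null : ∀ z ∈ Ω, Φ 0 z ^ 2 + Φ 1 z ^ 2 - Φ 2 z ^ 2 = 0
  pos : ∀ z ∈ Ω, 0 < normSq (Φ 0 z) + normSq (Φ 1 z) - normSq (Φ 2 z)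

/-- The form `2 ∂X/∂z dz` does not depend on the local lift, is holomorphic since the coordinates are
harmonic, and is null with positive Hermitian norm since the parameter is isothermal. -/
theorem IsIsothermal.exists_form [ChartedSpace E2 M] (hv : v ≠ 0)
    (hfr : LorFrame a b n) (hmax : ∀ p, p ∉ F → MaximalAt v X p)
    (hI : IsIsothermal v X F Ω ψ H) : ∃ Φ, IsHolomorphicForm v X Ω ψ Φ := by
  have hex : ∀ z, ∃ (U : Set ℂ) (f : ℂ → L3), z ∈ Ω → z ∈ U ∧ IsLocalLift v (X ∘ ψ) U f := by
    intro z
    by_cases hz : z ∈ Ω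
    · obtain ⟨U, f, h1, h2, -⟩ := hI.conformal z hz
      exact ⟨U, f, fun _ => ⟨h1, h2⟩⟩
    · exact ⟨∅, 0, fun h => absurd h hz⟩
  choose U f hUf using hex
  have hphi : ∀ U' f', IsLocalLift v (X ∘ ψ) U' f' → ∀ z ∈ U', z ∈ Ω → ∀ j,
      phi f' z j = phi (f z) z j := fun U' f' hf' z hz hzΩ j => by
    rw [phi, phi, (hUf z hzΩ).2.fderiv_eq hv hf' (hUf z hzΩ).1 hz]
  refine ⟨fun j z => phi (f z) z j, hI.isOpen, fun z hz => ⟨_, _, hUf z hz⟩, fun j z hz => ?_,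
    fun U' f' hf' z hz hzΩ => ⟨(hI.conformal_lift hv hf' hz hzΩ).1.differentiableAt (by simp),
      hphi U' f' hf' z hz hzΩ⟩, fun z hz => ?_, fun z hz => ?_⟩
  · have hev : ∀ᶠ z' in 𝓝 z, z' ∈ U z ∩ Ω :=
      ((hUf z hz).2.isOpen.inter hI.isOpen).mem_nhds ⟨(hUf z hz).1, hz⟩
    have hcomp : ∀ᶠ z' in 𝓝 z, ∀ u, fderiv ℝ (fun y => f z y j) z' u = fderiv ℝ (f z) z' u j := by
      filter_upwards [hev] with z' hz' u
      have h1 := ((hI.conformal_lift hv (hUf z hz).2 hz'.1 hz'.2).1.differentiableAt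
        (by simp)).hasFDerivAt
      rw [((hasFDerivAt_pi'.mp h1) j).fderiv]
      rfl
    have hharm : InnerProductSpace.HarmonicAt (fun y => f z y j) z := by
      refine ⟨?_, ?_⟩
      · exact (contDiffAt_pi.mp (hI.conformal_lift hv (hUf z hz).2 (hUf z hz).1 hz).1 j).of_le
          two_le_infty
      · filter_upwards [hev, hcomp.eventually_nhds] with z' hz' hc
        have hl := hI.laplacian_eq_zero hv hfr hmax (hUf z hz).2 hz'.1 hz'.2
        have hsm := (hI.conformal_lift hv (hUf z hz).2 hz'.1 hz'.2).1
        have h2 : ∀ u w, fderiv ℝ (fderiv ℝ (fun y => f z y j)) z' u w =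
            fderiv ℝ (fderiv ℝ (f z)) z' u w j := by
          intro u w
          have h3 : HasFDerivAt (fun y => fderiv ℝ (fun y => f z y j) y w) _ z' :=
            (((hasFDerivAt_pi'.mp (hasFDerivAt_fderiv_apply hsm w)) j)).congr_of_eventuallyEq
              (hc.mono fun y hy => hy w)
          have h4 : DifferentiableAt ℝ (fderiv ℝ (fun y => f z y j)) z' :=
            ((contDiffAt_pi.mp hsm j).fderiv_right (m := ∞) (by simp)).differentiableAt (by simp)
          have h5 : HasFDerivAt (fun y => fderiv ℝ (fun y => f z y j) y w) _ z' :=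
            (ContinuousLinearMap.apply ℝ ℝ w).hasFDerivAt.comp z' h4.hasFDerivAt
          have h6 := congrArg (fun ℓ : ℂ →L[ℝ] ℝ => ℓ u) (h5.unique h3)
          simpa using h6
        rw [InnerProductSpace.laplacian_eq_iteratedFDeriv_complexPlane]
        simp only [iteratedFDeriv_two_apply, Fin.isValue, Matrix.cons_val_zero,
          Matrix.cons_val_one, Matrix.cons_val_fin_one, Pi.zero_apply, h2]
        exact congrFun hl j
    refine ((HarmonicAt.differentiableAt_complex_partial hharm).congr_of_eventuallyEq
      ?_).differentiableWithinAt
    filter_upwards [hev, hcomp] with z' hz' hc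
    rw [hc, hc, ← hphi _ _ (hUf z hz).2 z' hz'.1 hz'.2 j]
    rfl
  · obtain ⟨-, -, h11, hII, h1I⟩ := hI.conformal_lift hv (hUf z hz).2 (hUf z hz).1 hz
    simp only [lor] at h11 hII h1I
    simp only [phi]
    apply Complex.ext
    · simp [pow_two]
      linarith
    · simp [pow_two]
      linarith
  · obtain ⟨-, hH, h11, hII, -⟩ := hI.conformal_lift hv (hUf z hz).2 (hUf z hz).1 hz
    simp only [lor] at h11 hII
    simp only [phi, normSq_apply]
    simp
    linarith

end HolomorphicForm

/-! ### Weierstrass data -/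

section Weierstrass

open Complex Set ComplexConjugate

variable {M : Type*} [TopologicalSpace M] {v : L3} {X : M → Quo v} {F : Set M} {Ω : Set ℂ}
  {ψ : ℂ → M} {H : ℂ → ℝ} {Φ : Fin 3 → ℂ → ℂ}

namespace IsHolomorphicForm

omit [TopologicalSpace M] in
theorem null_mul (hΦ : IsHolomorphicForm v X Ω ψ Φ) {z : ℂ} (hz : z ∈ Ω) :
    (Φ 0 z - I * Φ 1 z) * (Φ 0 z + I * Φ 1 z) = Φ 2 z ^ 2 := by
  have := hΦ.null z hz
  linear_combination this - Φ 1 z ^ 2 * I_sq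

omit [TopologicalSpace M] in
/-- The Gauss map, whose modulus squared is the quotient of the two sides, avoids the unit circle:
otherwise the form would be isotropic for the Hermitian product. -/
theorem norm_ne (hΦ : IsHolomorphicForm v X Ω ψ Φ) {z : ℂ} (hz : z ∈ Ω) :
    ‖Φ 0 z - I * Φ 1 z‖ ≠ ‖Φ 0 z + I * Φ 1 z‖ := by
  intro heq
  have h1 := congrArg norm (hΦ.null_mul hz)
  rw [norm_mul, norm_pow, ← heq, ← pow_two] at h1
  have h2 : ‖Φ 0 z + I * Φ 1 z‖ ^ 2 = ‖Φ 2 z‖ ^ 2 := by rw [← heq, h1]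
  have h3 := hΦ.pos z hz
  rw [Complex.sq_norm, Complex.sq_norm] at h1 h2
  simp only [normSq_apply] at h1 h2 h3
  simp at h1 h2
  linarith

omit [TopologicalSpace M] in
/-- The Weierstrass data are `η = -i (φ₁ - i φ₂)` and `g = φ₃ / η`. -/
theorem isWeierstrassData (hΦ : IsHolomorphicForm v X Ω ψ Φ)
    (hlt : ∀ z ∈ Ω, ‖Φ 0 z + I * Φ 1 z‖ < ‖Φ 0 z - I * Φ 1 z‖) :
    ∃ g φ₃ η, IsWeierstrassData v X Ω ψ g φ₃ η := by
  have hA : ∀ z ∈ Ω, Φ 0 z - I * Φ 1 z ≠ 0 := fun z hz =>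
    norm_pos_iff.mp ((norm_nonneg _).trans_lt (hlt z hz))
  refine ⟨fun z => Φ 2 z / (-I * (Φ 0 z - I * Φ 1 z)), Φ 2, fun z => -I * (Φ 0 z - I * Φ 1 z),
    fun z hz => ?_, fun z hz => ?_, fun z hz => ?_⟩
  · have h1 := congrArg norm (hΦ.null_mul hz)
    rw [norm_mul, norm_pow] at h1
    have h2 := norm_pos_iff.mpr (hA z hz)
    rw [norm_div, norm_mul, norm_neg, norm_I, one_mul, div_lt_one h2]
    refine lt_of_pow_lt_pow_left₀ 2 h2.le ?_
    rw [← h1, pow_two]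
    exact mul_lt_mul_of_pos_left (hlt z hz) h2
  · rw [div_mul_cancel₀]
    exact mul_ne_zero (neg_ne_zero.mpr I_ne_zero) (hA z hz)
  · obtain ⟨U, f, hzU, hf⟩ := hΦ.exists_lift z hz
    obtain ⟨h1, h2⟩ := hΦ.phi_eq U f hf z hzU hz
    have h3 : Φ 2 z / (-I * (Φ 0 z - I * Φ 1 z)) * Φ 2 z = I * (Φ 0 z + I * Φ 1 z) := by
      rw [div_mul_eq_mul_div, div_eq_iff (mul_ne_zero (neg_ne_zero.mpr I_ne_zero) (hA z hz))]
      linear_combination -(hΦ.null_mul hz) + (Φ 0 z - I * Φ 1 z) * (Φ 0 z + I * Φ 1 z) * I_sq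
    refine ⟨U, f, hzU, hf, h1, ?_, ?_, h2 2⟩
    · rw [h2, h3]; linear_combination Φ 0 z * I_sq
    · rw [h2, h3]; linear_combination Φ 1 z * I_sq

end IsHolomorphicForm

theorem isPreconnected_puncturedDisc (r : ℝ) : IsPreconnected (puncturedDisc r) := by
  convert isPreconnected_ball_diff_center (E := ℂ) (by simp) 0 r using 1
  ext z
  simp [puncturedDisc, and_comm]

theorem conj_mem_puncturedDisc {r : ℝ} {z : ℂ} :
    conj z ∈ puncturedDisc r ↔ z ∈ puncturedDisc r := by
  simp [puncturedDisc]

theorem IsLocalLift.comp_conj {Y : ℂ → Quo v} {U : Set ℂ} {f : ℂ → L3}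
    (hf : IsLocalLift v Y U f) : IsLocalLift v (Y ∘ conj) (conj ⁻¹' U) (f ∘ conj) :=
  ⟨hf.isOpen.preimage continuous_conj,
    hf.continuousOn.comp continuous_conj.continuousOn (mapsTo_preimage _ _),
    fun _ hz => hf.lifts _ hz⟩

theorem fderiv_comp_conj {f : ℂ → L3} {z : ℂ} (hf : DifferentiableAt ℝ f (conj z)) (u : ℂ) :
    fderiv ℝ (f ∘ conj) z u = fderiv ℝ f (conj z) (conj u) := by
  have h1 : HasFDerivAt (f ∘ conj) ((fderiv ℝ f (conj z)).comp (conjCLE : ℂ →L[ℝ] ℂ)) z :=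
    HasFDerivAt.comp (g := f) z hf.hasFDerivAt conjCLE.hasFDerivAt
  rw [h1.fderiv]
  rfl

/-- Reversing the orientation of an isothermal parametrization. -/
theorem IsIsothermal.comp_conj {r : ℝ} (hI : IsIsothermal v X F (puncturedDisc r) ψ H) :
    IsIsothermal v X F (puncturedDisc r) (ψ ∘ conj) (H ∘ conj) := by
  have himg : (ψ ∘ conj) '' puncturedDisc r = ψ '' puncturedDisc r := by
    rw [image_comp]
    congr 1
    ext z
    refine ⟨?_, fun hz => ⟨conj z, conj_mem_puncturedDisc.mpr hz, conj_conj z⟩⟩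
    rintro ⟨w, hw, rfl⟩
    exact conj_mem_puncturedDisc.mpr hw
  refine ⟨hI.isOpen, hI.continuousOn.comp continuous_conj.continuousOn
    fun z hz => conj_mem_puncturedDisc.mpr hz, fun z hz w hw h => ?_, ?_,
    fun z hz => hI.avoids _ (conj_mem_puncturedDisc.mpr hz), fun z hz => ?_⟩
  · exact (starRingEnd ℂ).injective
      (hI.injOn (conj_mem_puncturedDisc.mpr hz) (conj_mem_puncturedDisc.mpr hw) h)
  · rw [himg]; exact hI.isOpen_image
  · obtain ⟨U, f, hzU, hf, hsm, hH, h11, hII, h1I⟩ := hI.conformal _ (conj_mem_puncturedDisc.mpr hz)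
    have hd := hsm.differentiableAt (by simp)
    refine ⟨conj ⁻¹' U, f ∘ conj, hzU, hf.comp_conj,
      ContDiffAt.comp (g := f) z hsm conjCLE.contDiff.contDiffAt, hH, ?_, ?_, ?_⟩
    · rw [fderiv_comp_conj hd, map_one]; exact h11
    · rw [fderiv_comp_conj hd, conj_I, map_neg, lor_neg_left, lor_neg_right, neg_neg]; exact hII
    · rw [fderiv_comp_conj hd, fderiv_comp_conj hd, conj_I, map_neg, lor_neg_right, map_one, h1I,
        neg_zero]

/-- Up to reversing the orientation, a punctured disc carries Weierstrass data with `|g| < 1`. -/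
theorem IsIsothermal.exists_weierstrassData [ChartedSpace E2 M] {a b n : L3} (hv : v ≠ 0)
    (hfr : LorFrame a b n) (hmax : ∀ p, p ∉ F → MaximalAt v X p) {r : ℝ}
    (hI : IsIsothermal v X F (puncturedDisc r) ψ H) :
    (∃ g φ₃ η, IsWeierstrassData v X (puncturedDisc r) ψ g φ₃ η) ∨
      ∃ g φ₃ η, IsWeierstrassData v X (puncturedDisc r) (ψ ∘ conj) g φ₃ η := by
  obtain ⟨Φ, hΦ⟩ := hI.exists_form hv hfr hmax
  obtain ⟨Φ', hΦ'⟩ := hI.comp_conj.exists_form hv hfr hmax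
  have hc : ContinuousOn (fun z => ‖Φ 0 z - I * Φ 1 z‖ - ‖Φ 0 z + I * Φ 1 z‖)
      (puncturedDisc r) := by
    have h0 := (hΦ.differentiableOn 0).continuousOn
    have h1 := (hΦ.differentiableOn 1).continuousOn
    fun_prop
  have hpre := (isPreconnected_puncturedDisc r).image _ hc
  by_cases h : ∀ z ∈ puncturedDisc r, ‖Φ 0 z + I * Φ 1 z‖ < ‖Φ 0 z - I * Φ 1 z‖
  · exact Or.inl (hΦ.isWeierstrassData h)
  right
  push Not at h
  obtain ⟨z₁, hz₁, hle⟩ := h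
  have hgt : ∀ z ∈ puncturedDisc r, ‖Φ 0 z - I * Φ 1 z‖ < ‖Φ 0 z + I * Φ 1 z‖ := by
    intro z hz
    by_contra! hlt
    obtain ⟨w, hw, h0⟩ := hpre.Icc_subset ⟨z₁, hz₁, rfl⟩ ⟨z, hz, rfl⟩
      ⟨sub_nonpos.mpr hle, sub_nonneg.mpr hlt⟩
    exact hΦ.norm_ne hw (sub_eq_zero.mp h0)
  -- Reversing the orientation conjugates the form.
  have hconj : ∀ z ∈ puncturedDisc r, ∀ j, Φ' j z = conj (Φ j (conj z)) := by
    intro z hz j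
    obtain ⟨U, f, hzU, hf⟩ := hΦ.exists_lift _ (conj_mem_puncturedDisc.mpr hz)
    obtain ⟨hd, h1⟩ := hΦ.phi_eq U f hf _ hzU (conj_mem_puncturedDisc.mpr hz)
    rw [← (hΦ'.phi_eq _ _ hf.comp_conj z hzU hz).2 j, ← h1 j, phi, phi, fderiv_comp_conj hd,
      fderiv_comp_conj hd, conj_I, map_neg]
    simp
  refine hΦ'.isWeierstrassData fun z hz => ?_
  have h1 := hgt _ (conj_mem_puncturedDisc.mpr hz)
  rw [← norm_conj, ← norm_conj (Φ 0 _ + _)] at h1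
  rw [hconj z hz, hconj z hz]
  simpa [sub_eq_add_neg] using h1

end Weierstrass

section EndExistence

open Complex Set ComplexConjugate

variable {M : Type*} [TopologicalSpace M] [ChartedSpace E2 M] {N : Type*} [TopologicalSpace N]
  [ChartedSpace E2 N] {ι : M → N} {P : N} {v : L3} {X : M → Quo v} {F : Set M} {a b n : L3}

/-- The end is conformally a puncture. -/
theorem EntireData.exists_isConformalEnd [T2Space N] [T2Space M] [CompactSpace N]
    (D : EntireData v X F a b n) (hι : IsEndCompactification ι)
    (htop : Filter.Tendsto (fun p => quoCoord v b D.orth (X p)) (Filter.comap ι (𝓝 P))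
      Filter.atTop) :
    ∃ (r : ℝ) (ψ : ℂ → M) (g φ₃ η : ℂ → ℂ), IsConformalEnd v X F ι P r ψ g φ₃ η ∧
      ∀ r' > 0, insert P ((ι ∘ ψ) '' puncturedDisc r') ∈ 𝓝 P := by
  obtain ⟨r, ψ, H, hr, hI, hlim, hnh⟩ := D.exists_isothermal_end hι htop
  rcases hI.exists_weierstrassData D.ne_zero D.frame D.maximalAt with
    ⟨g, φ₃, η, hd⟩ | ⟨g, φ₃, η, hd⟩
  · exact ⟨r, ψ, g, φ₃, η, ⟨hr, ⟨H, hI⟩, hlim, hd⟩, hnh⟩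
  · refine ⟨r, ψ ∘ conj, g, φ₃, η, ⟨hr, ⟨_, hI.comp_conj⟩, ?_, hd⟩, fun r' hr' => ?_⟩
    · refine hlim.comp (tendsto_nhdsWithin_iff.mpr ⟨?_, ?_⟩)
      · refine Filter.Tendsto.mono_left ?_ nhdsWithin_le_nhds
        simpa using continuous_conj.tendsto 0
      · filter_upwards [self_mem_nhdsWithin] with z hz
        simpa using hz
    · refine Filter.mem_of_superset (hnh r' hr') (insert_subset_insert ?_)
      rintro _ ⟨z, hz, rfl⟩
      exact ⟨conj z, conj_mem_puncturedDisc.mpr hz, by simp⟩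

end EndExistence

/-! ### Logarithmic growth at a puncture -/

section Pole

open Complex Set Function.Periodic

/-- A holomorphic function which is bounded near the puncture extends. -/
theorem exists_analyticAt_of_bounded {f : ℂ → ℂ} {B : ℝ}
    (hd : ∀ᶠ z in 𝓝[≠] 0, DifferentiableAt ℂ f z) (hb : ∀ᶠ z in 𝓝[≠] 0, ‖f z‖ ≤ B) :
    ∃ G : ℂ → ℂ, AnalyticAt ℂ G 0 ∧ ∀ᶠ z in 𝓝[≠] 0, f z = G z := by
  obtain ⟨V, hV, hVs⟩ := mem_nhdsWithin_iff_exists_mem_nhds_inter.mp (hd.and hb)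
  have h1 := differentiableOn_update_limUnder_of_bddAbove (f := f) (c := 0) hV
    (fun z hz => (hVs hz).1.differentiableWithinAt)
    ⟨B, by rintro _ ⟨z, hz, rfl⟩; exact (hVs hz).2⟩
  refine ⟨_, h1.analyticAt hV, ?_⟩
  filter_upwards [self_mem_nhdsWithin] with z hz
  rw [Function.update_of_ne hz]

theorem exists_localQLog_eq {q q' : ℂ} (hq : q ≠ 0) (hq' : q' ≠ 0) :
    ∃ k : ℤ, invQParam 1 q' = localQLog q q' + k := by
  obtain ⟨k, hk⟩ := qParam_left_inv_mod_period (h := 1) one_ne_zero (localQLog q q')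
  rw [qParam_localQLog hq hq', ofReal_one, mul_one] at hk
  exact ⟨k, hk⟩

theorem hasDerivAt_localQLog {q : ℂ} (hq : q ≠ 0) :
    HasDerivAt (localQLog q) ((2 * Real.pi * I)⁻¹ * q⁻¹) q := by
  have h2 : HasDerivAt (fun q' => log (q' / q)) (1 / q / (q / q)) q :=
    ((hasDerivAt_id q).div_const q).clog (by rw [id, div_self hq]; exact one_mem_slitPlane)
  rw [div_self hq, div_one, one_div] at h2
  exact (h2.const_mul _).const_add _

theorem hasDerivAt_qParam (z : ℂ) : HasDerivAt (qParam 1) (qParam 1 z * (2 * Real.pi * I)) z := by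
  have h1 : HasDerivAt (fun z : ℂ => 2 * Real.pi * I * z / ((1 : ℝ) : ℂ)) (2 * Real.pi * I) z := by
    simpa using (hasDerivAt_id z).const_mul (2 * Real.pi * I)
  exact h1.cexp

theorem qParam_add_one {z : ℂ} : qParam 1 (z + 1) = qParam 1 z := by
  rw [qParam, qParam, ofReal_one, div_one, div_one, mul_add, mul_one, exp_add, exp_two_pi_mul_I,
    mul_one]

variable {t : ℂ → ℝ} {Θ : ℂ → ℂ} {C : ℝ}

/-- If `t = Re ∫ Θ dz` is a single valued function on a punctured disc then, for a real `κ`, some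
nonvanishing holomorphic function `E` has logarithmic derivative `κ / z - Θ` and
`|E| = exp (-t) |z| ^ κ`. -/
theorem exists_exp_primitive
    (hΘ : DifferentiableOn ℂ Θ (puncturedDisc (Real.exp (-2 * Real.pi * C))))
    (ht : ∀ z ∈ puncturedDisc (Real.exp (-2 * Real.pi * C)), DifferentiableAt ℝ t z ∧
      ∀ u, fderiv ℝ t z u = (Θ z * u).re) :
    ∃ (E : ℂ → ℂ) (κ c : ℝ), ∀ z ∈ puncturedDisc (Real.exp (-2 * Real.pi * C)),
      HasDerivAt E (E z * (κ / z - Θ z)) z ∧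
        ‖E z‖ = Real.exp (c - t z + κ * Real.log ‖z‖) := by
  set Ω := puncturedDisc (Real.exp (-2 * Real.pi * C)) with hΩ
  set S : Set ℂ := {ξ | C < ξ.im} with hS
  have hSo : IsOpen S := isOpen_halfPlane C
  have hSc : Convex ℝ S := convex_halfSpace_im_gt C
  have hmem : ∀ ξ ∈ S, qParam 1 ξ ∈ Ω := fun ξ hξ =>
    ⟨norm_pos_iff.mpr (qParam_ne_zero ξ), by
      have := (norm_qParam_lt_iff one_pos C ξ).mpr hξ
      rwa [div_one] at this⟩
  have hmem' : ∀ z ∈ Ω, invQParam 1 z ∈ S := fun z hz =>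
    (mem_puncturedDisc_iff (ne_zero_of_mem_puncturedDisc hz)).mp hz
  have hshift : ∀ ξ ∈ S, ξ + 1 ∈ S := fun ξ hξ => by simpa [hS] using hξ
  -- `k dξ` is the pullback of `Θ dz` to the half plane by `z = exp (2πiξ)`, and `K` its primitive.
  set k : ℂ → ℂ := fun ξ => Θ (qParam 1 ξ) * (qParam 1 ξ * (2 * Real.pi * I)) with hk
  have hkd : DifferentiableOn ℂ k S := fun ξ hξ =>
    ((((hΘ.differentiableAt ((isOpen_puncturedDisc _).mem_nhds (hmem ξ hξ))).comp ξ
      (hasDerivAt_qParam ξ).differentiableAt)).mul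
        ((hasDerivAt_qParam ξ).differentiableAt.mul_const _)).differentiableWithinAt
  obtain ⟨K, hK'⟩ := hSc.exists_forall_hasDerivWithinAt hkd
  have hK : ∀ ξ ∈ S, HasDerivAt K (k ξ) ξ := fun ξ hξ => (hK' ξ hξ).hasDerivAt (hSo.mem_nhds hξ)
  -- The real part of the primitive is `t`, up to a constant.
  obtain ⟨c, hc⟩ : ∃ c : ℝ, ∀ ξ ∈ S, (K ξ).re = t (qParam 1 ξ) - c := by
    have hder : ∀ ξ ∈ S, HasFDerivAt (fun ξ => t (qParam 1 ξ) - (K ξ).re) (0 : ℂ →L[ℝ] ℝ) ξ := by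
      intro ξ hξ
      obtain ⟨h1, h2⟩ := ht _ (hmem ξ hξ)
      have h3 := (hasDerivAt_qParam ξ).hasFDerivAt.restrictScalars ℝ
      have h4 := (hK ξ hξ).hasFDerivAt.restrictScalars ℝ
      have h5 : HasFDerivAt (fun ξ => t (qParam 1 ξ) - (K ξ).re) _ ξ :=
        (HasFDerivAt.comp (g := t) ξ h1.hasFDerivAt h3).sub (reCLM.hasFDerivAt.comp ξ h4)
      refine h5.congr_fderiv ?_
      ext u
      simp only [_root_.sub_apply, ContinuousLinearMap.comp_apply, h2]
      simp [hk]
      ring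
    have hξ₀ : ((C + 1 : ℝ) * I : ℂ) ∈ S := by simp [hS]
    refine ⟨t (qParam 1 ((C + 1 : ℝ) * I)) - (K ((C + 1 : ℝ) * I)).re, fun ξ hξ => ?_⟩
    have := hSc.is_const_of_fderivWithin_eq_zero (𝕜 := ℝ)
      (fun ξ hξ => (hder ξ hξ).differentiableAt.differentiableWithinAt)
      (fun ξ hξ => by rw [fderivWithin_of_isOpen hSo hξ, (hder ξ hξ).fderiv]) hξ hξ₀
    linarith
  -- The period of the primitive is imaginary, as `t` is single valued; `exp (2πiκξ)` compensates it.
  obtain ⟨c₀, hc₀⟩ : ∃ c₀ : ℂ, ∀ ξ ∈ S, K (ξ + 1) = K ξ + c₀ := by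
    have hder : ∀ ξ ∈ S, HasDerivAt (fun ξ => K (ξ + 1) - K ξ) 0 ξ := by
      intro ξ hξ
      have h1 := (hK _ (hshift ξ hξ)).comp_add_const ξ 1
      have h2 : k (ξ + 1) = k ξ := by simp only [hk, qParam_add_one]
      rw [h2] at h1
      have h3 := h1.sub (hK ξ hξ)
      rw [sub_self] at h3
      exact h3
    have hξ₀ : ((C + 1 : ℝ) * I : ℂ) ∈ S := by simp [hS]
    refine ⟨K ((C + 1 : ℝ) * I + 1) - K ((C + 1 : ℝ) * I), fun ξ hξ => ?_⟩
    have := hSc.is_const_of_fderivWithin_eq_zero (𝕜 := ℂ)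
      (fun ξ hξ => (hder ξ hξ).differentiableAt.differentiableWithinAt)
      (fun ξ hξ => by
        rw [fderivWithin_of_isOpen hSo hξ, (hder ξ hξ).hasFDerivAt.fderiv]; ext; simp) hξ hξ₀
    rw [← this]; ring
  have hc₀re : c₀.re = 0 := by
    have hξ₀ : ((C + 1 : ℝ) * I : ℂ) ∈ S := by simp [hS]
    have h1 := congrArg re (hc₀ _ hξ₀)
    rw [add_re, hc _ (hshift _ hξ₀), hc _ hξ₀, qParam_add_one] at h1
    linarith
  have hc₀I : c₀ = c₀.im * I := by
    apply Complex.ext <;> simp [hc₀re]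
  set κ := c₀.im / (2 * Real.pi) with hκ
  have hκπ : c₀.im = 2 * Real.pi * κ := by
    rw [hκ, mul_div_cancel₀ _ Real.two_pi_pos.ne']
  set E₀ : ℂ → ℂ := fun ξ => exp (2 * Real.pi * κ * I * ξ - K ξ) with hE₀
  have hE₀d : ∀ ξ ∈ S, HasDerivAt E₀ (E₀ ξ * (2 * Real.pi * κ * I - k ξ)) ξ := fun ξ hξ =>
    (((hasDerivAt_id ξ).const_mul _).sub (hK ξ hξ)).cexp.congr_deriv (by rw [mul_one]; rfl)
  have hE₀p : ∀ (j : ℤ), ∀ ξ ∈ S, E₀ (ξ + j) = E₀ ξ := by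
    intro j ξ hξ
    have h1 := apply_add_int_mul (f := E₀) (L := 1) (Λ := 0) (y₀ := C) (fun ξ hξ => by
      simp only [hE₀, ofReal_one]
      rw [hc₀ ξ hξ, hc₀I, hκπ, add_zero]
      congr 1
      push_cast
      ring) j ξ hξ
    simpa using h1
  refine ⟨fun z => E₀ (invQParam 1 z), κ, c, fun z hz => ⟨?_, ?_⟩⟩
  · have hz0 := ne_zero_of_mem_puncturedDisc hz
    have h1 := (hE₀d _ (hmem' z hz))
    rw [← localQLog_self hz0] at h1
    have h2 := h1.comp z (hasDerivAt_localQLog hz0)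
    have h3 : (fun z => E₀ (invQParam 1 z)) =ᶠ[𝓝 z] E₀ ∘ localQLog z := by
      filter_upwards [eventually_im_localQLog hz0 (hmem' z hz), isOpen_ne.mem_nhds hz0] with
        z' h4 h5
      obtain ⟨j, hj⟩ := exists_localQLog_eq hz0 h5
      rw [Function.comp_apply, hj, hE₀p j _ h4]
    refine (h2.congr_of_eventuallyEq h3).congr_deriv ?_
    rw [localQLog_self hz0]
    simp only [hk]
    rw [qParam_right_inv one_ne_zero hz0]
    have := two_pi_I_ne_zero
    have hπ : (Real.pi : ℂ) ≠ 0 := by exact_mod_cast Real.pi_ne_zero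
    have hI := I_ne_zero
    field_simp
  · have hz0 := ne_zero_of_mem_puncturedDisc hz
    have h1 := hc _ (hmem' z hz)
    rw [qParam_right_inv one_ne_zero hz0] at h1
    have h2 := im_invQParam 1 z
    have h3 : (2 * Real.pi * κ * I * invQParam 1 z - K (invQParam 1 z)).re =
        c - t z + κ * Real.log ‖z‖ := by
      rw [sub_re, h1]
      have h4 : (2 * Real.pi * κ * I * invQParam 1 z).re =
          -(2 * Real.pi * κ) * (invQParam 1 z).im := by simp
      rw [h4, h2]
      have := Real.pi_pos.ne'
      field_simp
      ring
    simp only [hE₀]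
    rw [norm_exp, h3]

/-- If `t = Re ∫ Θ dz` is a single valued function that tends to `+∞` at the puncture, then `Θ` has
a simple pole there: `exp (-t) |z| ^ κ` is the modulus of a meromorphic function, so that `t`
grows logarithmically. -/
theorem exists_simple_pole {r : ℝ} (hr : 0 < r) (hΘ : DifferentiableOn ℂ Θ (puncturedDisc r))
    (ht : ∀ z ∈ puncturedDisc r, DifferentiableAt ℝ t z ∧ ∀ u, fderiv ℝ t z u = (Θ z * u).re)
    (htop : Filter.Tendsto t (𝓝[≠] 0) Filter.atTop) :
    ∃ S : ℂ → ℂ, AnalyticAt ℂ S 0 ∧ S 0 ≠ 0 ∧ ∀ᶠ z in 𝓝[≠] 0, Θ z = S z / z := by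
  obtain ⟨C, rfl⟩ : ∃ C, r = Real.exp (-2 * Real.pi * C) :=
    ⟨-Real.log r / (2 * Real.pi), by
      rw [show -2 * Real.pi * (-Real.log r / (2 * Real.pi)) = Real.log r by
        have := Real.pi_pos.ne'; field_simp, Real.exp_log hr]⟩
  obtain ⟨E, κ, c, hE⟩ := exists_exp_primitive hΘ ht
  set Ω := puncturedDisc (Real.exp (-2 * Real.pi * C)) with hΩ
  have hΩe : ∀ᶠ z in 𝓝[≠] (0 : ℂ), z ∈ Ω := by
    filter_upwards [self_mem_nhdsWithin, mem_nhdsWithin_of_mem_nhds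
      (Metric.ball_mem_nhds (0 : ℂ) hr)] with z h1 h2
    exact ⟨norm_pos_iff.mpr h1, by simpa using h2⟩
  -- `z ^ m E` is bounded near the puncture, as `|E| ≤ const |z| ^ κ` there.
  obtain ⟨m, hm⟩ := exists_nat_ge (-κ)
  obtain ⟨G, hG, hEG⟩ := exists_analyticAt_of_bounded (f := fun z => z ^ m * E z)
    (B := Real.exp c)
    (hΩe.mono fun z hz => (differentiableAt_id.pow m).mul (hE z hz).1.differentiableAt) (by
      filter_upwards [hΩe, htop (Filter.Ici_mem_atTop 0), mem_nhdsWithin_of_mem_nhds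
        (Metric.ball_mem_nhds (0 : ℂ) one_pos)] with z hz h1 h2
      have h3 : Real.log ‖z‖ ≤ 0 :=
        Real.log_nonpos (norm_nonneg _) (by simpa using (Metric.mem_ball.mp h2).le)
      rw [norm_mul, norm_pow, (hE z hz).2, ← Real.exp_log hz.1, ← Real.exp_nat_mul,
        ← Real.exp_add, Real.exp_log hz.1, Real.exp_le_exp]
      have h4 : (0 : ℝ) ≤ t z := h1
      nlinarith)
  have hmer : MeromorphicAt E 0 := by
    refine (((MeromorphicAt.id (0 : ℂ)).pow m).inv.mul hG.meromorphicAt).congr ?_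
    filter_upwards [hEG, self_mem_nhdsWithin] with z h1 h2
    simp only [Pi.mul_apply, Pi.inv_apply, Pi.pow_apply, id]
    rw [← h1, inv_mul_cancel_left₀ (pow_ne_zero m h2)]
  have hord : meromorphicOrderAt E 0 ≠ ⊤ := by
    rw [ne_eq, meromorphicOrderAt_eq_top_iff]
    intro h0
    obtain ⟨z, h1, h2⟩ := (h0.and hΩe).exists
    have h3 := (hE z h2).2
    rw [h1, norm_zero] at h3
    exact (Real.exp_pos _).ne h3
  obtain ⟨W, hW, hW0, hEW⟩ := (meromorphicOrderAt_ne_top_iff hmer).mp hord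
  -- `E = z ^ j W`, and comparing logarithmic derivatives gives `Θ = κ / z - j / z - W' / W`.
  set j := (meromorphicOrderAt E 0).untop₀ with hj
  simp only [sub_zero, smul_eq_mul] at hEW
  have hWe : ∀ᶠ z in 𝓝 (0 : ℂ), AnalyticAt ℂ W z ∧ W z ≠ 0 :=
    hW.eventually_analyticAt.and (hW.continuousAt.eventually_ne hW0)
  refine ⟨fun z => (κ - j) - z * (deriv W z / W z),
    analyticAt_const.sub (analyticAt_id.mul (hW.deriv.div hW hW0)), ?_, ?_⟩
  · -- If the residue vanished, then `t` would be bounded near the puncture.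
    simp only [zero_mul, sub_zero]
    intro h0
    have hκj : κ = j := by
      have : (κ : ℂ) = ((j : ℝ) : ℂ) := by push_cast; exact sub_eq_zero.mp h0
      exact_mod_cast this
    have h1 : ∀ᶠ z in 𝓝[≠] (0 : ℂ), ‖W z‖ = Real.exp (c - t z) := by
      filter_upwards [hEW, hΩe] with z h2 h3
      have h4 := (hE z h3).2
      rw [h2, norm_mul, norm_zpow, Real.exp_add, hκj, mul_comm (j : ℝ), ← Real.rpow_def_of_pos h3.1,
        Real.rpow_intCast, mul_comm] at h4
      exact mul_right_cancel₀ (zpow_ne_zero j h3.1.ne') h4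
    have h2 : Filter.Tendsto (fun z => Real.exp (c - t z)) (𝓝[≠] (0 : ℂ)) (𝓝 0) :=
      Real.tendsto_exp_atBot.comp (Filter.tendsto_atBot_add_const_left _ c
        (Filter.tendsto_neg_atTop_atBot.comp htop))
    have h3 : Filter.Tendsto (fun z => ‖W z‖) (𝓝[≠] (0 : ℂ)) (𝓝 ‖W 0‖) :=
      hW.continuousAt.norm.tendsto.mono_left nhdsWithin_le_nhds
    have h4 := tendsto_nhds_unique (h3.congr' h1) h2
    exact hW0 (norm_eq_zero.mp h4)
  · have hEW' := eventually_eventually_nhdsWithin.mpr hEW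
    filter_upwards [hEW', hEW, hΩe, self_mem_nhdsWithin, mem_nhdsWithin_of_mem_nhds hWe] with
      z h1 h2 h3 h4 h5
    have h4' : z ≠ 0 := h4
    have h6 : E =ᶠ[𝓝 z] fun z => z ^ j * W z := by
      rwa [isOpen_compl_singleton.nhdsWithin_eq h4] at h1
    have h7 := ((hasDerivAt_zpow j z (Or.inl h4')).mul
      h5.1.differentiableAt.hasDerivAt).congr_of_eventuallyEq h6
    have h8 := h7.unique (hE z h3).1
    rw [h2, zpow_sub_one₀ h4'] at h8
    have h9 := zpow_ne_zero j h4'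
    have h10 := h5.2
    field_simp at h8 ⊢
    linear_combination h8

end Pole

/-! ### The form at a puncture -/

section Residue

open Complex Set

/-- A complex null vector spanning a spacelike plane is not orthogonal to a spacelike vector. -/
theorem clor_ne_zero {c : Fin 3 → ℂ} (hnull : c 0 ^ 2 + c 1 ^ 2 - c 2 ^ 2 = 0)
    (hpos : 0 < normSq (c 0) + normSq (c 1) - normSq (c 2)) {b : L3} (hb : 0 < lor b b) :
    c 0 * b 0 + c 1 * b 1 - c 2 * b 2 ≠ 0 := by
  intro h0
  set u : L3 := fun j => (c j).re with hu
  set w : L3 := fun j => (c j).im with hw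
  have hre := congrArg re hnull
  have him := congrArg im hnull
  simp only [pow_two, sub_re, add_re, mul_re, sub_im, add_im, mul_im, zero_re, zero_im] at hre him
  simp only [normSq_apply] at hpos
  have huw : lor u w = 0 := by simp only [lor, hu, hw]; linarith
  have huu : lor u u = lor w w := by simp only [lor, hu, hw]; linarith
  have hH : 0 < lor u u := by simp only [lor, hu, hw] at huu ⊢; linarith
  have hbu : lor b u = 0 := by
    have := congrArg re h0
    simp at this
    simp only [lor, hu]; linarith
  have hbw : lor b w = 0 := by
    have := congrArg im h0
    simp at this
    simp only [lor, hw]; linarith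
  have hs : √(lor u u) ≠ 0 := (Real.sqrt_pos.mpr hH).ne'
  have hn : ∀ x, lor x x = lor u u → lor ((√(lor u u))⁻¹ • x) ((√(lor u u))⁻¹ • x) = 1 := by
    intro x hx
    rw [lor_smul_left, lor_smul_right, hx, ← mul_assoc, ← mul_inv, Real.mul_self_sqrt hH.le,
      inv_mul_cancel₀ hH.ne']
  have hf := LorFrame.of_spacelike (hn u rfl) (hn w huu.symm) (by
    rw [lor_smul_left, lor_smul_right, huw]; simp)
  have h1 := hf.lor_eq b b
  simp only [lor_smul_right, hbu, hbw] at h1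
  nlinarith [sq_nonneg (lor b (cross ((√(lor u u))⁻¹ • u) ((√(lor u u))⁻¹ • w)))]

/-- The null vector `(i (1 - g²) / 2, -(1 + g²) / 2, g)` of the Weierstrass representation. -/
def weierstrassVec (g : ℂ) : Fin 3 → ℂ := ![I / 2 * (1 - g ^ 2), -(1 / 2) * (1 + g ^ 2), g]

theorem weierstrassVec_null (g : ℂ) :
    weierstrassVec g 0 ^ 2 + weierstrassVec g 1 ^ 2 - weierstrassVec g 2 ^ 2 = 0 := by
  simp only [weierstrassVec, Matrix.cons_val]
  linear_combination (1 / 4) * (1 - g ^ 2) ^ 2 * I_sq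

theorem weierstrassVec_pos {g : ℂ} (hg : ‖g‖ < 1) : 0 < normSq (weierstrassVec g 0)
    + normSq (weierstrassVec g 1) - normSq (weierstrassVec g 2) := by
  have h1 : normSq (weierstrassVec g 0) + normSq (weierstrassVec g 1)
      - normSq (weierstrassVec g 2) = (1 - normSq g) ^ 2 / 2 := by
    simp only [weierstrassVec, Matrix.cons_val, pow_two]
    simp [normSq_apply]
    ring
  rw [h1]
  have h2 : normSq g < 1 := by
    rw [normSq_eq_norm_sq]; exact pow_lt_one₀ (norm_nonneg _) hg two_ne_zero
  have h3 : 0 < 1 - normSq g := sub_pos.mpr h2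
  positivity

theorem analyticAt_weierstrassVec {g : ℂ → ℂ} (hg : AnalyticAt ℂ g 0) (j : Fin 3) :
    AnalyticAt ℂ (fun z => weierstrassVec (g z) j) 0 := by
  fin_cases j
  · exact analyticAt_const.mul (analyticAt_const.sub (hg.pow 2))
  · exact analyticAt_const.mul (analyticAt_const.add (hg.pow 2))
  · exact hg

variable {M : Type*} [TopologicalSpace M] {v : L3} {X : M → Quo v} {F : Set M} {Ω : Set ℂ}
  {ψ : ℂ → M} {H : ℂ → ℝ} {Φ : Fin 3 → ℂ → ℂ}

theorem fderiv_apply_eq_of_phi {f : ℂ → L3} {z : ℂ} {c : Fin 3 → ℂ} (h : ∀ j, phi f z j = c j)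
    (u : ℂ) (j : Fin 3) : fderiv ℝ f z u j = (c j * u).re := by
  have h1 : u = u.re • (1 : ℂ) + u.im • I := by simp [re_add_im]
  rw [← h j, phi]
  conv_lhs => rw [h1, map_add, map_smul, map_smul]
  simp
  ring

omit [TopologicalSpace M] in
/-- The differential of the axial coordinate of the surface. -/
theorem IsHolomorphicForm.hasFDerivAt_quoCoord (hΦ : IsHolomorphicForm v X Ω ψ Φ) {b : L3}
    (hb : lor v b = 0) {z : ℂ} (hz : z ∈ Ω) :
    DifferentiableAt ℝ (fun z => quoCoord v b hb (X (ψ z))) z ∧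
      ∀ u, fderiv ℝ (fun z => quoCoord v b hb (X (ψ z))) z u =
        ((Φ 0 z * b 0 + Φ 1 z * b 1 - Φ 2 z * b 2) * u).re := by
  obtain ⟨U, f, hzU, hf⟩ := hΦ.exists_lift z hz
  obtain ⟨hd, hphi⟩ := hΦ.phi_eq U f hf z hzU hz
  have h1 : (fun z => quoCoord v b hb (X (ψ z))) =ᶠ[𝓝 z] fun z => lorL b (f z) := by
    filter_upwards [hf.isOpen.mem_nhds hzU] with z' hz'
    have h2 := hf.lifts z' hz'
    rw [Function.comp_apply] at h2
    rw [← h2, quoCoord_toQuo, lorL_apply]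
  have h2 : HasFDerivAt (fun z => quoCoord v b hb (X (ψ z))) ((lorL b).comp (fderiv ℝ f z)) z :=
    ((lorL b).hasFDerivAt.comp z hd.hasFDerivAt).congr_of_eventuallyEq h1
  refine ⟨h2.differentiableAt, fun u => ?_⟩
  rw [h2.fderiv, ContinuousLinearMap.comp_apply, lorL_apply, lor]
  simp only [fderiv_apply_eq_of_phi hphi]
  simp
  ring

omit [TopologicalSpace M] in
/-- At a puncture where the axial coordinate tends to `+∞`, the holomorphic form of a maximal
surface has simple poles, and so does `η`. The coefficients of the leading term are a complex null
vector which spans a spacelike plane. -/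
theorem IsWeierstrassData.exists_residue {r : ℝ} (hr : 0 < r) {g φ₃ η : ℂ → ℂ}
    (hΦ : IsHolomorphicForm v X (puncturedDisc r) ψ Φ)
    (hW : IsWeierstrassData v X (puncturedDisc r) ψ g φ₃ η) {b : L3} (hb : lor v b = 0)
    (hbb : 0 < lor b b)
    (htop : Filter.Tendsto (fun z => quoCoord v b hb (X (ψ z))) (𝓝[≠] 0) Filter.atTop) :
    HasSimplePole η ∧ ∃ V : Fin 3 → ℂ → ℂ, (∀ j, AnalyticAt ℂ (V j) 0) ∧
      (∀ᶠ z in 𝓝[≠] 0, ∀ j, Φ j z = V j z / z) ∧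
      V 0 0 ^ 2 + V 1 0 ^ 2 - V 2 0 ^ 2 = 0 ∧
      0 < normSq (V 0 0) + normSq (V 1 0) - normSq (V 2 0) := by
  set Ω := puncturedDisc r with hΩ
  have hΩe : ∀ᶠ z in 𝓝[≠] (0 : ℂ), z ∈ Ω := by
    filter_upwards [self_mem_nhdsWithin, mem_nhdsWithin_of_mem_nhds
      (Metric.ball_mem_nhds (0 : ℂ) hr)] with z h1 h2
    exact ⟨norm_pos_iff.mpr h1, by simpa using h2⟩
  have hΦg : ∀ z ∈ Ω, ∀ j, Φ j z = weierstrassVec (g z) j * η z := by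
    intro z hz
    obtain ⟨U, f, hzU, hf, -, h0, h1, h2⟩ := hW.phi_eq z hz
    have h3 := (hΦ.phi_eq U f hf z hzU hz).2
    rw [h3, hW.form_eq z hz] at h0 h1 h2
    intro j
    fin_cases j
    · simp [weierstrassVec, h0]; ring
    · simp [weierstrassVec, h1]; ring
    · simp [weierstrassVec, h2]
  have hη : ∀ z ∈ Ω, η z ≠ 0 := by
    intro z hz h0
    have := hΦ.pos z hz
    simp [hΦg z hz, h0] at this
  have hgeq : ∀ z ∈ Ω, g z = Φ 2 z / (-I * (Φ 0 z - I * Φ 1 z)) := by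
    intro z hz
    have h1 : -I * (Φ 0 z - I * Φ 1 z) = η z := by
      simp only [hΦg z hz, weierstrassVec, Matrix.cons_val]
      linear_combination (-η z) * I_sq
    rw [h1, hΦg z hz]
    exact (mul_div_cancel_right₀ _ (hη z hz)).symm
  have hΦd : ∀ z ∈ Ω, ∀ j, DifferentiableAt ℂ (Φ j) z := fun z hz j =>
    (hΦ.differentiableOn j).differentiableAt (hΦ.isOpen.mem_nhds hz)
  have hgd : ∀ z ∈ Ω, DifferentiableAt ℂ g z := by
    intro z hz
    have h1 : DifferentiableAt ℂ (fun z => Φ 2 z / (-I * (Φ 0 z - I * Φ 1 z))) z := by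
      refine (hΦd z hz 2).div (((hΦd z hz 0).sub ((hΦd z hz 1).const_mul I)).const_mul (-I)) ?_
      have h1 : -I * (Φ 0 z - I * Φ 1 z) = η z := by
        simp only [hΦg z hz, weierstrassVec, Matrix.cons_val]
        linear_combination (-η z) * I_sq
      rw [h1]; exact hη z hz
    refine h1.congr_of_eventuallyEq ?_
    filter_upwards [hΦ.isOpen.mem_nhds hz] with z' hz' using hgeq z' hz'
  obtain ⟨G, hG, hgG⟩ := exists_analyticAt_of_bounded (B := 1) (hΩe.mono hgd)
    (hΩe.mono fun z hz => (hW.norm_lt_one z hz).le)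
  -- By the maximum principle the extension of `g` takes its value at the puncture in the disc.
  have hG0 : ‖G 0‖ < 1 := by
    have hle : ‖G 0‖ ≤ 1 := by
      have h0 : Filter.Tendsto (fun z => ‖G z‖) (𝓝[≠] 0) (𝓝 ‖G 0‖) :=
        hG.continuousAt.norm.tendsto.mono_left nhdsWithin_le_nhds
      refine le_of_tendsto h0 ?_
      filter_upwards [hgG, hΩe] with z h1 h2
      rw [← h1]; exact (hW.norm_lt_one z h2).le
    refine lt_of_le_of_ne hle fun h1 => ?_
    have hmax : IsLocalMax (norm ∘ G) 0 := by
      have h2 : ∀ᶠ z in 𝓝[≠] (0 : ℂ), ‖G z‖ ≤ ‖G 0‖ := by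
        filter_upwards [hgG, hΩe] with z h3 h4
        rw [h1, ← h3]; exact (hW.norm_lt_one z h4).le
      rw [eventually_nhdsWithin_iff] at h2
      filter_upwards [h2] with z hz
      by_cases hz0 : z = 0
      · rw [hz0]
      · exact hz hz0
    have hconst := Complex.eventually_eq_of_isLocalMax_norm
      (hG.eventually_analyticAt.mono fun z hz => hz.differentiableAt) hmax
    obtain ⟨z, ⟨h2, h3⟩, h4⟩ := ((hgG.and hΩe).and
      (mem_nhdsWithin_of_mem_nhds hconst)).exists
    have h5 := hW.norm_lt_one z h3
    have h6 : G z = G 0 := h4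
    rw [h2, h6, h1] at h5
    exact lt_irrefl _ h5
  -- The axial component of the form is `Q (g) η`, and `Q` does not vanish on the disc.
  set Q : ℂ → ℂ := fun γ => weierstrassVec γ 0 * b 0 + weierstrassVec γ 1 * b 1
    - weierstrassVec γ 2 * b 2 with hQ
  have hQ0 : ∀ γ, ‖γ‖ < 1 → Q γ ≠ 0 := fun γ hγ =>
    clor_ne_zero (weierstrassVec_null γ) (weierstrassVec_pos hγ) hbb
  have hQG : AnalyticAt ℂ (fun z => Q (G z)) 0 :=
    (((analyticAt_weierstrassVec hG 0).mul analyticAt_const).add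
      ((analyticAt_weierstrassVec hG 1).mul analyticAt_const)).sub
      ((analyticAt_weierstrassVec hG 2).mul analyticAt_const)
  obtain ⟨S, hS, hS0, hΘS⟩ := exists_simple_pole
    (Θ := fun z => Φ 0 z * b 0 + Φ 1 z * b 1 - Φ 2 z * b 2) hr
    ((((hΦ.differentiableOn 0).mul_const _).add ((hΦ.differentiableOn 1).mul_const _)).sub
      ((hΦ.differentiableOn 2).mul_const _))
    (fun z hz => hΦ.hasFDerivAt_quoCoord hb hz) htop
  set T : ℂ → ℂ := fun z => S z / Q (G z) with hT
  have hTa : AnalyticAt ℂ T 0 := hS.div hQG (hQ0 _ hG0)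
  have hT0 : T 0 ≠ 0 := div_ne_zero hS0 (hQ0 _ hG0)
  have hηT : ∀ᶠ z in 𝓝[≠] (0 : ℂ), η z = T z / z := by
    filter_upwards [hgG, hΩe, hΘS] with z h1 h2 h3
    have h4 : Q (G z) * η z = S z / z := by
      rw [← h3, ← h1]
      simp only [hQ, hΦg z h2]
      ring
    rw [hT]
    simp only
    rw [div_right_comm, ← h4, mul_div_cancel_left₀]
    rw [← h1]; exact hQ0 _ (hW.norm_lt_one z h2)
  have hηm : MeromorphicAt η 0 :=
    (hTa.meromorphicAt.div (MeromorphicAt.id 0)).congr (by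
      filter_upwards [hηT] with z hz using hz.symm)
  refine ⟨⟨hηm, (meromorphicOrderAt_eq_int_iff hηm).mpr ⟨T, hTa, hT0, ?_⟩⟩,
    fun j z => weierstrassVec (G z) j * T z,
    fun j => (analyticAt_weierstrassVec hG j).mul hTa, ?_, ?_, ?_⟩
  · filter_upwards [hηT] with z hz
    rw [hz, sub_zero, zpow_neg_one, smul_eq_mul, div_eq_inv_mul]
  · filter_upwards [hηT, hgG, hΩe] with z h1 h2 h3 j
    rw [hΦg z h3, h1, h2, mul_div_assoc]
  · linear_combination T 0 ^ 2 * weierstrassVec_null (G 0)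
  · have h1 := mul_pos (weierstrassVec_pos hG0) (normSq_pos.mpr hT0)
    simp only [map_mul]
    linarith

end Residue

/-! ### Asymptotics at a puncture -/

section Asymptotics

open Complex Set Metric

variable {M : Type*} [TopologicalSpace M] {v : L3} {X : M → Quo v} {F : Set M}
  {ψ : ℂ → M} {Φ : Fin 3 → ℂ → ℂ}

omit [TopologicalSpace M] in
/-- Integration of the holomorphic form: in the logarithmic coordinate the surface is the sum of a
linear map, given by the residues, and of a smooth function of `z` vanishing at the puncture. -/
theorem IsHolomorphicForm.exists_expansion {r : ℝ} (hr : 0 < r)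
    (hΦ : IsHolomorphicForm v X (puncturedDisc r) ψ Φ) {V : Fin 3 → ℂ → ℂ}
    (hV : ∀ j, AnalyticAt ℂ (V j) 0) (hΦV : ∀ᶠ z in 𝓝[≠] 0, ∀ j, Φ j z = V j z / z) :
    ∃ (ρ : ℝ) (R : ℂ → L3) (x₀ : L3), 0 < ρ ∧ ρ ≤ r ∧ R 0 = 0 ∧ ContDiffAt ℝ ∞ R 0 ∧
      ∀ ζ : ℂ, exp ζ ∈ ball 0 ρ →
        X (ψ (exp ζ)) = toQuo v (x₀ + ((fun j => (V j 0 * ζ).re) + R (exp ζ))) := by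
  obtain ⟨ρ₁, hρ₁, hρV⟩ := Metric.eventually_nhds_iff_ball.mp
    ((Filter.eventually_all.mpr fun j => (hV j).eventually_analyticAt).and
      (eventually_nhdsWithin_iff.mp hΦV))
  set ρ := min ρ₁ r with hρ
  have hρ0 : 0 < ρ := lt_min hρ₁ hr
  have hsub : ball (0 : ℂ) ρ ⊆ ball 0 ρ₁ := ball_subset_ball (min_le_left _ _)
  -- A primitive of the holomorphic part `(V j z - V j 0) / z` of `Φ j`.
  have hprim : ∀ j, ∃ h : ℂ → ℂ, h 0 = 0 ∧ ∀ z ∈ ball (0 : ℂ) ρ,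
      HasDerivAt h (dslope (V j) 0 z) z := by
    intro j
    have h1 : DifferentiableOn ℂ (V j) (ball 0 ρ) := fun z hz =>
      ((hρV z (hsub hz)).1 j).differentiableAt.differentiableWithinAt
    obtain ⟨h, hh⟩ := ((Complex.differentiableOn_dslope (ball_mem_nhds 0 hρ0)).mpr
      h1).isExactOn_ball
    exact ⟨fun z => h z - h 0, sub_self _, fun z hz => (hh z hz).sub_const _⟩
  choose h hh0 hh using hprim
  set R : ℂ → L3 := fun z j => (h j z).re with hR
  have hRsm : ContDiffAt ℝ ∞ R 0 := by
    refine contDiffAt_pi.mpr fun j => ?_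
    have h1 : AnalyticAt ℂ (h j) 0 := DifferentiableOn.analyticAt
      (fun z hz => (hh j z hz).differentiableAt.differentiableWithinAt) (ball_mem_nhds 0 hρ0)
    exact reCLM.contDiff.contDiffAt.comp 0 (h1.contDiffAt.restrict_scalars ℝ)
  set G : ℂ → L3 := fun ζ => (fun j => (V j 0 * ζ).re) + R (exp ζ) with hG
  set S : Set ℂ := {ζ | exp ζ ∈ ball (0 : ℂ) ρ} with hS
  have hSo : IsOpen S := isOpen_ball.preimage continuous_exp
  have hSc : IsPreconnected S := by
    have h1 : S = {ζ | ζ.re < Real.log ρ} := by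
      ext ζ
      simp only [hS, mem_ofPred_eq, mem_ball_zero_iff, norm_exp]
      rw [Real.lt_log_iff_exp_lt hρ0]
    rw [h1]
    exact (convex_halfSpace_re_lt _).isPreconnected
  have hmem : ∀ ζ ∈ S, exp ζ ∈ puncturedDisc r := fun ζ hζ =>
    ⟨norm_pos_iff.mpr (exp_ne_zero ζ),
      (mem_ball_zero_iff.mp hζ).trans_le (min_le_right _ _)⟩
  have hGd : ∀ ζ ∈ S, HasFDerivAt G (ContinuousLinearMap.pi fun j => reCLM.comp
      ((ContinuousLinearMap.toSpanSingleton ℂ (V j (exp ζ))).restrictScalars ℝ)) ζ := by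
    intro ζ hζ
    refine hasFDerivAt_pi.mpr fun j => ?_
    have h1 : HasDerivAt (fun ζ => V j 0 * ζ + h j (exp ζ)) (V j (exp ζ)) ζ := by
      have h2 := ((hasDerivAt_id ζ).const_mul (V j 0)).add
        ((hh j _ hζ).comp ζ (hasDerivAt_exp ζ))
      refine h2.congr_deriv ?_
      have h3 := sub_smul_dslope (V j) 0 (exp ζ)
      rw [sub_zero, smul_eq_mul] at h3
      rw [mul_comm (dslope _ _ _), h3]; ring
    exact reCLM.hasFDerivAt.comp ζ (h1.hasFDerivAt.restrictScalars ℝ)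
  -- The surface and `G` differ locally by a translation.
  have hloc : ∀ ζ ∈ S, ∀ᶠ ζ' in 𝓝 ζ,
      X (ψ (exp ζ')) - toQuo v (G ζ') = X (ψ (exp ζ)) - toQuo v (G ζ) := by
    intro ζ hζ
    obtain ⟨U, f, hzU, hf⟩ := hΦ.exists_lift _ (hmem ζ hζ)
    have hO : IsOpen (exp ⁻¹' U ∩ S) := (hf.isOpen.preimage continuous_exp).inter hSo
    obtain ⟨δ, hδ, hδs⟩ := Metric.isOpen_iff.mp hO ζ ⟨hzU, hζ⟩
    have hder : ∀ ζ' ∈ ball ζ δ, HasFDerivAt (fun ζ => f (exp ζ) - G ζ) (0 : ℂ →L[ℝ] L3) ζ' := by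
      intro ζ' hζ'
      obtain ⟨h1, h2⟩ := hδs hζ'
      obtain ⟨hd, hphi⟩ := hΦ.phi_eq U f hf _ h1 (hmem ζ' h2)
      have h3 : HasFDerivAt (fun ζ => f (exp ζ) - G ζ) _ ζ' :=
        (HasFDerivAt.comp (g := f) ζ' hd.hasFDerivAt
          ((hasDerivAt_exp ζ').hasFDerivAt.restrictScalars ℝ)).sub (hGd ζ' h2)
      refine h3.congr_fderiv ?_
      ext u j
      have h4 := (hρV _ (hsub h2)).2 (exp_ne_zero ζ') j
      simp only [_root_.sub_apply, Pi.sub_apply, ContinuousLinearMap.comp_apply,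
        fderiv_apply_eq_of_phi hphi, ContinuousLinearMap.pi_apply, h4]
      have h5 : V j (exp ζ') / exp ζ' * (u * exp ζ') = u * V j (exp ζ') := by
        field_simp [exp_ne_zero ζ']
      simp only [ContinuousLinearMap.coe_restrictScalars',
        ContinuousLinearMap.toSpanSingleton_apply, smul_eq_mul, h5, reCLM_apply, sub_self]
      rfl
    filter_upwards [ball_mem_nhds ζ hδ] with ζ' hζ'
    have h1 := (convex_ball ζ δ).is_const_of_fderivWithin_eq_zero (𝕜 := ℝ)
      (fun ξ hξ => (hder ξ hξ).differentiableAt.differentiableWithinAt)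
      (fun ξ hξ => by rw [fderivWithin_of_isOpen isOpen_ball hξ, (hder ξ hξ).fderiv])
      hζ' (mem_ball_self hδ)
    have h2 : ∀ ξ ∈ ball ζ δ, X (ψ (exp ξ)) - toQuo v (G ξ) = toQuo v (f (exp ξ) - G ξ) := by
      intro ξ hξ
      have h3 := hf.lifts _ (hδs hξ).1
      rw [Function.comp_apply] at h3
      rw [← h3]; rfl
    rw [h2 _ hζ', h2 _ (mem_ball_self hδ)]
    exact congrArg _ h1
  obtain ⟨ζ₀, hζ₀⟩ : S.Nonempty := ⟨(Real.log (ρ / 2) : ℝ), by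
    rw [hS, mem_ofPred_eq, mem_ball_zero_iff, norm_exp, ofReal_re, Real.exp_log (half_pos hρ0)]
    exact half_lt_self hρ0⟩
  obtain ⟨x₀, hx₀⟩ : ∃ x₀, toQuo v x₀ = X (ψ (exp ζ₀)) - toQuo v (G ζ₀) :=
    QuotientAddGroup.mk_surjective _
  refine ⟨ρ, R, x₀, hρ0, min_le_right _ _, ?_, hRsm, fun ζ hζ => ?_⟩
  · ext j; simp [hR, hh0]
  · have h1 := hSc.induction₂ (fun ζ ζ' => X (ψ (exp ζ)) - toQuo v (G ζ) =
      X (ψ (exp ζ')) - toQuo v (G ζ')) (fun x hx => by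
        filter_upwards [mem_nhdsWithin_of_mem_nhds (hloc x hx)] with y hy using hy.symm)
      (fun _ _ _ _ _ _ h1 h2 => h1.trans h2) (fun _ _ _ _ h => h.symm) hζ hζ₀
    rw [toQuo_add, hx₀, ← h1, sub_add_cancel]

/-- The residues of the holomorphic form: the period of the surface around the puncture is a
nonzero multiple of `v`, and the real part of the residue is orthogonal to it. -/
theorem exists_residue_eq (hv : 0 < lor v v) {ρ : ℝ} (hρ : 0 < ρ) {R : ℂ → L3} {x₀ : L3}
    {c : Fin 3 → ℂ} {Y : ℂ → Quo v}
    (hY : ∀ ζ : ℂ, exp ζ ∈ ball 0 ρ →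
      Y (exp ζ) = toQuo v (x₀ + ((fun j => (c j * ζ).re) + R (exp ζ))))
    (hnull : c 0 ^ 2 + c 1 ^ 2 - c 2 ^ 2 = 0)
    (hpos : 0 < normSq (c 0) + normSq (c 1) - normSq (c 2)) :
    ∃ (k : ℤ) (α : ℝ) (e n : L3), k ≠ 0 ∧ 0 < α ∧
      LorFrame ((√(lor v v))⁻¹ • v) e n ∧
      ∀ ζ : ℂ, (fun j => (c j * ζ).re) =
        (-α * ζ.re) • e + (k / (2 * Real.pi) * ζ.im) • v := by
  set A : L3 := fun j => (c j).re with hA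
  set B : L3 := fun j => (c j).im with hB
  have hlin : ∀ ζ : ℂ, (fun j => (c j * ζ).re) = ζ.re • A - ζ.im • B := by
    intro ζ; ext j; simp [hA, hB]; ring
  -- Both `ζ` and `ζ + 2πi` represent the same point, so that `-2π B` is a period.
  obtain ⟨k, hk⟩ : ∃ k : ℤ, B = (-(k / (2 * Real.pi)) : ℝ) • v := by
    have h1 : exp (Real.log (ρ / 2) : ℝ) ∈ ball (0 : ℂ) ρ := by
      rw [mem_ball_zero_iff, norm_exp, ofReal_re, Real.exp_log (half_pos hρ)]
      exact half_lt_self hρ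
    have hexp : exp ((Real.log (ρ / 2) : ℝ) + 2 * Real.pi * I) = exp (Real.log (ρ / 2) : ℝ) := by
      rw [exp_add, exp_two_pi_mul_I, mul_one]
    have h2 := hY _ h1
    have h3 := hY ((Real.log (ρ / 2) : ℝ) + 2 * Real.pi * I) (by rw [hexp]; exact h1)
    rw [hexp, h2] at h3
    obtain ⟨k, hk⟩ := toQuo_eq_iff.mp h3
    refine ⟨k, ?_⟩
    rw [hlin, hlin] at hk
    ext j
    have h4 := congrFun hk j
    simp at h4
    have hπ := Real.pi_pos.ne'
    simp
    field_simp
    linarith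
  have hre := congrArg re hnull
  have him := congrArg im hnull
  simp only [pow_two, sub_re, add_re, mul_re, sub_im, add_im, mul_im, zero_re, zero_im] at hre him
  simp only [normSq_apply] at hpos
  have hAB : lor A B = 0 := by simp only [lor, hA, hB]; linarith
  have hAA : lor A A = lor B B := by simp only [lor, hA, hB]; linarith
  have hA0 : 0 < lor A A := by simp only [lor, hA, hB] at hAA ⊢; linarith
  have hk0 : k ≠ 0 := by
    rintro rfl
    rw [hAA, hk] at hA0
    simp at hA0
  have hAv : lor A v = 0 := by
    rw [hk, lor_smul_right] at hAB
    refine (mul_eq_zero.mp hAB).resolve_left (neg_ne_zero.mpr (div_ne_zero ?_ ?_))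
    · exact_mod_cast hk0
    · exact Real.two_pi_pos.ne'
  have hα : 0 < √(lor A A) := Real.sqrt_pos.mpr hA0
  have hunit : ∀ x : L3, 0 < lor x x → lor ((√(lor x x))⁻¹ • x) ((√(lor x x))⁻¹ • x) = 1 := by
    intro x hx
    rw [lor_smul_left, lor_smul_right, ← mul_assoc, ← mul_inv, Real.mul_self_sqrt hx.le,
      inv_mul_cancel₀ hx.ne']
  refine ⟨k, √(lor A A), -((√(lor A A))⁻¹ • A), _, hk0, hα,
    LorFrame.of_spacelike (hunit v hv) ?_ ?_, fun ζ => ?_⟩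
  · rw [lor_neg_left, lor_neg_right, neg_neg]; exact hunit A hA0
  · rw [lor_neg_right, lor_smul_left, lor_smul_right, lor_comm v A, hAv]; simp
  · rw [hlin, hk, smul_neg, ← neg_smul, smul_smul, smul_smul, sub_eq_add_neg, ← neg_smul]
    congr 2
    · field_simp
    · ring

/-- A smooth function of `z` which is `z` to first order at the origin has a local inverse. -/
theorem exists_local_inverse {Z : ℂ → ℂ} (hZ : ContDiffAt ℝ 1 Z 0) (hZ0 : Z 0 = 0)
    (hZd : HasFDerivAt Z (ContinuousLinearMap.id ℝ ℂ) 0) {ρ : ℝ} (hρ : 0 < ρ) :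
    ∃ (ε : ℝ) (G : ℂ → ℂ), 0 < ε ∧ ContinuousOn G (ball 0 ε) ∧ G 0 = 0 ∧
      (∀ y ∈ ball (0 : ℂ) ε, G y ∈ ball (0 : ℂ) ρ ∧ Z (G y) = y) ∧
      ∀ ε' > 0, ∃ r' > 0, ∀ z ∈ ball (0 : ℂ) r', Z z ∈ ball (0 : ℂ) ε' ∧ G (Z z) = z := by
  have hs : HasStrictFDerivAt Z ((ContinuousLinearEquiv.refl ℝ ℂ : ℂ ≃L[ℝ] ℂ) : ℂ →L[ℝ] ℂ) 0 :=
    hZ.hasStrictFDerivAt' hZd (by simp)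
  set E := hs.toOpenPartialHomeomorph Z with hE
  have hEZ : ∀ z, E z = Z z := fun z => rfl
  have h0s : (0 : ℂ) ∈ E.source := hs.mem_toOpenPartialHomeomorph_source
  have h0t : (0 : ℂ) ∈ E.target := by
    have := E.map_source h0s
    rwa [hEZ, hZ0] at this
  have hG0 : E.symm 0 = 0 := by
    have := E.left_inv h0s
    rwa [hEZ, hZ0] at this
  have hcont : ContinuousAt E.symm 0 := E.continuousAt_symm h0t
  obtain ⟨ε, hε, hεs⟩ := Metric.mem_nhds_iff.mp (Filter.inter_mem (E.open_target.mem_nhds h0t)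
    (hcont (by rw [hG0]; exact ball_mem_nhds 0 hρ)))
  refine ⟨ε, E.symm, hε, E.continuousOn_symm.mono fun y hy => (hεs hy).1, hG0,
    fun y hy => ⟨(hεs hy).2, E.right_inv (hεs hy).1⟩, fun ε' hε' => ?_⟩
  have hZc : ContinuousAt Z 0 := hZ.continuousAt
  obtain ⟨r', hr', hrs⟩ := Metric.mem_nhds_iff.mp (Filter.inter_mem (E.open_source.mem_nhds h0s)
    (hZc (by rw [hZ0]; exact ball_mem_nhds 0 hε')))
  exact ⟨r', hr', fun z hz => ⟨(hrs hz).2, E.left_inv (hrs hz).1⟩⟩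

/-- At a puncture where the holomorphic form has simple poles the surface is asymptotic to a half
cylinder: the remainder `R` is absorbed by a change of the parameter, except for its normal part
`-⟨R, n⟩`, which becomes the function whose graph is the surface. -/
theorem asymptotic_of_expansion {N : Type*} [TopologicalSpace N] {ι : M → N} {P : N}
    (hv : 0 < lor v v) {r ρ : ℝ} (hρ : 0 < ρ) (hρr : ρ ≤ r) {R : ℂ → L3} {x₀ : L3}
    (hR0 : R 0 = 0) (hR : ContDiffAt ℝ ∞ R 0) {c : Fin 3 → ℂ}
    (hX : ∀ ζ : ℂ, exp ζ ∈ ball 0 ρ →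
      X (ψ (exp ζ)) = toQuo v (x₀ + ((fun j => (c j * ζ).re) + R (exp ζ))))
    (hnull : c 0 ^ 2 + c 1 ^ 2 - c 2 ^ 2 = 0)
    (hpos : 0 < normSq (c 0) + normSq (c 1) - normSq (c 2))
    (hψc : ContinuousOn ψ (puncturedDisc r)) (hψi : InjOn ψ (puncturedDisc r))
    (hlim : Filter.Tendsto (ι ∘ ψ) (𝓝[≠] 0) (𝓝 P))
    (hnh : ∀ r' > 0, insert P ((ι ∘ ψ) '' puncturedDisc r') ∈ 𝓝 P) :
    ∃ (C : Set (Quo v)) (w : ℕ), 1 ≤ w ∧ AsymptoticWithMultiplicity v X ι P C w := by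
  obtain ⟨k, α, e, n, hk, hα, hf, hlin⟩ := exists_residue_eq hv hρ (Y := X ∘ ψ) hX hnull hpos
  have hπ := Real.pi_pos
  have hkR : (k : ℝ) ≠ 0 := by exact_mod_cast hk
  have hsv : √(lor v v) ≠ 0 := (Real.sqrt_pos.mpr hv).ne'
  -- The multiplicity is `|k|`; the sign `j₀` of `k` is the direction of rotation around the end.
  obtain ⟨j₀, hj₀, hkw⟩ : ∃ j₀ : ℤ, j₀ * j₀ = 1 ∧ k = j₀ * k.natAbs := by
    rcases Int.natAbs_eq k with h | h
    · exact ⟨1, rfl, by omega⟩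
    · exact ⟨-1, rfl, by omega⟩
  -- The new coordinate `z exp (m z)` absorbs the tangential part of the remainder.
  set m : ℂ → ℂ := fun z => ((-lor (R z) e / α : ℝ) : ℂ)
    + ((2 * Real.pi / k * (lor (R z) v / lor v v) : ℝ) : ℂ) * I with hm
  have hlsm : ∀ y : L3, ContDiffAt ℝ ∞ (fun z => lor (R z) y) 0 := fun y => by
    have := (lorL y).contDiff.contDiffAt.comp 0 hR
    exact this.congr_of_eventuallyEq (Filter.Eventually.of_forall fun z => by simp)
  have hmsm : ContDiffAt ℝ ∞ m 0 :=
    (ofRealCLM.contDiff.contDiffAt.comp 0 ((hlsm e).neg.div_const α)).add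
      ((ofRealCLM.contDiff.contDiffAt.comp 0
        (contDiffAt_const.mul ((hlsm v).div_const (lor v v)))).mul contDiffAt_const)
  have hm0 : m 0 = 0 := by simp [hm, hR0]
  set Z : ℂ → ℂ := fun z => z * exp (m z) with hZ
  have hZ0 : Z 0 = 0 := by simp [hZ]
  have hesm : ContDiffAt ℝ ∞ (fun z => exp (m z)) 0 := hmsm.cexp
  have hZsm : ContDiffAt ℝ ∞ Z 0 := contDiffAt_id.mul hesm
  have hZd : HasFDerivAt Z (ContinuousLinearMap.id ℝ ℂ) 0 := by
    have h1 := (hasFDerivAt_id (𝕜 := ℝ) (0 : ℂ)).mul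
      (hesm.differentiableAt (by simp)).hasFDerivAt
    refine h1.congr_fderiv ?_
    ext u; simp [hm0]
  obtain ⟨ε, G, hε, hGc, hG0, hGr, hGn⟩ :=
    exists_local_inverse (hZsm.of_le (by simp)) hZ0 hZd hρ
  -- The point `(s, t)` of the half cylinder has the logarithmic coordinate `Λ (s, t)`; the shift `t₁`
  -- places `t ≥ 0` in the domain of the local inverse.
  set t₁ : ℝ := -α * Real.log (ε / 2) with ht₁
  obtain ⟨Λ, hΛ⟩ : ∃ Λ : ℝ × ℝ → ℂ, Λ = fun q =>
      ((-(q.2 + t₁) / α : ℝ) : ℂ) + ((2 * Real.pi * q.1 / k : ℝ) : ℂ) * I := ⟨_, rfl⟩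
  have hΛre : ∀ q, (Λ q).re = -(q.2 + t₁) / α := fun q => by simp [hΛ]
  have hΛim : ∀ q, (Λ q).im = 2 * Real.pi * q.1 / k := fun q => by
    simp only [hΛ, add_im, ofReal_im, mul_im, ofReal_re, I_im, I_re]; ring
  have hΛc : Continuous Λ := by
    rw [hΛ]; fun_prop
  have hΛb : ∀ q : ℝ × ℝ, 0 ≤ q.2 → exp (Λ q) ∈ ball (0 : ℂ) ε := by
    intro q hq
    rw [mem_ball_zero_iff, norm_exp, hΛre]
    refine lt_of_le_of_lt (Real.exp_le_exp.mpr ?_)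
      ((Real.exp_log (half_pos hε)).trans_lt (half_lt_self hε))
    rw [div_le_iff₀ hα, ht₁]
    linarith
  have hz0 : ∀ q : ℝ × ℝ, 0 ≤ q.2 → G (exp (Λ q)) ≠ 0 := by
    intro q hq h0
    have h1 := (hGr _ (hΛb q hq)).2
    rw [h0, hZ0] at h1
    exact exp_ne_zero _ h1.symm
  have hzb : ∀ q : ℝ × ℝ, 0 ≤ q.2 → G (exp (Λ q)) ∈ puncturedDisc r := fun q hq =>
    ⟨norm_pos_iff.mpr (hz0 q hq),
      (mem_ball_zero_iff.mp (hGr _ (hΛb q hq)).1).trans_le hρr⟩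
  have hΛtop : Filter.Tendsto (fun q => exp (Λ q)) (Filter.comap Prod.snd Filter.atTop)
      (𝓝 0) := by
    rw [tendsto_zero_iff_norm_tendsto_zero]
    simp only [norm_exp, hΛre]
    refine Real.tendsto_exp_atBot.comp ?_
    have h1 : Filter.Tendsto (fun t : ℝ => -(t + t₁) / α) Filter.atTop Filter.atBot :=
      Filter.Tendsto.atBot_div_const hα (Filter.tendsto_neg_atTop_atBot.comp
        (Filter.tendsto_atTop_add_const_right _ _ Filter.tendsto_id))
    exact h1.comp Filter.tendsto_comap
  have hGat : ContinuousAt G 0 := hGc.continuousAt (ball_mem_nhds 0 hε)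
  have hztop : Filter.Tendsto (fun q => G (exp (Λ q))) (Filter.comap Prod.snd Filter.atTop)
      (𝓝 0) := by
    have h1 := hGat.tendsto.comp hΛtop
    rwa [hG0] at h1
  have hev : ∀ᶠ q : ℝ × ℝ in Filter.comap Prod.snd Filter.atTop, 0 ≤ q.2 :=
    ⟨Ici 0, Filter.Ici_mem_atTop 0, fun q hq => hq⟩
  refine ⟨halfCylinder v (x₀ + t₁ • e) e, k.natAbs, Int.natAbs_pos.mpr hk, x₀ + t₁ • e, e, n,
    fun q => ψ (G (exp (Λ q))), fun q => -lor (R (G (exp (Λ q)))) n,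
    ⟨rfl, hv, hf.bb, ?_, hf.nn, ?_, ?_⟩, ?_, ?_, ?_, ?_, ?_, ?_⟩
  · have h1 := hf.ab
    rw [lor_smul_left] at h1
    rw [lor_comm]
    exact (mul_eq_zero.mp h1).resolve_left (inv_ne_zero hsv)
  · have h1 := hf.an
    rw [lor_smul_left] at h1
    rw [lor_comm]
    exact (mul_eq_zero.mp h1).resolve_left (inv_ne_zero hsv)
  · rw [lor_comm]; exact hf.bn
  · exact hψc.comp (hGc.comp (continuous_exp.comp hΛc).continuousOn hΛb) hzb
  · intro q q' hq hq'
    have h1 : ψ (G (exp (Λ q))) = ψ (G (exp (Λ q'))) ↔ exp (Λ q) = exp (Λ q') := by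
      refine ⟨fun h => ?_, fun h => by rw [h]⟩
      have h2 := hψi (hzb q hq) (hzb q' hq') h
      rw [← (hGr _ (hΛb q hq)).2, ← (hGr _ (hΛb q' hq')).2, h2]
    have hkw' : (k : ℝ) = j₀ * (k.natAbs : ℝ) :=
      (congrArg (fun x : ℤ => (x : ℝ)) hkw).trans (by rw [Int.cast_mul, Int.cast_natCast])
    have hj₀' : (j₀ : ℝ) * j₀ = 1 := by exact_mod_cast hj₀
    show ψ (G (exp (Λ q))) = ψ (G (exp (Λ q'))) ↔ _
    rw [h1, exp_eq_exp_iff_exists_int]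
    constructor
    · rintro ⟨j, hj⟩
      have hre := congrArg re hj
      have him := congrArg im hj
      rw [add_re, hΛre, hΛre] at hre
      rw [add_im, hΛim, hΛim] at him
      simp at hre him
      have h2 : q.1 = q'.1 + j * k := by
        field_simp at him
        linarith
      refine ⟨?_, -j * j₀, ?_⟩
      · rw [div_left_inj' hα.ne'] at hre
        linarith
      · push_cast
        rw [h2, hkw']; ring
    · rintro ⟨h2, j, hj⟩
      refine ⟨-j * j₀, ?_⟩
      apply Complex.ext
      · rw [add_re, hΛre, hΛre, h2]; simp
      · rw [add_im, hΛim, hΛim, hj]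
        have h3 : (j : ℝ) * k.natAbs = j * j₀ * k := by
          rw [hkw']; linear_combination (-j * (k.natAbs : ℝ)) * hj₀'
        rw [h3]
        simp
        field_simp
        ring
  · obtain ⟨r', hr', hrs⟩ := hGn (ε / 2) (half_pos hε)
    refine Filter.mem_of_superset (hnh r' hr') (insert_subset_insert ?_)
    rintro _ ⟨z, hz, rfl⟩
    obtain ⟨h1, h2⟩ := hrs z (mem_ball_zero_iff.mpr hz.2)
    have hZz : Z z ≠ 0 := mul_ne_zero (norm_pos_iff.mp hz.1) (exp_ne_zero _)
    have hΛz : Λ (k / (2 * Real.pi) * arg (Z z), -α * Real.log ‖Z z‖ - t₁) = log (Z z) := by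
      apply Complex.ext
      · rw [hΛre, log_re]; field_simp; ring
      · rw [hΛim, log_im]; field_simp
    refine ⟨(k / (2 * Real.pi) * arg (Z z), -α * Real.log ‖Z z‖ - t₁), ?_, ?_⟩
    · have h3 := Real.log_le_log (norm_pos_iff.mpr hZz) (mem_ball_zero_iff.mp h1).le
      have h4 := mul_le_mul_of_nonneg_left h3 hα.le
      show 0 ≤ -α * Real.log ‖Z z‖ - t₁
      rw [ht₁]; linarith
    · show ι (ψ (G (exp (Λ _)))) = ι (ψ z)
      rw [hΛz, exp_log hZz, h2]
  · exact hlim.comp (tendsto_nhdsWithin_iff.mpr ⟨hztop, hev.mono fun q hq => hz0 q hq⟩)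
  · intro q hq
    set z := G (exp (Λ q)) with hz
    have hZz : z * exp (m z) = exp (Λ q) := (hGr _ (hΛb q hq)).2
    have hzexp : exp (Λ q - m z) = z := by
      rw [exp_sub, ← hZz, mul_div_cancel_right₀ _ (exp_ne_zero _)]
    have h1 := hX (Λ q - m z) (by rw [hzexp]; exact (hGr _ (hΛb q hq)).1)
    rw [hzexp, hlin] at h1
    show X (ψ z) = _
    rw [h1]
    congr 1
    have hre : (Λ q - m z).re = -(q.2 + t₁) / α + lor (R z) e / α := by
      rw [sub_re, hΛre]; simp [hm]; ring
    have him : (Λ q - m z).im = 2 * Real.pi * q.1 / k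
        - 2 * Real.pi / k * (lor (R z) v / lor v v) := by
      rw [sub_im, hΛim]
      simp only [hm, add_im, ofReal_im, mul_im, ofReal_re, I_im, I_re]; ring
    have hcoe : -α * (-(q.2 + t₁) / α + lor (R z) e / α) = q.2 + t₁ - lor (R z) e := by
      field_simp; ring
    have hcov : k / (2 * Real.pi) * (2 * Real.pi * q.1 / k
        - 2 * Real.pi / k * (lor (R z) v / lor v v)) = q.1 - lor (R z) v / lor v v := by
      field_simp
    have hexp := hf.expand (R z)
    have hvv : lor (R z) ((√(lor v v))⁻¹ • v) • ((√(lor v v))⁻¹ • v) =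
        (lor (R z) v / lor v v) • v := by
      rw [lor_smul_right, smul_smul]
      congr 1
      rw [mul_right_comm, ← mul_inv, Real.mul_self_sqrt hv.le]
      ring
    rw [hvv] at hexp
    rw [hre, him, hcoe, hcov]
    change _ = x₀ + t₁ • e + q.1 • v + q.2 • e + (-lor (R z) n) • n
    generalize lor (R z) v / lor v v = pv at hexp ⊢
    generalize lor (R z) e = pe at hexp ⊢
    generalize lor (R z) n = pn at hexp ⊢
    rw [hexp]
    simp only [sub_smul, add_smul, neg_smul]
    abel
  · have h1 : ContinuousAt (fun z => -lor (R z) n) 0 := (hlsm n).continuousAt.neg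
    have h2 : Filter.Tendsto (fun q => -lor (R (G (exp (Λ q)))) n)
      (Filter.comap Prod.snd Filter.atTop) (𝓝 (-lor (R 0) n)) := h1.tendsto.comp hztop
    rwa [hR0, lor_zero_left, neg_zero] at h2

end Asymptotics

open Set Complex Metric

section Ends

variable {M : Type*} [TopologicalSpace M] [ChartedSpace E2 M] {v a b n : L3} {X : M → Quo v}
  {F : Set M}

/-- Changing the orientation of the second axis. -/
theorem EntireData.neg (D : EntireData v X F a b n) (hn : lor n n = -1)
    (hb : IsBranchedCovering (orthProj n hn ∘ liftMap v X)) : EntireData v X F a (-b) n :=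
  { D with
    frame := D.frame.neg
    orth := by simp [D.orth]
    branched := hb.liftProj D.frame.neg hn }

omit [TopologicalSpace M] [ChartedSpace E2 M] in
theorem quoCoord_neg (hb : lor v b = 0) (hb' : lor v (-b) = 0) (y : Quo v) :
    quoCoord v (-b) hb' y = -quoCoord v b hb y := by
  obtain ⟨x, rfl⟩ := QuotientAddGroup.mk_surjective y
  exact (quoCoord_toQuo hb' x).trans ((lor_neg_right _ _).trans (congrArg _ (quoCoord_toQuo hb x).symm))

variable {N : Type*} [TopologicalSpace N] [T2Space N] [CompactSpace N] [ChartedSpace E2 N]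
  [T2Space M] {ι : M → N} {P : N}

/-- The behaviour of the surface at an end at which the coordinate `⟨·, b⟩` tends to `+∞`. -/
theorem EntireData.end_behaviour (D : EntireData v X F a b n) (hv : 0 < lor v v)
    (hι : IsEndCompactification ι)
    (htop : Filter.Tendsto (fun p => quoCoord v b D.orth (X p)) (Filter.comap ι (𝓝 P))
      Filter.atTop) :
    (∃ (r : ℝ) (ψ : ℂ → M) (g φ₃ η : ℂ → ℂ), IsConformalEnd v X F ι P r ψ g φ₃ η) ∧
    (∀ (r : ℝ) (ψ : ℂ → M) (g φ₃ η : ℂ → ℂ),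
      IsConformalEnd v X F ι P r ψ g φ₃ η → HasSimplePole η) ∧
    (∃ (C : Set (Quo v)) (w : ℕ), 1 ≤ w ∧ AsymptoticWithMultiplicity v X ι P C w) := by
  have hbb : 0 < lor b b := by rw [D.frame.bb]; exact one_pos
  have htop' : ∀ {ψ : ℂ → M}, Filter.Tendsto (ι ∘ ψ) (𝓝[≠] 0) (𝓝 P) →
      Filter.Tendsto (fun z => quoCoord v b D.orth (X (ψ z))) (𝓝[≠] 0) Filter.atTop :=
    fun h => htop.comp (Filter.tendsto_comap_iff.mpr h)
  obtain ⟨r, ψ, g, φ₃, η, hE, hnh⟩ := D.exists_isConformalEnd hι htop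
  refine ⟨⟨r, ψ, g, φ₃, η, hE⟩, fun r ψ g φ₃ η hE => ?_, ?_⟩
  · obtain ⟨H, hI⟩ := hE.isothermal
    obtain ⟨Φ, hΦ⟩ := hI.exists_form D.ne_zero D.frame D.maximalAt
    exact (hE.data.exists_residue hE.pos hΦ D.orth hbb (htop' hE.tendsto)).1
  · obtain ⟨H, hI⟩ := hE.isothermal
    obtain ⟨Φ, hΦ⟩ := hI.exists_form D.ne_zero D.frame D.maximalAt
    obtain ⟨-, V, hV, hΦV, hnull, hpos⟩ :=
      hE.data.exists_residue hE.pos hΦ D.orth hbb (htop' hE.tendsto)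
    obtain ⟨ρ, R, x₀, hρ, hρr, hR0, hR, hexp⟩ := hΦ.exists_expansion hE.pos hV hΦV
    exact asymptotic_of_expansion hv hρ hρr hR0 hR hexp hnull hpos hI.continuousOn hI.injOn
      hE.tendsto hnh

end Ends
end

end MaxSurf

theorem mainTheorem8 {M : Type*} [TopologicalSpace M] [ConnectedSpace M]
    [ChartedSpace MaxSurf.E2 M] [IsManifold (𝓡 2) ∞ M]
    {N : Type*} [TopologicalSpace N] [T2Space N] [CompactSpace N] [ChartedSpace MaxSurf.E2 N]
    (ι : M → N) (hι : MaxSurf.IsEndCompactification ι)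
    (v : MaxSurf.L3) (hv : 0 < MaxSurf.lor v v)
    (X : C(M, MaxSurf.Quo v)) (F : Set M)
    (hX : MaxSurf.IsMaximalWithSingularities v X F)
    (hsurj : ∀ p : M, Function.Surjective (FundamentalGroup.map X p))
    (hentire : MaxSurf.IsEntire v X)
    (hfinite : F.Finite) (hsheets : MaxSurf.FinitelySheeted v X) :
    ∀ P : N, P ∉ Set.range ι →
      (∃ (r : ℝ) (ψ : ℂ → M) (g φ₃ η : ℂ → ℂ),
        MaxSurf.IsConformalEnd v X F ι P r ψ g φ₃ η) ∧
      (∀ (r : ℝ) (ψ : ℂ → M) (g φ₃ η : ℂ → ℂ),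
        MaxSurf.IsConformalEnd v X F ι P r ψ g φ₃ η → MaxSurf.HasSimplePole η) ∧
      (∃ (C : Set (MaxSurf.Quo v)) (w : ℕ), 1 ≤ w ∧
        MaxSurf.AsymptoticWithMultiplicity v X ι P C w) := by
  intro P hP
  have : T2Space M := hι.isOpenEmbedding.isEmbedding.t2Space
  obtain ⟨n, hn, hb⟩ := hentire
  obtain ⟨a, b, hf, hvb, hva⟩ := MaxSurf.exists_frame hv hn
  have D : MaxSurf.EntireData v X F a b n :=
    { continuous := X.continuous
      isClosed := hX.isClosed
      finite := hfinite
      maximalAt := hX.maximalAt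
      ne_zero := MaxSurf.ne_zero_of_lor_pos hv
      frame := hf
      orth := hvb
      pos := hva
      branched := hb.liftProj hf hn
      sheeted := hsheets }
  rcases D.tendsto_atTop_or hι hP with h | h
  · exact D.end_behaviour hv hι h
  · have D' := D.neg hn hb
    refine D'.end_behaviour hv hι ?_
    simpa only [MaxSurf.quoCoord_neg D.orth D'.orth] using h
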